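/- **Setting.** Fix real $a<b$, $N\in\mathbb N$, $n=(n_0,\dots,n_N)\in\mathbb N^{N+1}$. Put $n_{\hat{\mathbf x}}=\sum_{i=0}^N n_i$, $n_{Si}=\sum_{j=i}^N n_j$, $n_S=\sum_{i=1}^N n_{Si}$, and let $W^n=\prod_{i=0}^N W_i^{n_i}[a,b]$, where $W_i$ is the $L_2$-Sobolev space of order $i$. For $\hat{\mathbf x}=\mathrm{col}(\hat{\mathbf x}_0,\dots,\hat{\mathbf x}_N)\in W^n$ let $S^i\hat{\mathbf x}=\mathrm{col}(\hat{\mathbf x}_i,\dots,\hat{\mathbf x}_N)$, $$\mathcal F\hat{\mathbf x}=\mathrm{col}(\hat{\mathbf x},\partial_sS\hat{\mathbf x},\dots,\partial_s^NS^N\hat{\mathbf x}),\quad \mathcal C\hat{\mathbf x}=\mathrm{col}(S\hat{\mathbf x},\partial_sS^2\hat{\mathbf x},\dots,\partial_s^{N-1}S^N\hat{\mathbf x}),\quad \mathcal B\hat{\mathbf x}=\begin{bmatrix}(\mathcal C\hat{\mathbf x})(a)\\(\mathcal C\hat{\mathbf x})(b)\end{bmatrix},\quad \mathcal D\hat{\mathbf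 x}=\mathrm{col}(\hat{\mathbf x}_0,\partial_s\hat{\mathbf x}_1,\dots,\partial_s^N\hat{\mathbf x}_N).$$ Write $\mathbb RL_2^{m,p}=\mathbb R^m\times L_2^p[a,b]$. $L_{2e}$ denotes the functions on $[0,\infty)$ that are square integrable on every $[0,T]$, and $W_{1e}$ the continuous functions on $[0,\infty)$ that are in $W_1[0,T]$ for every $T$. **GPDE.** The parameters are real matrices $A,B_{xw},B_{xu},B_{xr},C_z,D_{zw},D_{zu},D_{zr},C_y,D_{yw},D_{yu},D_{yr},C_v,D_{vw},D_{vu}$; boundary parameters $B\in\mathbb R^{n_{BC}\times 2n_S}$, $B_v\in\mathbb R^{n_{BC}\times n_v}$, $B_I\in L_2([a,b];\mathbb R^{n_{BC}\times(n_S+n_{\hat{\mathbf x}})})$; and essentially bounded $A_0(s),A_1(s,\theta),A_2(s,\theta),B_{xv}(s),B_{xb}(s),C_r(s)$ with a matrix $D_{rb}$. Let $$X_v=\Big\{\hat{\mathbf x}\in W^n:\int_a^bB_I\,\mathcal F\hat{\mathbf x}\,ds+B_vv-B\,\mathcal B\hat{\mathbf x}=0\Big\},\qquad \mathcal X_{w,u}=\{(x,\hat{\mathbf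 x}):\hat{\mathbf x}\in X_{C_vx+D_{vw}w+D_{vu}u}\}.$$ Let $w,u\in L_{2e}$ with $B_vD_{vw}w,\ B_vD_{vu}u\in W_{1e}$. $\{x,\hat{\mathbf x},z,y,v,r\}$ *satisfies the GPDE* with initial condition $(x^0,\hat{\mathbf x}^0)\in\mathcal X_{w(0),u(0)}$ and input $\{w,u\}$ if $z,y,v,r\in L_{2e}$; $(x(t),\hat{\mathbf x}(t))\in\mathcal X_{w(t),u(t)}$ for all $t\ge0$; $(x(0),\hat{\mathbf x}(0))=(x^0,\hat{\mathbf x}^0)$; $x$ is differentiable and $\hat{\mathbf x}$ is Fréchet differentiable in the $L_2$-norm at almost every $t$; and for almost every $t\ge 0$ $$\dot x=Ax+B_{xw}w+B_{xu}u+B_{xr}r,\quad z=C_zx+D_{zw}w+D_{zu}u+D_{zr}r,\quad y=C_yx+D_{yw}w+D_{yu}u+D_{yr}r,\quad v=C_vx+D_{vw}w+D_{vu}u,$$ $$\dot{\hat{\mathbf x}}(s)=A_0(s)(\mathcal F\hat{\mathbf x})(s)+B_{xv}(s)v+B_{xb}(s)\mathcal B\hat{\mathbf x}+\int_a^sA_1(s,\theta)(\mathcal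 F\hat{\mathbf x})(\theta)d\theta+\int_s^bA_2(s,\theta)(\mathcal F\hat{\mathbf x})(\theta)d\theta,$$ $$r=D_{rb}\mathcal B\hat{\mathbf x}+\int_a^bC_r\,\mathcal F\hat{\mathbf x}\,d\theta$$ (hence $\hat{\mathbf x}(t)\in X_{v(t)}$ for almost every $t$). **4-PI operators.** For parameters $K=[P,Q_1;Q_2,\{R_0,R_1,R_2\}]$ the operator is $$\mathcal P[K](u,\mathbf v)=\Big(Pu+\int_a^bQ_1\mathbf v\,d\theta,\ \ Q_2(s)u+R_0(s)\mathbf v(s)+\int_a^sR_1(s,\theta)\mathbf v(\theta)d\theta+\int_s^bR_2(s,\theta)\mathbf v(\theta)d\theta\Big).$$ The product $K'\!\circ K$, with $K'=[P',Q_1';Q_2',\{R_i'\}]$, has parameters $\hat P=P'P+\int_a^bQ_1'Q_2$, $\hat Q_1(s)=P'Q_1(s)+Q_1'(s)R_0(s)+\int_s^bQ_1'(\eta)R_1(\eta,s)d\eta+\int_a^sQ_1'(\eta)R_2(\eta,s)d\eta$, $\hat Q_2(s)=Q_2'(s)P+R_0'(s)Q_2(s)+\int_a^sR_1'(s,\eta)Q_2(\eta)d\eta+\int_s^bR_2'(s,\eta)Q_2(\eta)d\eta$,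 $\hat R_0=R_0'R_0$, $\hat R_1(s,\eta)=Q_2'(s)Q_1(\eta)+R_0'(s)R_1(s,\eta)+R_1'(s,\eta)R_0(\eta)+\int_a^\eta R_1'(s,\theta)R_2(\theta,\eta)d\theta+\int_\eta^sR_1'(s,\theta)R_1(\theta,\eta)d\theta+\int_s^bR_2'(s,\theta)R_1(\theta,\eta)d\theta$, $\hat R_2(s,\eta)=Q_2'(s)Q_1(\eta)+R_0'(s)R_2(s,\eta)+R_2'(s,\eta)R_0(\eta)+\int_a^sR_1'(s,\theta)R_2(\theta,\eta)d\theta+\int_s^\eta R_2'(s,\theta)R_2(\theta,\eta)d\theta+\int_\eta^bR_2'(s,\theta)R_1(\theta,\eta)d\theta$. **Associated PIE.** Let $\tau_i(s)=s^i/i!$. Let $T(s)$ be the block matrix with blocks $T_{i,j}(s)=\tau_{j-i}(s)\begin{bmatrix}0\\I_{n_{Sj}}\end{bmatrix}\in\mathbb R^{n_{Si}\times n_{Sj}}$ for $1\le i\le j\le N$ and $0$ for $i>j$, and $T_1$ its first block row; $Q(s)=\mathrm{col}(Q_1(s),\dots,Q_N(s))$ with $Q_i(s)=[\,0\ \ \mathrm{diag}(\tau_0(s)I_{n_i},\dots,\tau_{N-i}(s)I_{n_N})]$;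 $U_1,U_2$ the $0$-$1$ matrices with $\mathcal F\hat{\mathbf x}=U_1\mathcal D\hat{\mathbf x}+U_2\mathcal C\hat{\mathbf x}$, i.e. $U_1=\mathrm{diag}_{i=0}^{N}\begin{bmatrix}I_{n_i}\\0\end{bmatrix}$, $U_2=\begin{bmatrix}\mathrm{diag}_{i=0}^{N-1}\begin{bmatrix}0\\I_{n_{S(i+1)}}\end{bmatrix}\\0\end{bmatrix}$; $$B_T=B\begin{bmatrix}T(0)\\T(b-a)\end{bmatrix}-\int_a^bB_I(s)U_2T(s-a)ds .$$ The pair $\{n,(B,B_I,B_v)\}$ is *admissible* if $B_T$ is invertible (in particular $n_{BC}=n_S$). Then let $$B_Q(s)=B_T^{-1}\Big(B_I(s)U_1+\int_s^bB_I(\theta)U_2Q(\theta-s)d\theta-B\begin{bmatrix}0\\Q(b-s)\end{bmatrix}\Big),$$ $G_0=\begin{bmatrix}I_{n_0}&0\\0&0\end{bmatrix}$, $G_2(s,\theta)=\begin{bmatrix}0\\T_1(s-a)B_Q(\theta)\end{bmatrix}$, $G_1(s,\theta)=\begin{bmatrix}0\\Q_1(s-\theta)\end{bmatrix}+G_2(s,\theta)$,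 $G_v(s)=\begin{bmatrix}0\\T_1(s-a)B_T^{-1}B_v\end{bmatrix}$, $R_{D,2}(s,\theta)=U_2T(s-a)B_Q(\theta)$, $R_{D,1}(s,\theta)=R_{D,2}(s,\theta)+U_2Q(s-\theta)$, and $$[D_{rv},C_{rx};\hat B_{xv},\{\hat A_i\}]=\big[[0\ D_{rb}],C_r;[B_{xv}\ B_{xb}],\{A_i\}\big]\circ\left[\begin{bmatrix}I\\B_T^{-1}B_v\\T(b-a)B_T^{-1}B_v\end{bmatrix},\begin{bmatrix}0\\B_Q(s)\\T(b-a)B_Q(s)+Q(b-s)\end{bmatrix};U_2T(s-a)B_T^{-1}B_v,\{U_1,R_{D,1},R_{D,2}\}\right].$$ With $\hat{\mathcal T},\hat{\mathcal A}$ the operators on $L_2$ with kernels $\{G_i\},\{\hat A_i\}$, $\mathcal C_r\mathbf v=\int_a^bC_{rx}\mathbf v$, $\mathcal D_{rv}=D_{rv}$ and $\mathcal B_v$ multiplication by $\hat B_{xv}(s)$, the PIE parameters $\mathbf G_{PIE}$ are $$\mathcal T=\begin{bmatrix}I&0\\G_vC_v&\hat{\mathcal T}\end{bmatrix},\ \mathcal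 T_w=\begin{bmatrix}0\\G_vD_{vw}\end{bmatrix},\ \mathcal T_u=\begin{bmatrix}0\\G_vD_{vu}\end{bmatrix},\ \mathcal A=\begin{bmatrix}A+B_{xr}\mathcal D_{rv}C_v&B_{xr}\mathcal C_r\\\mathcal B_vC_v&\hat{\mathcal A}\end{bmatrix},\ \mathcal B_1=\begin{bmatrix}B_{xw}+B_{xr}\mathcal D_{rv}D_{vw}\\\mathcal B_vD_{vw}\end{bmatrix},\ \mathcal B_2=\begin{bmatrix}B_{xu}+B_{xr}\mathcal D_{rv}D_{vu}\\\mathcal B_vD_{vu}\end{bmatrix},$$ $$\mathcal C_1=[C_z+D_{zr}\mathcal D_{rv}C_v\ \ D_{zr}\mathcal C_r],\quad \mathcal C_2=[C_y+D_{yr}\mathcal D_{rv}C_v\ \ D_{yr}\mathcal C_r],$$ $$\mathcal D_{11}=D_{zw}+D_{zr}\mathcal D_{rv}D_{vw},\ \mathcal D_{12}=D_{zu}+D_{zr}\mathcal D_{rv}D_{vu},\ \mathcal D_{21}=D_{yw}+D_{yr}\mathcal D_{rv}D_{vw},\ \mathcal D_{22}=D_{yu}+D_{yr}\mathcal D_{rv}D_{vu}.$$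 $\{\underline{\mathbf x},z,y\}$ *satisfies the PIE* with initial condition $\underline{\mathbf x}^0\in\mathbb RL_2^{n_x,n_{\hat{\mathbf x}}}$ and input $\{w,u\}$ if $w,u\in L_{2e}$; $(\mathcal T_ww)(\cdot,s),(\mathcal T_uu)(\cdot,s)\in W_{1e}$ for all $s\in[a,b]$; $z,y\in L_{2e}$; $\underline{\mathbf x}(t)\in\mathbb RL_2^{n_x,n_{\hat{\mathbf x}}}$ for all $t\ge0$; $\underline{\mathbf x}(0)=\underline{\mathbf x}^0$; $\mathcal T\underline{\mathbf x}$ is Fréchet differentiable in $\mathbb RL_2$ at almost every $t$; and for almost every $t\ge 0$ $$\partial_t(\mathcal T\underline{\mathbf x})=\mathcal A\underline{\mathbf x}+\mathcal B_1w+\mathcal B_2u-\partial_t(\mathcal T_ww)-\partial_t(\mathcal T_uu),\quad z=\mathcal C_1\underline{\mathbf x}+\mathcal D_{11}w+\mathcal D_{12}u,\quad y=\mathcal C_2\underline{\mathbf x}+\mathcal D_{21}w+\mathcal D_{22}u .$$ **Theorem.** Let $\{n,(B,B_I,B_v)\}$ be admissible, $w,u\in L_{2e}$, and $B_vD_{vw}w,\,B_vD_{vu}u\in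 W_{1e}$. 1. For any $(x^0,\hat{\mathbf x}^0)\in\mathcal X_{w(0),u(0)}$: if $\{x,\hat{\mathbf x},z,y,v,r\}$ satisfies the GPDE with initial condition $(x^0,\hat{\mathbf x}^0)$ and input $\{w,u\}$, then $\left\{\begin{bmatrix}x\\\mathcal D\hat{\mathbf x}\end{bmatrix},z,y\right\}$ satisfies the PIE with initial condition $\begin{bmatrix}x^0\\\mathcal D\hat{\mathbf x}^0\end{bmatrix}$ and input $\{w,u\}$. 2. For any $\underline{\mathbf x}^0\in\mathbb RL_2^{n_x,n_{\hat{\mathbf x}}}$: if $\{\underline{\mathbf x},z,y\}$ satisfies the PIE with initial condition $\underline{\mathbf x}^0$ and input $\{w,u\}$, let $$\begin{bmatrix}x(t)\\\hat{\mathbf x}(t)\end{bmatrix}=\mathcal T\underline{\mathbf x}(t)+\mathcal T_ww(t)+\mathcal T_uu(t),\quad v(t)=C_vx(t)+D_{vw}w(t)+D_{vu}u(t),\quad r(t)=[0\ \ \mathcal C_r]\,\underline{\mathbf x}(t)+\mathcal D_{rv}v(t).$$ Then $\{x,\hat{\mathbf x},z,y,v,r\}$ meets all the requirements of the GPDE with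 initial condition $\mathcal T\underline{\mathbf x}^0+\mathcal T_ww(0)+\mathcal T_uu(0)$ and input $\{w,u\}$ other than $v,r\in L_{2e}$. Hence it satisfies the GPDE if $v,r\in L_{2e}$. In particular, it satisfies the GPDE whenever $\underline{\mathbf x}$ is square integrable on $[0,T]$ as an $\mathbb RL_2$-valued function (jointly measurable in $(t,s)$) for every $T$. -/

import Mathlib

open MeasureTheory Set Filter Topology Matrix
open scoped ContDiff

namespace GPDE

/-! ### Function spaces on a bounded interval and on the half line -/

/-- `L₂ⁿ[a,b]`: every component is square integrable on `[a,b]`. -/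
def MemL2 {ι : Type} (a b : ℝ) (f : ℝ → ι → ℝ) : Prop :=
  ∀ i, MemLp (fun s => f s i) 2 (volume.restrict (Icc a b))

/-- `g` is the `j`-th order weak derivative of `u` on `(a,b)`. -/
def IsWeakDeriv (a b : ℝ) (j : ℕ) (u g : ℝ → ℝ) : Prop :=
  ∀ φ : ℝ → ℝ, ContDiff ℝ ∞ φ → HasCompactSupport φ → tsupport φ ⊆ Ioo a b →
    ∫ s in a..b, u s * iteratedDeriv j φ s = (-1) ^ j * ∫ s in a..b, g s * φ s

/-- `u` lies in the Sobolev space `W_k[a,b]`: `u` and its weak derivatives of order `≤ k` are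
square integrable on `[a,b]`. -/
def MemW (a b : ℝ) (k : ℕ) (u : ℝ → ℝ) : Prop :=
  MemLp u 2 (volume.restrict (Icc a b)) ∧
    ∀ l ≤ k, ∃ g : ℝ → ℝ, MemLp g 2 (volume.restrict (Icc a b)) ∧ IsWeakDeriv a b l u g

open Classical in
/-- The `j`-th weak derivative `∂ₛʲ u ∈ L₂[a,b]` (unique almost everywhere on `[a,b]`); it is `0`
when there is none. -/
noncomputable def wD (a b : ℝ) (j : ℕ) (u : ℝ → ℝ) : ℝ → ℝ :=
  if h : ∃ g : ℝ → ℝ, MemLp g 2 (volume.restrict (Icc a b)) ∧ IsWeakDeriv a b j u g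
  then h.choose else 0

open Classical in
/-- The continuous representative of `u` on `[a,b]` (unique on `[a,b]` when `a < b`); it is `0`
when there is none. -/
noncomputable def contRep (a b : ℝ) (u : ℝ → ℝ) : ℝ → ℝ :=
  if h : ∃ g : ℝ → ℝ, ContinuousOn g (Icc a b) ∧ u =ᵐ[volume.restrict (Icc a b)] g
  then h.choose else 0

/-- `L_{2e}[ℝ₊]`: square integrable on `[0,T]` for every `T`. -/
def MemL2e {ι : Type} (f : ℝ → ι → ℝ) : Prop :=
  ∀ T : ℝ, 0 ≤ T → MemL2 0 T f

/-- `W_{1e}[ℝ₊]`: each component is the continuous representative of a function that is in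
`W_1[0,T]` for every `T`. -/
def MemW1e {ι : Type} (f : ℝ → ι → ℝ) : Prop :=
  ∀ i, ContinuousOn (fun t => f t i) (Ici 0) ∧ ∀ T : ℝ, 0 < T → MemW 0 T 1 (fun t => f t i)

/-- The space `ℝL₂^{κ,ι}[a,b] = ℝ^κ × L₂^ι[a,b]` has elements of this type; two of them are the
same element if they agree almost everywhere on `[a,b]`. -/
abbrev RL2 (κ ι : Type) : Type := (κ → ℝ) × (ℝ → ι → ℝ)

def MemRL2 {κ ι : Type} (a b : ℝ) (x : RL2 κ ι) : Prop := MemL2 a b x.2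

/-- Equality of two elements of `ℝL₂`. -/
def EqRL2 {κ ι : Type} (a b : ℝ) (x y : RL2 κ ι) : Prop :=
  x.1 = y.1 ∧ x.2 =ᵐ[volume.restrict (Icc a b)] y.2

/-- `F' ∈ L₂[a,b]` is the Fréchet derivative of `τ ↦ F τ` at `t` with respect to the `L₂`-norm. -/
def HasL2DerivAt {ι : Type} (a b : ℝ) (F : ℝ → ℝ → ι → ℝ) (F' : ℝ → ι → ℝ) (t : ℝ) : Prop :=
  MemL2 a b F' ∧ ∀ i,
    Tendsto (fun h : ℝ => eLpNorm (fun s => h⁻¹ * (F (t + h) s i - F t s i) - F' s i) 2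
      (volume.restrict (Icc a b))) (𝓝[≠] 0) (𝓝 0)

/-- `F' ∈ ℝL₂` is the Fréchet derivative of `τ ↦ F τ` at `t` with respect to the `ℝL₂`-norm. -/
def HasRL2DerivAt {κ ι : Type} [Fintype κ] (a b : ℝ) (F : ℝ → RL2 κ ι) (F' : RL2 κ ι) (t : ℝ) :
    Prop :=
  HasDerivAt (fun τ => (F τ).1) F'.1 t ∧ HasL2DerivAt a b (fun τ => (F τ).2) F'.2 t

/-- `x ∈ L_{2e}[ℝ₊; ℝL₂]` for an `ℝL₂`-valued function of time. -/
def MemL2eRL2 {κ ι : Type} (a b : ℝ) (x : ℝ → RL2 κ ι) : Prop :=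
  MemL2e (fun t => (x t).1) ∧ ∀ T : ℝ, 0 ≤ T → ∀ i,
    MemLp (fun p : ℝ × ℝ => (x p.1).2 p.2 i) 2
      ((volume.restrict (Icc 0 T)).prod (volume.restrict (Icc a b)))

/-! ### 4-PI operators -/

/-- Parameters `[P, Q₁; Q₂, {R₀,R₁,R₂}]` of a 4-PI operator from `ℝL₂^{n,q}` to `ℝL₂^{m,p}`. -/
structure PI4 (m n p q : Type) where
  P : Matrix m n ℝ
  Q1 : ℝ → Matrix m q ℝ
  Q2 : ℝ → Matrix p n ℝ
  R0 : ℝ → Matrix p q ℝ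
  R1 : ℝ → ℝ → Matrix p q ℝ
  R2 : ℝ → ℝ → Matrix p q ℝ

/-- The 4-PI operator with the given parameters. -/
noncomputable def PI4.apply {m n p q : Type} [Fintype m] [Fintype n] [Fintype p] [Fintype q]
    (a b : ℝ) (K : PI4 m n p q) (x : RL2 n q) : RL2 m p :=
  (K.P *ᵥ x.1 + ∫ θ in a..b, K.Q1 θ *ᵥ x.2 θ,
   fun s => K.Q2 s *ᵥ x.1 + (K.R0 s *ᵥ x.2 s + (∫ θ in a..s, K.R1 s θ *ᵥ x.2 θ)
      + ∫ θ in s..b, K.R2 s θ *ᵥ x.2 θ))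

/-- A 4-PI operator with no distributed input, applied to a finite-dimensional vector. -/
noncomputable def PI4.applyVec {m n p : Type} [Fintype m] [Fintype n] [Fintype p]
    (a b : ℝ) (K : PI4 m n p (Fin 0)) (x : n → ℝ) : RL2 m p :=
  K.apply a b (x, 0)

/-- Entrywise integral of a matrix-valued function. -/
noncomputable def mint {m n : Type} (a b : ℝ) (F : ℝ → Matrix m n ℝ) : Matrix m n ℝ :=
  Matrix.of fun i j => ∫ s in a..b, F s i j

/-- The composition map on the parameters of 4-PI operators. -/
noncomputable def PI4.comp {m k n p l q : Type} [Fintype k] [Fintype l] (a b : ℝ)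
    (K : PI4 m k p l) (L : PI4 k n l q) : PI4 m n p q where
  P := K.P * L.P + mint a b (fun s => K.Q1 s * L.Q2 s)
  Q1 := fun s => K.P * L.Q1 s + K.Q1 s * L.R0 s
    + mint s b (fun η => K.Q1 η * L.R1 η s) + mint a s (fun η => K.Q1 η * L.R2 η s)
  Q2 := fun s => K.Q2 s * L.P + K.R0 s * L.Q2 s
    + mint a s (fun η => K.R1 s η * L.Q2 η) + mint s b (fun η => K.R2 s η * L.Q2 η)
  R0 := fun s => K.R0 s * L.R0 s
  R1 := fun s η => K.Q2 s * L.Q1 η + K.R0 s * L.R1 s η + K.R1 s η * L.R0 η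
    + mint a η (fun θ => K.R1 s θ * L.R2 θ η) + mint η s (fun θ => K.R1 s θ * L.R1 θ η)
    + mint s b (fun θ => K.R2 s θ * L.R1 θ η)
  R2 := fun s η => K.Q2 s * L.Q1 η + K.R0 s * L.R2 s η + K.R2 s η * L.R0 η
    + mint a s (fun θ => K.R1 s θ * L.R2 θ η) + mint s η (fun θ => K.R2 s θ * L.R2 θ η)
    + mint η b (fun θ => K.R2 s θ * L.R1 θ η)

/-! ### Partial integral equations -/

/-- The twelve 4-PI parameters of a PIE system with state in `ℝL₂^{nx,ι}`. -/
structure PIEParams (nx nz ny nw nu : ℕ) (ι : Type) where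
  T : PI4 (Fin nx) (Fin nx) ι ι
  Tw : PI4 (Fin nx) (Fin nw) ι (Fin 0)
  Tu : PI4 (Fin nx) (Fin nu) ι (Fin 0)
  A : PI4 (Fin nx) (Fin nx) ι ι
  B1 : PI4 (Fin nx) (Fin nw) ι (Fin 0)
  B2 : PI4 (Fin nx) (Fin nu) ι (Fin 0)
  C1 : PI4 (Fin nz) (Fin nx) (Fin 0) ι
  C2 : PI4 (Fin ny) (Fin nx) (Fin 0) ι
  D11 : PI4 (Fin nz) (Fin nw) (Fin 0) (Fin 0)
  D12 : PI4 (Fin nz) (Fin nu) (Fin 0) (Fin 0)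
  D21 : PI4 (Fin ny) (Fin nw) (Fin 0) (Fin 0)
  D22 : PI4 (Fin ny) (Fin nu) (Fin 0) (Fin 0)

/-- `{ux, z, y}` satisfies the PIE defined by `G` with initial condition `ux0` and input `{w, u}`.
Differentiability of `ux` with respect to the `T`-norm `‖T ·‖` is differentiability of `T ux`
in `ℝL₂`; the terms `T ẋ`, `T_w ẇ`, `T_u u̇` are the time derivatives of `T ux`, `T_w w`,
`T_u u`. -/
structure IsPIESolution {nx nz ny nw nu : ℕ} {ι : Type} [Fintype ι] (a b : ℝ)
    (G : PIEParams nx nz ny nw nu ι) (ux0 : RL2 (Fin nx) ι)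
    (w : ℝ → Fin nw → ℝ) (u : ℝ → Fin nu → ℝ)
    (ux : ℝ → RL2 (Fin nx) ι) (z : ℝ → Fin nz → ℝ) (y : ℝ → Fin ny → ℝ) : Prop where
  w_mem : MemL2e w
  u_mem : MemL2e u
  Tw_fin_mem : MemW1e (fun t => (G.Tw.applyVec a b (w t)).1)
  Tw_mem : ∀ s ∈ Icc a b, MemW1e (fun t => (G.Tw.applyVec a b (w t)).2 s)
  Tu_fin_mem : MemW1e (fun t => (G.Tu.applyVec a b (u t)).1)
  Tu_mem : ∀ s ∈ Icc a b, MemW1e (fun t => (G.Tu.applyVec a b (u t)).2 s)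
  init_mem : MemRL2 a b ux0
  z_mem : MemL2e z
  y_mem : MemL2e y
  state_mem : ∀ t, 0 ≤ t → MemRL2 a b (ux t)
  init : EqRL2 a b (ux 0) ux0
  dynamics : ∀ᵐ t ∂(volume.restrict (Ici (0 : ℝ))), ∃ dT dTw dTu : RL2 (Fin nx) ι,
    HasRL2DerivAt a b (fun τ => G.T.apply a b (ux τ)) dT t ∧
    HasRL2DerivAt a b (fun τ => G.Tw.applyVec a b (w τ)) dTw t ∧
    HasRL2DerivAt a b (fun τ => G.Tu.applyVec a b (u τ)) dTu t ∧
    EqRL2 a b dT (G.A.apply a b (ux t) + G.B1.applyVec a b (w t) + G.B2.applyVec a b (u t)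
      - (dTw + dTu))
  z_eq : ∀ᵐ t ∂(volume.restrict (Ici (0 : ℝ))),
    z t = (G.C1.apply a b (ux t)).1 + (G.D11.applyVec a b (w t)).1 + (G.D12.applyVec a b (u t)).1
  y_eq : ∀ᵐ t ∂(volume.restrict (Ici (0 : ℝ))),
    y t = (G.C2.apply a b (ux t)).1 + (G.D21.applyVec a b (w t)).1 + (G.D22.applyVec a b (u t)).1

/-! ### The continuity constraint -/

/-- Indices of the components of `x̂ = col(x̂₀, …, x̂_N)`, `x̂ᵢ ∈ ℝ^{nᵢ}`; there are `n_x̂` of them. -/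
abbrev XIdx {N : ℕ} (n : Fin (N + 1) → ℕ) : Type := (i : Fin (N + 1)) × Fin (n i)

/-- Indices of `ℱx̂ = col(∂ₛ⁰S⁰x̂, …, ∂ₛᴺSᴺx̂)`: the pair `(i, p)` stands for `∂ₛⁱ x̂_p`, where the
component `p` is at least `i` times differentiable; there are `n_S + n_x̂` of them. -/
abbrev FIdx {N : ℕ} (n : Fin (N + 1) → ℕ) : Type :=
  {q : Fin (N + 1) × XIdx n // (q.1 : ℕ) ≤ (q.2.1 : ℕ)}

/-- Indices of `𝒞x̂ = col(∂ₛ⁰S¹x̂, …, ∂ₛᴺ⁻¹Sᴺx̂)`: the pair `(j, p)` stands for `∂ₛʲ x̂_p`, where the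
component `p` is at least `j + 1` times differentiable; there are `n_S` of them. -/
abbrev CIdx {N : ℕ} (n : Fin (N + 1) → ℕ) : Type :=
  {q : Fin N × XIdx n // (q.1 : ℕ) + 1 ≤ (q.2.1 : ℕ)}

section Continuity

variable {N : ℕ} {n : Fin (N + 1) → ℕ}

/-- `x̂ ∈ Wⁿ[a,b]`. -/
def MemWn (a b : ℝ) (xh : ℝ → XIdx n → ℝ) : Prop :=
  ∀ p : XIdx n, MemW a b (p.1 : ℕ) (fun s => xh s p)

/-- `𝒟x̂ = col(∂ₛ⁰x̂₀, …, ∂ₛᴺx̂_N)`. -/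
noncomputable def opD (a b : ℝ) (xh : ℝ → XIdx n → ℝ) : ℝ → XIdx n → ℝ :=
  fun s p => wD a b (p.1 : ℕ) (fun θ => xh θ p) s

/-- `ℱx̂`. -/
noncomputable def opF (a b : ℝ) (xh : ℝ → XIdx n → ℝ) : ℝ → FIdx n → ℝ :=
  fun s q => wD a b (q.1.1 : ℕ) (fun θ => xh θ q.1.2) s

/-- `𝒞x̂`, a vector of (absolutely) continuous functions. -/
noncomputable def opC (a b : ℝ) (xh : ℝ → XIdx n → ℝ) : ℝ → CIdx n → ℝ :=
  fun s q => contRep a b (wD a b (q.1.1 : ℕ) (fun θ => xh θ q.1.2)) s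

/-- `ℬx̂ = col((𝒞x̂)(a), (𝒞x̂)(b))`. -/
noncomputable def opB (a b : ℝ) (xh : ℝ → XIdx n → ℝ) : CIdx n ⊕ CIdx n → ℝ :=
  Sum.elim (opC a b xh a) (opC a b xh b)

end Continuity

/-! ### Parameters of a GPDE model -/

/-- Parameters of the ODE subsystem. -/
structure OdeParams (nx nz ny nw nu nv nr : ℕ) where
  A : Matrix (Fin nx) (Fin nx) ℝ
  Bxw : Matrix (Fin nx) (Fin nw) ℝ
  Bxu : Matrix (Fin nx) (Fin nu) ℝ
  Bxr : Matrix (Fin nx) (Fin nr) ℝ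
  Cz : Matrix (Fin nz) (Fin nx) ℝ
  Dzw : Matrix (Fin nz) (Fin nw) ℝ
  Dzu : Matrix (Fin nz) (Fin nu) ℝ
  Dzr : Matrix (Fin nz) (Fin nr) ℝ
  Cy : Matrix (Fin ny) (Fin nx) ℝ
  Dyw : Matrix (Fin ny) (Fin nw) ℝ
  Dyu : Matrix (Fin ny) (Fin nu) ℝ
  Dyr : Matrix (Fin ny) (Fin nr) ℝ
  Cv : Matrix (Fin nv) (Fin nx) ℝ
  Dvw : Matrix (Fin nv) (Fin nw) ℝ
  Dvu : Matrix (Fin nv) (Fin nu) ℝ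

/-- Parameters of the boundary conditions; `B_I` is square integrable. -/
structure BcParams {N : ℕ} (n : Fin (N + 1) → ℕ) (a b : ℝ) (nBC nv : ℕ) where
  B : Matrix (Fin nBC) (CIdx n ⊕ CIdx n) ℝ
  BI : ℝ → Matrix (Fin nBC) (FIdx n) ℝ
  Bv : Matrix (Fin nBC) (Fin nv) ℝ
  BI_mem : ∀ i j, MemLp (fun s => BI s i j) 2 (volume.restrict (Icc a b))

/-- Parameters of the in-domain dynamics; all functions are essentially bounded. -/
structure PdeParams {N : ℕ} (n : Fin (N + 1) → ℕ) (a b : ℝ) (nv nr : ℕ) where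
  A0 : ℝ → Matrix (XIdx n) (FIdx n) ℝ
  A1 : ℝ → ℝ → Matrix (XIdx n) (FIdx n) ℝ
  A2 : ℝ → ℝ → Matrix (XIdx n) (FIdx n) ℝ
  Bxv : ℝ → Matrix (XIdx n) (Fin nv) ℝ
  Bxb : ℝ → Matrix (XIdx n) (CIdx n ⊕ CIdx n) ℝ
  Cr : ℝ → Matrix (Fin nr) (FIdx n) ℝ
  Drb : Matrix (Fin nr) (CIdx n ⊕ CIdx n) ℝ
  A0_mem : ∀ i j, MemLp (fun s => A0 s i j) ⊤ (volume.restrict (Icc a b))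
  A1_mem : ∀ i j, MemLp (fun p : ℝ × ℝ => A1 p.1 p.2 i j) ⊤
    ((volume.restrict (Icc a b)).prod (volume.restrict (Icc a b)))
  A2_mem : ∀ i j, MemLp (fun p : ℝ × ℝ => A2 p.1 p.2 i j) ⊤
    ((volume.restrict (Icc a b)).prod (volume.restrict (Icc a b)))
  Bxv_mem : ∀ i j, MemLp (fun s => Bxv s i j) ⊤ (volume.restrict (Icc a b))
  Bxb_mem : ∀ i j, MemLp (fun s => Bxb s i j) ⊤ (volume.restrict (Icc a b))
  Cr_mem : ∀ i j, MemLp (fun s => Cr s i j) ⊤ (volume.restrict (Icc a b))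

section Model

variable {N : ℕ} {n : Fin (N + 1) → ℕ} {a b : ℝ} {nBC nx nz ny nw nu nv nr : ℕ}

/-- The set `X_v` of states in `Wⁿ` that satisfy the boundary conditions. -/
def domX (Gb : BcParams n a b nBC nv) (v : Fin nv → ℝ) : Set (ℝ → XIdx n → ℝ) :=
  {xh | MemWn a b xh ∧
    (∫ s in a..b, Gb.BI s *ᵥ opF a b xh s) + (Gb.Bv *ᵥ v - Gb.B *ᵥ opB a b xh) = 0}

/-- The set `𝒳_{w,u}`. -/
def domXX (Go : OdeParams nx nz ny nw nu nv nr) (Gb : BcParams n a b nBC nv)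
    (w : Fin nw → ℝ) (u : Fin nu → ℝ) : Set (RL2 (Fin nx) (XIdx n)) :=
  {x | x.2 ∈ domX Gb (Go.Cv *ᵥ x.1 + Go.Dvw *ᵥ w + Go.Dvu *ᵥ u)}

/-- All the requirements on a solution `{x, x̂, z, y, v, r}` of the GPDE with initial condition
`{x0, x̂0}` and input `{w, u}`, except for `v, r ∈ L_{2e}`. -/
structure IsGPDEPresolution (Go : OdeParams nx nz ny nw nu nv nr) (Gb : BcParams n a b nBC nv)
    (Gp : PdeParams n a b nv nr) (x0 : Fin nx → ℝ) (xh0 : ℝ → XIdx n → ℝ)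
    (w : ℝ → Fin nw → ℝ) (u : ℝ → Fin nu → ℝ)
    (x : ℝ → Fin nx → ℝ) (xh : ℝ → ℝ → XIdx n → ℝ) (z : ℝ → Fin nz → ℝ) (y : ℝ → Fin ny → ℝ)
    (v : ℝ → Fin nv → ℝ) (r : ℝ → Fin nr → ℝ) : Prop where
  init_mem : (x0, xh0) ∈ domXX Go Gb (w 0) (u 0)
  w_mem : MemL2e w
  u_mem : MemL2e u
  Bw_mem : MemW1e (fun t => Gb.Bv *ᵥ (Go.Dvw *ᵥ w t))
  Bu_mem : MemW1e (fun t => Gb.Bv *ᵥ (Go.Dvu *ᵥ u t))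
  z_mem : MemL2e z
  y_mem : MemL2e y
  state_mem : ∀ t, 0 ≤ t → (x t, xh t) ∈ domXX Go Gb (w t) (u t)
  x_init : x 0 = x0
  xh_init : xh 0 =ᵐ[volume.restrict (Icc a b)] xh0
  x_dyn : ∀ᵐ t ∂(volume.restrict (Ici (0 : ℝ))),
    HasDerivAt x (Go.A *ᵥ x t + Go.Bxw *ᵥ w t + Go.Bxu *ᵥ u t + Go.Bxr *ᵥ r t) t
  z_eq : ∀ᵐ t ∂(volume.restrict (Ici (0 : ℝ))),
    z t = Go.Cz *ᵥ x t + Go.Dzw *ᵥ w t + Go.Dzu *ᵥ u t + Go.Dzr *ᵥ r t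
  y_eq : ∀ᵐ t ∂(volume.restrict (Ici (0 : ℝ))),
    y t = Go.Cy *ᵥ x t + Go.Dyw *ᵥ w t + Go.Dyu *ᵥ u t + Go.Dyr *ᵥ r t
  v_eq : ∀ᵐ t ∂(volume.restrict (Ici (0 : ℝ))),
    v t = Go.Cv *ᵥ x t + Go.Dvw *ᵥ w t + Go.Dvu *ᵥ u t
  bc : ∀ᵐ t ∂(volume.restrict (Ici (0 : ℝ))), xh t ∈ domX Gb (v t)
  xh_dyn : ∀ᵐ t ∂(volume.restrict (Ici (0 : ℝ))), ∃ d : ℝ → XIdx n → ℝ,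
    HasL2DerivAt a b xh d t ∧ ∀ᵐ s ∂(volume.restrict (Icc a b)),
      d s = Gp.A0 s *ᵥ opF a b (xh t) s + (Gp.Bxv s *ᵥ v t + Gp.Bxb s *ᵥ opB a b (xh t))
        + ((∫ θ in a..s, Gp.A1 s θ *ᵥ opF a b (xh t) θ)
          + ∫ θ in s..b, Gp.A2 s θ *ᵥ opF a b (xh t) θ)
  r_eq : ∀ᵐ t ∂(volume.restrict (Ici (0 : ℝ))),
    r t = Gp.Drb *ᵥ opB a b (xh t) + ∫ θ in a..b, Gp.Cr θ *ᵥ opF a b (xh t) θ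

/-- `{x, x̂, z, y, v, r}` satisfies the GPDE with initial condition `{x0, x̂0}` and input
`{w, u}`. -/
structure IsGPDESolution (Go : OdeParams nx nz ny nw nu nv nr) (Gb : BcParams n a b nBC nv)
    (Gp : PdeParams n a b nv nr) (x0 : Fin nx → ℝ) (xh0 : ℝ → XIdx n → ℝ)
    (w : ℝ → Fin nw → ℝ) (u : ℝ → Fin nu → ℝ)
    (x : ℝ → Fin nx → ℝ) (xh : ℝ → ℝ → XIdx n → ℝ) (z : ℝ → Fin nz → ℝ) (y : ℝ → Fin ny → ℝ)
    (v : ℝ → Fin nv → ℝ) (r : ℝ → Fin nr → ℝ) : Prop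
    extends IsGPDEPresolution Go Gb Gp x0 xh0 w u x xh z y v r where
  v_mem : MemL2e v
  r_mem : MemL2e r

end Model

/-! ### The map from GPDE parameters to PIE parameters -/

/-- `τᵢ(s) = sⁱ / i!`. -/
noncomputable def tau (i : ℕ) (s : ℝ) : ℝ := s ^ i / (i.factorial : ℝ)

/-- A two-sided inverse of a (possibly rectangular) matrix exists. -/
def IsInvertible {m k : Type} [Fintype m] [Fintype k] [DecidableEq m] [DecidableEq k]
    (M : Matrix m k ℝ) : Prop :=
  ∃ L : Matrix k m ℝ, M * L = 1 ∧ L * M = 1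

open Classical in
/-- The inverse of an invertible matrix, `0` for other matrices. -/
noncomputable def minv {m k : Type} [Fintype m] [Fintype k] [DecidableEq m] [DecidableEq k]
    (M : Matrix m k ℝ) : Matrix k m ℝ :=
  if h : IsInvertible M then h.choose else 0

section Blocks

variable {N : ℕ} (n : Fin (N + 1) → ℕ)

/-- `T(s) = (T_{i,j}(s))`, `T_{i,j} = τ_{j-i}(s) [0; I]` for `i ≤ j` and `0` otherwise. -/
noncomputable def matT (s : ℝ) : Matrix (CIdx n) (CIdx n) ℝ := Matrix.of fun c d =>
  if c.1.2 = d.1.2 ∧ c.1.1 ≤ d.1.1 then tau ((d.1.1 : ℕ) - (c.1.1 : ℕ)) s else 0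

/-- `Q(s) = col(Q₁(s), …, Q_N(s))`. -/
noncomputable def matQ (s : ℝ) : Matrix (CIdx n) (XIdx n) ℝ := Matrix.of fun c p =>
  if c.1.2 = p then tau ((p.1 : ℕ) - ((c.1.1 : ℕ) + 1)) s else 0

/-- `[0; T₁(s)]`, the first block row of `T(s)` with `n₀` rows of zeros above it. -/
noncomputable def matT1 (s : ℝ) : Matrix (XIdx n) (CIdx n) ℝ := Matrix.of fun p d =>
  if p = d.1.2 then tau (d.1.1 : ℕ) s else 0

/-- `[0; Q₁(s)]`, the first block row of `Q(s)` with `n₀` rows of zeros above it. -/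
noncomputable def matQ1 (s : ℝ) : Matrix (XIdx n) (XIdx n) ℝ := Matrix.of fun p q =>
  if p = q ∧ 1 ≤ (p.1 : ℕ) then tau ((p.1 : ℕ) - 1) s else 0

/-- `U₁ = diag(U₁₀, …, U₁ₙ)`, `U₁ᵢ = [I; 0]`. -/
noncomputable def matU1 : Matrix (FIdx n) (XIdx n) ℝ := Matrix.of fun f p =>
  if f.1.2 = p ∧ (f.1.1 : ℕ) = (p.1 : ℕ) then 1 else 0

/-- `U₂ = [diag(U₂₀, …, U₂₍ₙ₋₁₎); 0]`, `U₂ᵢ = [0; I]`. -/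
noncomputable def matU2 : Matrix (FIdx n) (CIdx n) ℝ := Matrix.of fun f c =>
  if f.1.2 = c.1.2 ∧ (f.1.1 : ℕ) = (c.1.1 : ℕ) then 1 else 0

/-- `G₀ = diag(I_{n₀}, 0)`. -/
noncomputable def matG0 : Matrix (XIdx n) (XIdx n) ℝ := Matrix.of fun p q =>
  if p = q ∧ (p.1 : ℕ) = 0 then 1 else 0

end Blocks

section Map

variable {N : ℕ} {n : Fin (N + 1) → ℕ} {a b : ℝ} {nBC nx nz ny nw nu nv nr : ℕ}

/-- `B_T`. -/
noncomputable def BT (Gb : BcParams n a b nBC nv) : Matrix (Fin nBC) (CIdx n) ℝ :=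
  Gb.B * Matrix.fromRows (matT n 0) (matT n (b - a))
    - mint a b (fun s => Gb.BI s * matU2 n * matT n (s - a))

/-- Admissibility of `{n, G_b}`. -/
def Admissible (Gb : BcParams n a b nBC nv) : Prop := IsInvertible (BT Gb)

/-- `B_Q(s)`. -/
noncomputable def BQ (Gb : BcParams n a b nBC nv) (s : ℝ) : Matrix (CIdx n) (XIdx n) ℝ :=
  minv (BT Gb) * (Gb.BI s * matU1 n + mint s b (fun θ => Gb.BI θ * matU2 n * matQ n (θ - s))
    - Gb.B * Matrix.fromRows 0 (matQ n (b - s)))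

noncomputable def G2 (Gb : BcParams n a b nBC nv) (s θ : ℝ) : Matrix (XIdx n) (XIdx n) ℝ :=
  matT1 n (s - a) * BQ Gb θ

noncomputable def G1 (Gb : BcParams n a b nBC nv) (s θ : ℝ) : Matrix (XIdx n) (XIdx n) ℝ :=
  matQ1 n (s - θ) + G2 Gb s θ

noncomputable def Gv (Gb : BcParams n a b nBC nv) (s : ℝ) : Matrix (XIdx n) (Fin nv) ℝ :=
  matT1 n (s - a) * (minv (BT Gb) * Gb.Bv)

noncomputable def RD2 (Gb : BcParams n a b nBC nv) (s θ : ℝ) : Matrix (FIdx n) (XIdx n) ℝ :=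
  matU2 n * matT n (s - a) * BQ Gb θ

noncomputable def RD1 (Gb : BcParams n a b nBC nv) (s θ : ℝ) : Matrix (FIdx n) (XIdx n) ℝ :=
  RD2 Gb s θ + matU2 n * matQ n (s - θ)

/-- `Υ`. -/
noncomputable def Ups (Gb : BcParams n a b nBC nv) :
    PI4 (Fin nv ⊕ (CIdx n ⊕ CIdx n)) (Fin nv) (FIdx n) (XIdx n) where
  P := Matrix.fromRows 1 (Matrix.fromRows (minv (BT Gb) * Gb.Bv)
    (matT n (b - a) * (minv (BT Gb) * Gb.Bv)))
  Q1 := fun s => Matrix.fromRows 0 (Matrix.fromRows (BQ Gb s)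
    (matT n (b - a) * BQ Gb s + matQ n (b - s)))
  Q2 := fun s => matU2 n * matT n (s - a) * (minv (BT Gb) * Gb.Bv)
  R0 := fun _ => matU1 n
  R1 := RD1 Gb
  R2 := RD2 Gb

/-- `Ξ`. -/
noncomputable def Xi (Gp : PdeParams n a b nv nr) :
    PI4 (Fin nr) (Fin nv ⊕ (CIdx n ⊕ CIdx n)) (XIdx n) (FIdx n) where
  P := Matrix.fromCols 0 Gp.Drb
  Q1 := Gp.Cr
  Q2 := fun s => Matrix.fromCols (Gp.Bxv s) (Gp.Bxb s)
  R0 := Gp.A0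
  R1 := Gp.A1
  R2 := Gp.A2

/-- The parameters `[D_rv, C_rx; B_xv, {Âᵢ}]` of the PIE representation of the PDE subsystem. -/
noncomputable def sub (Gb : BcParams n a b nBC nv) (Gp : PdeParams n a b nv nr) :
    PI4 (Fin nr) (Fin nv) (XIdx n) (XIdx n) :=
  (Xi Gp).comp a b (Ups Gb)

/-- The operator `[0  𝒞_r]` on `ℝL₂`. -/
noncomputable def zeroCr (nx : ℕ) (Gb : BcParams n a b nBC nv) (Gp : PdeParams n a b nv nr) :
    PI4 (Fin nr) (Fin nx) (Fin 0) (XIdx n) where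
  P := 0
  Q1 := (sub Gb Gp).Q1
  Q2 := 0
  R0 := 0
  R1 := 0
  R2 := 0

/-- The matrix `𝒟_rv`. -/
noncomputable def Drv (Gb : BcParams n a b nBC nv) (Gp : PdeParams n a b nv nr) :
    Matrix (Fin nr) (Fin nv) ℝ :=
  (sub Gb Gp).P

/-- The map `M` from GPDE parameters to PIE parameters. -/
noncomputable def pieOf (Go : OdeParams nx nz ny nw nu nv nr) (Gb : BcParams n a b nBC nv)
    (Gp : PdeParams n a b nv nr) : PIEParams nx nz ny nw nu (XIdx n) where
  T := ⟨1, 0, fun s => Gv Gb s * Go.Cv, fun _ => matG0 n, G1 Gb, G2 Gb⟩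
  Tw := ⟨0, 0, fun s => Gv Gb s * Go.Dvw, 0, 0, 0⟩
  Tu := ⟨0, 0, fun s => Gv Gb s * Go.Dvu, 0, 0, 0⟩
  A := ⟨Go.A + Go.Bxr * Drv Gb Gp * Go.Cv, fun θ => Go.Bxr * (sub Gb Gp).Q1 θ,
    fun s => (sub Gb Gp).Q2 s * Go.Cv, (sub Gb Gp).R0, (sub Gb Gp).R1, (sub Gb Gp).R2⟩
  B1 := ⟨Go.Bxw + Go.Bxr * Drv Gb Gp * Go.Dvw, 0, fun s => (sub Gb Gp).Q2 s * Go.Dvw, 0, 0, 0⟩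
  B2 := ⟨Go.Bxu + Go.Bxr * Drv Gb Gp * Go.Dvu, 0, fun s => (sub Gb Gp).Q2 s * Go.Dvu, 0, 0, 0⟩
  C1 := ⟨Go.Cz + Go.Dzr * Drv Gb Gp * Go.Cv, fun θ => Go.Dzr * (sub Gb Gp).Q1 θ, 0, 0, 0, 0⟩
  C2 := ⟨Go.Cy + Go.Dyr * Drv Gb Gp * Go.Cv, fun θ => Go.Dyr * (sub Gb Gp).Q1 θ, 0, 0, 0, 0⟩
  D11 := ⟨Go.Dzw + Go.Dzr * Drv Gb Gp * Go.Dvw, 0, 0, 0, 0, 0⟩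
  D12 := ⟨Go.Dzu + Go.Dzr * Drv Gb Gp * Go.Dvu, 0, 0, 0, 0, 0⟩
  D21 := ⟨Go.Dyw + Go.Dyr * Drv Gb Gp * Go.Dvw, 0, 0, 0, 0, 0⟩
  D22 := ⟨Go.Dyu + Go.Dyr * Drv Gb Gp * Go.Dvu, 0, 0, 0, 0, 0⟩

end Map

end GPDE

/-! At a fixed time everything reduces to Taylor's formula. A component with `m` weak derivatives in
L₂ is determined by its top derivative and its derivatives of order below `m` at `a`; conversely any
such data define a Sobolev function (`MemW.exists_taylor`, `memW_of_ae_eq_taylor`). In block form, a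
state x̂ ∈ Wⁿ corresponds to a pair `(c, D)` with `c = (𝒞x̂)(a)` and `D = 𝒟x̂`: the operator `xOp`
recovers x̂ from the pair, and `fOp` gives `(𝒞x̂)(b)` and ℱx̂ (`memWn_of_ae_eq`, `MemWn.ae_eq`).

Substituting these expressions into the boundary condition turns it into a finite linear system `B_T
c = B_v v + ∫ B_T B_Q D`. Admissibility says precisely that this system has a unique solution `c =
bcVal Gb v D` (`boundary_iff`). Hence 𝒟 identifies X_v, up to null sets, with all of L₂, and the
inverse is `D ↦ T̂ D + G_v v` (`pieOf_state`).

With the same value of `c`, the operator Υ sends `(v, D)` to `(v, ℬx̂, ℱx̂)` (`Ups_opD`). The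
in-domain right-hand side and the output `r` are Ξ applied to that triple, so they are the composite
ΞΥ applied to `(v, D)`. That the stated formulas for the product parameters represent this composite
is Fubini's theorem plus bookkeeping about which side of the diagonal each variable lies on
(`PI4.comp_apply_fst`, `PI4.comp_apply_snd`).

In time, the state satisfies `(x, x̂) = 𝒯ux + 𝒯_w w + 𝒯_u u`, so the two evolution equations differ
only by moving the derivatives of the input terms across the equality. These derivatives exist
almost everywhere because the input terms depend on `w`, `u` only through `B_v D_vw w`, `B_v D_vu
u`, and functions in W_{1e} are differentiable almost everywhere (`MemW1e.ae_hasDerivAt`). Square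
integrability of `r`, for a jointly square integrable PIE state, follows from the Cauchy–Schwarz
inequality (`memLp_integral_mul`). -/

namespace GPDE

/-! ### Iterated integrals on an interval -/

section Kernels

variable {a b : ℝ}

theorem intervalIntegrable_of_memLp {f : ℝ → ℝ} (hf : MemLp f 2 (volume.restrict (Icc a b)))
    {c d : ℝ} (hc : c ∈ Icc a b) (hd : d ∈ Icc a b) : IntervalIntegrable f volume c d := by
  have h : IntegrableOn f (Icc a b) volume := hf.integrable (by norm_num)
  rw [intervalIntegrable_iff]
  refine h.mono_set (uIoc_subset_uIcc.trans ?_)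
  exact ordConnected_Icc.uIcc_subset hc hd

/-- Moving the variable endpoint into an indicator gives a fixed domain of integration, on which
Fubini's theorem for the square applies. -/
theorem integral_lower_eq {s : ℝ} (hs : s ∈ Icc a b) (f : ℝ → ℝ) :
    ∫ θ in a..s, f θ = ∫ θ in Icc a b, if θ ≤ s then f θ else 0 := by
  rw [intervalIntegral.integral_of_le hs.1, ← integral_Icc_eq_integral_Ioc]
  have : (fun θ => if θ ≤ s then f θ else 0) = (Iic s).indicator f := by
    ext θ; simp [indicator]
  rw [this, setIntegral_indicator measurableSet_Iic]
  congr 2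
  ext θ; constructor
  · intro h; exact ⟨⟨h.1, h.2.trans hs.2⟩, h.2⟩
  · intro h; exact ⟨h.1.1, h.2⟩

theorem integral_upper_eq {s : ℝ} (hs : s ∈ Icc a b) (f : ℝ → ℝ) :
    ∫ θ in s..b, f θ = ∫ θ in Icc a b, if s ≤ θ then f θ else 0 := by
  rw [intervalIntegral.integral_of_le hs.2, ← integral_Icc_eq_integral_Ioc]
  have : (fun θ => if s ≤ θ then f θ else 0) = (Ici s).indicator f := by
    ext θ; simp [indicator]
  rw [this, setIntegral_indicator measurableSet_Ici]
  congr 2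
  ext θ; constructor
  · intro h; exact ⟨⟨hs.1.trans h.1, h.2⟩, h.1⟩
  · intro h; exact ⟨h.2, h.1.2⟩

theorem integral_eq_Icc (hab : a ≤ b) (f : ℝ → ℝ) :
    ∫ θ in a..b, f θ = ∫ θ in Icc a b, f θ := by
  rw [intervalIntegral.integral_of_le hab, integral_Icc_eq_integral_Ioc]

theorem integrable_ite_le {F : ℝ → ℝ → ℝ} {μ : Measure (ℝ × ℝ)}
    (hF : Integrable (Function.uncurry F) μ) :
    Integrable (Function.uncurry fun θ η => if η ≤ θ then F θ η else 0) μ := by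
  have : (Function.uncurry fun θ η => if η ≤ θ then F θ η else 0)
      = {p : ℝ × ℝ | p.2 ≤ p.1}.indicator (Function.uncurry F) := by
    ext p; simp [indicator, Function.uncurry]
  rw [this]
  exact hF.indicator (measurableSet_le measurable_snd measurable_fst)

/-- Fubini on the triangle η ≤ θ. It is the interchange behind both Cauchy's repeated integration
formula and the integration by parts for primitives of L₂ functions. -/
theorem integral_triangle (hab : a ≤ b) {F : ℝ → ℝ → ℝ}
    (hF : Integrable (Function.uncurry F)
      ((volume.restrict (Icc a b)).prod (volume.restrict (Icc a b)))) :
    ∫ θ in a..b, ∫ η in a..θ, F θ η = ∫ η in a..b, ∫ θ in η..b, F θ η := by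
  rw [integral_eq_Icc hab, integral_eq_Icc hab,
    setIntegral_congr_fun measurableSet_Icc (fun θ hθ => integral_lower_eq hθ (F θ)),
    integral_integral_swap (integrable_ite_le hF)]
  exact setIntegral_congr_fun measurableSet_Icc
    (fun η hη => (integral_upper_eq hη (fun θ => F θ η)).symm)

/-- Measurable kernels on `[a,b]²` that are dominated by a square integrable function of the second
variable. -/
def KerL2 (a b : ℝ) (H : ℝ → ℝ → ℝ) : Prop :=
  AEStronglyMeasurable (Function.uncurry H)
      ((volume.restrict (Icc a b)).prod (volume.restrict (Icc a b))) ∧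
    ∃ g : ℝ → ℝ, MemLp g 2 (volume.restrict (Icc a b)) ∧
      ∀ᵐ p ∂((volume.restrict (Icc a b)).prod (volume.restrict (Icc a b))),
        |H p.1 p.2| ≤ g p.2

theorem ae_prod_Icc {p : ℝ × ℝ → Prop} (h : ∀ θ ∈ Icc a b, ∀ η ∈ Icc a b, p (θ, η)) :
    ∀ᵐ q ∂((volume.restrict (Icc a b)).prod (volume.restrict (Icc a b))), p q := by
  rw [Measure.prod_restrict]
  exact (ae_restrict_iff' (measurableSet_Icc.prod measurableSet_Icc)).2
    (ae_of_all _ fun q hq => h q.1 hq.1 q.2 hq.2)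

theorem KerL2.zero : KerL2 a b (fun _ _ => 0) :=
  ⟨aestronglyMeasurable_const, 0, MemLp.zero, ae_of_all _ fun _ => by simp⟩

theorem KerL2.add {H K : ℝ → ℝ → ℝ} (hH : KerL2 a b H) (hK : KerL2 a b K) :
    KerL2 a b (fun θ η => H θ η + K θ η) := by
  obtain ⟨h1, g, hg, h2⟩ := hH
  obtain ⟨k1, l, hl, k2⟩ := hK
  refine ⟨h1.add k1, g + l, hg.add hl, ?_⟩
  filter_upwards [h2, k2] with p hp hp'
  exact (abs_add_le _ _).trans (add_le_add hp hp')

theorem KerL2.sum {ι : Type} (s : Finset ι) {H : ι → ℝ → ℝ → ℝ} (hH : ∀ i ∈ s, KerL2 a b (H i)) :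
    KerL2 a b (fun θ η => ∑ i ∈ s, H i θ η) := by
  classical
  induction s using Finset.induction_on with
  | empty => simpa using KerL2.zero
  | insert i s his ih =>
    simp only [Finset.sum_insert his]
    exact (hH i (by simp)).add (ih fun j hj => hH j (by simp [hj]))

theorem KerL2.of_continuous {H : ℝ → ℝ → ℝ} (hH : Continuous (Function.uncurry H)) :
    KerL2 a b H := by
  obtain ⟨C, hC⟩ := (isCompact_Icc.prod isCompact_Icc :
    IsCompact (Icc a b ×ˢ Icc a b)).exists_bound_of_continuousOn hH.continuousOn
  exact ⟨hH.aestronglyMeasurable, fun _ => C, memLp_const C,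
    ae_prod_Icc fun θ hθ η hη => hC (θ, η) ⟨hθ, hη⟩⟩

theorem KerL2.mul {f g : ℝ → ℝ} (hf : Continuous f)
    (hg : MemLp g 2 (volume.restrict (Icc a b))) : KerL2 a b (fun θ η => f θ * g η) := by
  obtain ⟨C, hC⟩ := (isCompact_Icc : IsCompact (Icc a b)).exists_bound_of_continuousOn
    hf.continuousOn
  refine ⟨(hf.aestronglyMeasurable.comp_fst).mul hg.1.comp_snd, fun η => C * |g η|,
    hg.abs.const_mul C, ae_prod_Icc fun θ hθ η _ => ?_⟩
  rw [abs_mul]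
  exact mul_le_mul_of_nonneg_right (hC θ hθ) (abs_nonneg _)

theorem KerL2.of_memLp_top {H : ℝ → ℝ → ℝ} (hH : MemLp (fun p : ℝ × ℝ => H p.1 p.2) ⊤
    ((volume.restrict (Icc a b)).prod (volume.restrict (Icc a b)))) : KerL2 a b H := by
  refine ⟨hH.1, fun _ => lpNorm (fun p : ℝ × ℝ => H p.1 p.2) ⊤
    ((volume.restrict (Icc a b)).prod (volume.restrict (Icc a b))), memLp_const _, ?_⟩
  exact ae_le_lpNorm_exponent_top hH

theorem measurableSet_snd_le_fst : MeasurableSet {p : ℝ × ℝ | p.2 ≤ p.1} :=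
  measurableSet_le measurable_snd measurable_fst

/-- A 4-PI operator uses one kernel below the diagonal and another above it; gluing them must stay
inside the class. -/
theorem KerL2.ite {H K : ℝ → ℝ → ℝ} (hH : KerL2 a b H) (hK : KerL2 a b K) :
    KerL2 a b (fun θ η => if η ≤ θ then H θ η else K θ η) := by
  obtain ⟨h1, g, hg, h2⟩ := hH
  obtain ⟨k1, l, hl, k2⟩ := hK
  refine ⟨?_, fun η => |g η| + |l η|, hg.abs.add hl.abs, ?_⟩
  · have := (h1.indicator measurableSet_snd_le_fst).add
      (k1.indicator measurableSet_snd_le_fst.compl)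
    refine this.congr (ae_of_all _ fun p => ?_)
    by_cases h : p.2 ≤ p.1 <;> simp [h, Function.uncurry, indicator]
  · filter_upwards [h2, k2] with p hp hp'
    have e1 := (le_abs_self (g p.2))
    have e2 := (le_abs_self (l p.2))
    have e3 := abs_nonneg (g p.2)
    have e4 := abs_nonneg (l p.2)
    split_ifs <;> linarith

/-- The integrand is dominated by `|f θ| * (g η * |x η|)`, a product of two integrable functions of
one variable each. This is the integrability that every use of Fubini on composed kernels relies on.
-/
theorem KerL2.integrable {H : ℝ → ℝ → ℝ} (hH : KerL2 a b H) {f x : ℝ → ℝ}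
    (hf : MemLp f 2 (volume.restrict (Icc a b))) (hx : MemLp x 2 (volume.restrict (Icc a b))) :
    Integrable (Function.uncurry fun θ η => f θ * H θ η * x η)
      ((volume.restrict (Icc a b)).prod (volume.restrict (Icc a b))) := by
  obtain ⟨h1, g, hg, h2⟩ := hH
  have hgx : Integrable (fun η => g η * |x η|) (volume.restrict (Icc a b)) :=
    hg.integrable_mul hx.abs
  have hf1 : Integrable (fun θ => |f θ|) (volume.restrict (Icc a b)) :=
    (hf.integrable (by norm_num)).abs
  refine (hf1.mul_prod hgx).mono' ((hf.1.comp_fst.mul h1).mul hx.1.comp_snd) ?_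
  filter_upwards [h2] with p hp
  simp only [Function.uncurry, Real.norm_eq_abs, abs_mul, mul_assoc]
  gcongr

theorem KerL2.memLp_slice {H : ℝ → ℝ → ℝ} (hH : KerL2 a b H) :
    ∀ᵐ θ ∂(volume.restrict (Icc a b)), MemLp (H θ) 2 (volume.restrict (Icc a b)) := by
  obtain ⟨h1, g, hg, h2⟩ := hH
  filter_upwards [h1.prodMk_left, Measure.ae_ae_of_ae_prod h2] with θ hθ hθ'
  exact hg.mono' hθ hθ'

/-- The image is even essentially bounded, by the constant ∫ g|x|, and the interval has finite
measure. -/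
theorem KerL2.memLp_apply {H : ℝ → ℝ → ℝ} (hH : KerL2 a b H) {x : ℝ → ℝ}
    (hx : MemLp x 2 (volume.restrict (Icc a b))) :
    MemLp (fun θ => ∫ η in Icc a b, H θ η * x η) 2 (volume.restrict (Icc a b)) := by
  obtain ⟨h1, g, hg, h2⟩ := hH
  have hgx : Integrable (fun η => g η * |x η|) (volume.restrict (Icc a b)) :=
    hg.integrable_mul hx.abs
  refine MemLp.of_bound ((h1.mul hx.1.comp_snd).integral_prod_right')
    (∫ η in Icc a b, g η * |x η|) ?_
  filter_upwards [Measure.ae_ae_of_ae_prod h2] with θ hθ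
  refine norm_integral_le_of_norm_le hgx ?_
  filter_upwards [hθ] with η hη
  rw [norm_mul, Real.norm_eq_abs, Real.norm_eq_abs]
  gcongr

/-- Integrating out the first variable leaves the dominating function `g`, scaled by the L₁ norm of
`f`; unlike `KerL2.memLp_apply`, the result is square integrable but need not be bounded. -/
theorem KerL2.memLp_coapply {H : ℝ → ℝ → ℝ} (hH : KerL2 a b H) {f : ℝ → ℝ}
    (hf : MemLp f 2 (volume.restrict (Icc a b))) :
    MemLp (fun η => ∫ θ in Icc a b, f θ * H θ η) 2 (volume.restrict (Icc a b)) := by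
  obtain ⟨h1, g, hg, h2⟩ := hH
  have hf1 : Integrable (fun θ => |f θ|) (volume.restrict (Icc a b)) :=
    (hf.integrable (by norm_num)).abs
  refine (hg.const_mul (∫ θ in Icc a b, |f θ|)).mono'
    ((hf.1.comp_fst.mul h1).prod_swap.integral_prod_right') ?_
  filter_upwards [Measure.ae_ae_of_ae_prod 
    (Measure.measurePreserving_swap.quasiMeasurePreserving.ae h2)] with η hη
  rw [← integral_mul_const]
  refine norm_integral_le_of_norm_le (hf1.mul_const _) ?_
  filter_upwards [hη] with θ hθ
  simp only [norm_mul, Real.norm_eq_abs]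
  exact mul_le_mul_of_nonneg_left hθ (abs_nonneg _)

end Kernels

/-! ### Test functions and weak derivatives -/

section Weak

variable {a b : ℝ}

theorem exists_Icc_of_compact {K : Set ℝ} (hK : IsCompact K) (hab : a < b) (h : K ⊆ Ioo a b) :
    ∃ c d, a < c ∧ c ≤ d ∧ d < b ∧ K ⊆ Icc c d := by
  set m := (a + b) / 2 with hm
  have hmI : m ∈ Ioo a b := ⟨by linarith, by linarith⟩
  -- Adding the midpoint makes the compact set nonempty, so that its least and greatest elements
  -- exist even when `K` is empty.
  have hK' : IsCompact (insert m K) := hK.insert m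
  have hs : insert m K ⊆ Ioo a b := insert_subset hmI h
  obtain ⟨c, hc⟩ := hK'.exists_isLeast ⟨m, mem_insert _ _⟩
  obtain ⟨d, hd⟩ := hK'.exists_isGreatest ⟨m, mem_insert _ _⟩
  exact ⟨c, d, (hs hc.1).1, hc.2 hd.1, (hs hd.1).2,
    fun x hx => ⟨hc.2 (mem_insert_of_mem _ hx), hd.2 (mem_insert_of_mem _ hx)⟩⟩

/-- Test functions on the open interval `(a,b)`. -/
def IsTest (a b : ℝ) (φ : ℝ → ℝ) : Prop :=
  ContDiff ℝ ∞ φ ∧ HasCompactSupport φ ∧ tsupport φ ⊆ Ioo a b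

theorem IsTest.continuous {φ : ℝ → ℝ} (h : IsTest a b φ) : Continuous φ := h.1.continuous

theorem IsTest.eq_zero {φ : ℝ → ℝ} (h : IsTest a b φ) {s : ℝ} (hs : s ∉ Ioo a b) : φ s = 0 :=
  image_eq_zero_of_notMem_tsupport fun h' => hs (h.2.2 h')

theorem IsTest.deriv {φ : ℝ → ℝ} (h : IsTest a b φ) : IsTest a b (deriv φ) :=
  ⟨(contDiff_infty_iff_deriv.1 h.1).2, h.2.1.deriv, tsupport_deriv_subset.trans h.2.2⟩

theorem IsTest.hasDerivAt {φ : ℝ → ℝ} (h : IsTest a b φ) (s : ℝ) :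
    HasDerivAt φ (_root_.deriv φ s) s :=
  ((h.1.differentiable (by simp)) s).hasDerivAt

/-- To the left of the support of ζ the primitive is trivially zero; the vanishing total integral
makes it zero to the right as well, so it has compact support inside the open interval. -/
theorem IsTest.primitive (hab : a < b) {ζ : ℝ → ℝ} (h : IsTest a b ζ)
    (h0 : ∫ s in a..b, ζ s = 0) :
    IsTest a b (fun s => ∫ θ in a..s, ζ θ) ∧
      _root_.deriv (fun s => ∫ θ in a..s, ζ θ) = ζ := by
  have hd : ∀ s, HasDerivAt (fun s => ∫ θ in a..s, ζ θ) (ζ s) s := fun s =>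
    intervalIntegral.integral_hasDerivAt_right (h.continuous.intervalIntegrable _ _)
      (h.continuous.stronglyMeasurableAtFilter _ _) h.continuous.continuousAt
  have hderiv : _root_.deriv (fun s => ∫ θ in a..s, ζ θ) = ζ := funext fun s => (hd s).deriv
  obtain ⟨c, d, hac, hcd, hdb, hK⟩ := exists_Icc_of_compact h.2.1 hab h.2.2
  have hz : ∀ s, s ∉ Icc c d → ζ s = 0 := fun s hs =>
    image_eq_zero_of_notMem_tsupport fun h' => hs (hK h')
  have hz1 : ∀ s, s < c → ∫ θ in a..s, ζ θ = 0 := by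
    intro s hs
    refine (intervalIntegral.integral_congr (g := fun _ => (0 : ℝ)) fun θ hθ => ?_).trans (by simp)
    refine hz θ fun hθ' => ?_
    rcases le_total a s with h1 | h1
    · rw [uIcc_of_le h1] at hθ; linarith [hθ.2, hθ'.1]
    · rw [uIcc_of_ge h1] at hθ; linarith [hθ.2, hθ'.1]
  have hz2 : ∀ s, d < s → ∫ θ in a..s, ζ θ = 0 := by
    intro s hs
    have : ∫ θ in b..s, ζ θ = 0 := by
      refine (intervalIntegral.integral_congr (g := fun _ => (0 : ℝ)) fun θ hθ => ?_).trans
        (by simp)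
      refine hz θ fun hθ' => ?_
      rcases le_total b s with h1 | h1
      · rw [uIcc_of_le h1] at hθ; linarith [hθ.1, hθ'.2]
      · rw [uIcc_of_ge h1] at hθ; linarith [hθ.1, hθ'.2]
    rw [← intervalIntegral.integral_add_adjacent_intervals (b := b)
      (h.continuous.intervalIntegrable _ _) (h.continuous.intervalIntegrable _ _), h0, this,
      add_zero]
  have hsupp : Function.support (fun s => ∫ θ in a..s, ζ θ) ⊆ Icc c d := by
    intro s hs
    by_contra hs'
    rw [mem_Icc, not_and_or, not_le, not_le] at hs'
    exact hs (hs'.elim (hz1 s) (hz2 s))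
  have ht : tsupport (fun s => ∫ θ in a..s, ζ θ) ⊆ Icc c d := closure_minimal hsupp isClosed_Icc
  refine ⟨⟨contDiff_infty_iff_deriv.2 ⟨fun s => (hd s).differentiableAt, ?_⟩,
    HasCompactSupport.of_support_subset_isCompact isCompact_Icc hsupp,
    ht.trans fun s hs => ⟨hac.trans_le hs.1, hs.2.trans_lt hdb⟩⟩, hderiv⟩
  rw [hderiv]; exact h.1

theorem exists_test_integral_one (hab : a < b) :
    ∃ ψ, IsTest a b ψ ∧ ∫ s in a..b, ψ s = 1 := by
  obtain ⟨r, hr, hr'⟩ : ∃ r : ℝ, 0 < r ∧ r < (b - a) / 2 :=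
    ⟨(b - a) / 4, by linarith, by linarith⟩
  let f : ContDiffBump ((a + b) / 2) := ⟨r / 2, r, by linarith, by linarith⟩
  have ht : tsupport (f.normed volume) ⊆ Ioo a b := by
    rw [f.tsupport_normed_eq, Real.closedBall_eq_Icc]
    intro s hs
    change s ∈ Icc ((a + b) / 2 - r) ((a + b) / 2 + r) at hs
    exact ⟨by linarith [hs.1], by linarith [hs.2]⟩
  refine ⟨f.normed volume, ⟨f.contDiff_normed, f.hasCompactSupport_normed, ht⟩, ?_⟩
  rw [intervalIntegral.integral_eq_integral_of_support_subset, f.integral_normed]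
  exact (subset_tsupport _).trans (ht.trans Ioo_subset_Ioc_self)

theorem intervalIntegrable_mul_continuous {h φ : ℝ → ℝ} (hab : a ≤ b)
    (hh : MemLp h 2 (volume.restrict (Icc a b))) (hφ : Continuous φ) :
    IntervalIntegrable (fun s => h s * φ s) volume a b :=
  (intervalIntegrable_of_memLp hh (left_mem_Icc.2 hab) (right_mem_Icc.2 hab)).mul_continuousOn
    hφ.continuousOn

/-- The fundamental lemma of the calculus of variations, transferred from the open interval to the
closed one since the endpoints are null. -/
theorem ae_zero_of_test {h : ℝ → ℝ} (hh : MemLp h 2 (volume.restrict (Icc a b)))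
    (h0 : ∀ φ, IsTest a b φ → ∫ s in a..b, h s * φ s = 0) :
    h =ᵐ[volume.restrict (Icc a b)] 0 := by
  have hi : IntegrableOn h (Icc a b) volume := hh.integrable (by norm_num)
  have := isOpen_Ioo.ae_eq_zero_of_integral_contDiff_smul_eq_zero (f := h) (μ := volume)
    (U := Ioo a b) (hi.mono_set Ioo_subset_Icc_self).locallyIntegrableOn
    (fun φ h1 h2 h3 => by
      rw [← h0 φ ⟨h1, h2, h3⟩, intervalIntegral.integral_eq_integral_of_support_subset]
      · exact integral_congr_ae (ae_of_all _ fun s => by simp [mul_comm])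
      · intro s hs
        have : φ s ≠ 0 := fun h => hs (by simp [h])
        exact Ioo_subset_Ioc_self (h3 (subset_tsupport _ this)))
  rw [← restrict_Ioo_eq_restrict_Icc]
  exact (ae_restrict_iff' measurableSet_Ioo).2 this

/-- The lemma of du Bois-Reymond. -/
theorem ae_const_of_test (hab : a < b) {h : ℝ → ℝ} (hh : MemLp h 2 (volume.restrict (Icc a b)))
    (h0 : ∀ φ, IsTest a b φ → ∫ s in a..b, h s * deriv φ s = 0) :
    ∃ c, h =ᵐ[volume.restrict (Icc a b)] fun _ => c := by
  obtain ⟨ψ, hψ, hψ1⟩ := exists_test_integral_one hab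
  set c := ∫ s in a..b, h s * ψ s with hc
  refine ⟨c, ?_⟩
  have key : (fun s => h s - c) =ᵐ[volume.restrict (Icc a b)] 0 := by
    refine ae_zero_of_test (hh.sub (memLp_const c)) fun φ hφ => ?_
    set m := ∫ s in a..b, φ s with hm
    -- Subtracting `m * ψ` removes the mean of φ, so the difference is the derivative of a test
    -- function and the hypothesis applies to it.
    have hζ : IsTest a b (fun s => φ s - m * ψ s) := by
      have hs : tsupport (fun s => φ s - m * ψ s) ⊆ tsupport φ ∪ tsupport ψ :=
        closure_minimal (fun s hs => by
          by_contra hcon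
          rw [mem_union, not_or] at hcon
          exact hs (by
            simp [image_eq_zero_of_notMem_tsupport hcon.1,
              image_eq_zero_of_notMem_tsupport hcon.2]))
          ((isClosed_tsupport φ).union (isClosed_tsupport ψ))
      exact ⟨hφ.1.sub (contDiff_const.mul hψ.1),
        (hφ.2.1.union hψ.2.1).of_isClosed_subset (isClosed_tsupport _) hs,
        hs.trans (union_subset hφ.2.2 hψ.2.2)⟩
    have hint : ∫ s in a..b, (φ s - m * ψ s) = 0 := by
      rw [intervalIntegral.integral_sub (hφ.continuous.intervalIntegrable _ _)
        ((hψ.continuous.intervalIntegrable _ _).const_mul m),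
        intervalIntegral.integral_const_mul, hψ1, ← hm]
      ring
    have hp := hζ.primitive hab hint
    have h1 := h0 _ hp.1
    rw [hp.2] at h1
    have e1 : ∫ s in a..b, h s * (φ s - m * ψ s) = (∫ s in a..b, h s * φ s) - m * c := by
      rw [hc, ← intervalIntegral.integral_const_mul, ← intervalIntegral.integral_sub
        (intervalIntegrable_mul_continuous hab.le hh hφ.continuous)
        ((intervalIntegrable_mul_continuous hab.le hh hψ.continuous).const_mul m)]
      exact intervalIntegral.integral_congr fun s _ => by ring
    have e2 : ∫ s in a..b, (h s - c) * φ s = (∫ s in a..b, h s * φ s) - c * m := by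
      rw [hm, ← intervalIntegral.integral_const_mul, ← intervalIntegral.integral_sub
        (intervalIntegrable_mul_continuous hab.le hh hφ.continuous)
        ((hφ.continuous.intervalIntegrable _ _).const_mul c)]
      exact intervalIntegral.integral_congr fun s _ => by ring
    rw [e2, mul_comm c m, ← e1, h1]
  filter_upwards [key] with s hs
  exact sub_eq_zero.1 hs

/-- Integration by parts without differentiating the primitive: swap the order of integration on the
triangle and use that φ' integrates to `-φ s` over `[s, b]`. The constant `c` drops out because φ
vanishes at both ends. -/
theorem integral_primitive_mul_deriv (hab : a < b) {g : ℝ → ℝ}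
    (hg : MemLp g 2 (volume.restrict (Icc a b))) (c : ℝ) {φ : ℝ → ℝ} (hφ : IsTest a b φ) :
    ∫ s in a..b, (c + ∫ θ in a..s, g θ) * deriv φ s = -∫ s in a..b, g s * φ s := by
  have hφ' := hφ.deriv.continuous
  have hend : φ a = 0 ∧ φ b = 0 := ⟨hφ.eq_zero (by simp), hφ.eq_zero (by simp)⟩
  have hda : ∀ s, ∫ θ in s..b, deriv φ θ = - φ s := fun s => by
    rw [intervalIntegral.integral_eq_sub_of_hasDerivAt (fun t _ => hφ.hasDerivAt t)
      (hφ'.intervalIntegrable _ _), hend.2, zero_sub]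
  have hprim : ContinuousOn (fun s => ∫ θ in a..s, g θ) (uIcc a b) :=
    intervalIntegral.continuousOn_primitive_interval
      (by rw [uIcc_of_le hab.le]; exact hg.integrable (by norm_num))
  have hL2 : MemLp (deriv φ) 2 (volume.restrict (Icc a b)) :=
    (hφ'.memLp_of_hasCompactSupport hφ.deriv.2.1).restrict _
  have hsw := integral_triangle hab.le (F := fun θ η => deriv φ θ * g η)
    ((hL2.integrable (by norm_num)).mul_prod (hg.integrable (by norm_num)))
  simp only [intervalIntegral.integral_const_mul, intervalIntegral.integral_mul_const, hda] at hsw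
  have : ∀ s, (c + ∫ θ in a..s, g θ) * deriv φ s
      = c * deriv φ s + deriv φ s * ∫ θ in a..s, g θ := fun s => by ring
  simp only [this]
  rw [intervalIntegral.integral_add ((hφ'.intervalIntegrable _ _).const_mul c)
    (ContinuousOn.intervalIntegrable (u := fun s => deriv φ s * ∫ θ in a..s, g θ)
      (hφ'.continuousOn.mul hprim)), intervalIntegral.integral_const_mul, hda,
    hsw, hend.1, ← intervalIntegral.integral_neg]
  simp only [neg_zero, mul_zero, zero_add]
  exact intervalIntegral.integral_congr fun s _ => by ring

end Weak

/-! ### Sobolev functions of one variable and Taylor's formula -/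

section Sobolev

variable {a b : ℝ}

/-! ### Weak derivatives and their canonical representatives. -/

theorem isWeakDeriv_iff {j : ℕ} {u g : ℝ → ℝ} :
    IsWeakDeriv a b j u g ↔ ∀ φ, IsTest a b φ →
      ∫ s in a..b, u s * iteratedDeriv j φ s = (-1) ^ j * ∫ s in a..b, g s * φ s :=
  ⟨fun h φ hφ => h φ hφ.1 hφ.2.1 hφ.2.2, fun h φ h1 h2 h3 => h φ ⟨h1, h2, h3⟩⟩

theorem IsTest.iteratedDeriv {φ : ℝ → ℝ} (h : IsTest a b φ) (j : ℕ) :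
    IsTest a b (iteratedDeriv j φ) := by
  induction j with
  | zero => simpa using h
  | succ j ih => rw [iteratedDeriv_succ]; exact ih.deriv

theorem IsWeakDeriv.congr (hab : a ≤ b) {j : ℕ} {u u' g g' : ℝ → ℝ}
    (hu : u =ᵐ[volume.restrict (Icc a b)] u') (hg : g =ᵐ[volume.restrict (Icc a b)] g')
    (h : IsWeakDeriv a b j u g) : IsWeakDeriv a b j u' g' := by
  intro φ h1 h2 h3
  have := h φ h1 h2 h3
  rw [integral_eq_Icc hab, integral_eq_Icc hab] at this ⊢
  have e1 := integral_congr_ae (hu.mul (ae_eq_refl (iteratedDeriv j φ)))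
  have e2 := integral_congr_ae (hg.mul (ae_eq_refl φ))
  exact e1.symm.trans (this.trans (congrArg _ e2))

theorem IsWeakDeriv.unique (hab : a < b) {j : ℕ} {u g g' : ℝ → ℝ}
    (hg : MemLp g 2 (volume.restrict (Icc a b))) (hg' : MemLp g' 2 (volume.restrict (Icc a b)))
    (h : IsWeakDeriv a b j u g) (h' : IsWeakDeriv a b j u g') :
    g =ᵐ[volume.restrict (Icc a b)] g' := by
  have : (fun s => g s - g' s) =ᵐ[volume.restrict (Icc a b)] 0 := by
    refine ae_zero_of_test (hg.sub hg') fun φ hφ => ?_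
    have e := (h φ hφ.1 hφ.2.1 hφ.2.2).symm.trans (h' φ hφ.1 hφ.2.1 hφ.2.2)
    have e' := mul_left_cancel₀ (pow_ne_zero j (by norm_num : (-1 : ℝ) ≠ 0)) e
    simp only [sub_mul]
    rw [intervalIntegral.integral_sub
      (intervalIntegrable_mul_continuous hab.le hg hφ.continuous)
      (intervalIntegrable_mul_continuous hab.le hg' hφ.continuous), e', sub_self]
  filter_upwards [this] with s hs
  exact sub_eq_zero.1 hs

theorem wD_spec {j : ℕ} {u : ℝ → ℝ}
    (h : ∃ g : ℝ → ℝ, MemLp g 2 (volume.restrict (Icc a b)) ∧ IsWeakDeriv a b j u g) :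
    MemLp (wD a b j u) 2 (volume.restrict (Icc a b)) ∧ IsWeakDeriv a b j u (wD a b j u) := by
  rw [wD, dif_pos h]
  exact h.choose_spec

theorem memLp_wD (j : ℕ) (u : ℝ → ℝ) : MemLp (wD a b j u) 2 (volume.restrict (Icc a b)) := by
  by_cases h : ∃ g : ℝ → ℝ, MemLp g 2 (volume.restrict (Icc a b)) ∧ IsWeakDeriv a b j u g
  · exact (wD_spec h).1
  · rw [wD, dif_neg h]; exact MemLp.zero

theorem wD_ae_eq (hab : a < b) {j : ℕ} {u g : ℝ → ℝ}
    (hg : MemLp g 2 (volume.restrict (Icc a b))) (h : IsWeakDeriv a b j u g) :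
    wD a b j u =ᵐ[volume.restrict (Icc a b)] g :=
  have hw := wD_spec ⟨g, hg, h⟩
  IsWeakDeriv.unique hab hw.1 hg hw.2 h

/-- The equality is everywhere, not just almost everywhere: both sides choose from the same
predicate, since being a weak derivative ignores null sets. -/
theorem wD_congr (hab : a ≤ b) {j : ℕ} {u u' : ℝ → ℝ}
    (hu : u =ᵐ[volume.restrict (Icc a b)] u') : wD a b j u = wD a b j u' := by
  have : (fun g => MemLp g 2 (volume.restrict (Icc a b)) ∧ IsWeakDeriv a b j u g)
      = fun g => MemLp g 2 (volume.restrict (Icc a b)) ∧ IsWeakDeriv a b j u' g := by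
    funext g
    exact propext (and_congr_right fun _ =>
      ⟨fun h => h.congr hab hu (ae_eq_refl g), fun h => h.congr hab hu.symm (ae_eq_refl g)⟩)
  classical
  exact congrArg (fun P : (ℝ → ℝ) → Prop => if h : ∃ g, P g then h.choose else 0) this

/-- On a nondegenerate interval two continuous functions that agree almost everywhere agree
everywhere, endpoints included. This makes the boundary values in ℬ well defined. -/
theorem contRep_eq (hab : a < b) {u g : ℝ → ℝ} (hg : ContinuousOn g (Icc a b))
    (hu : u =ᵐ[volume.restrict (Icc a b)] g) : EqOn (contRep a b u) g (Icc a b) := by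
  have h : ∃ g : ℝ → ℝ, ContinuousOn g (Icc a b) ∧ u =ᵐ[volume.restrict (Icc a b)] g :=
    ⟨g, hg, hu⟩
  rw [contRep, dif_pos h]
  exact Measure.eqOn_Icc_of_ae_eq volume hab.ne (h.choose_spec.2.symm.trans hu) h.choose_spec.1 hg

/-! ### The monomials τᵢ and Taylor's formula with integral remainder. -/

theorem tau_zero (s : ℝ) : tau 0 s = 1 := by simp [tau]

theorem tau_succ_zero (i : ℕ) : tau (i + 1) 0 = 0 := by simp [tau]

theorem continuous_tau (i : ℕ) : Continuous (tau i) := by unfold tau; fun_prop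

theorem hasDerivAt_tau (i : ℕ) (s : ℝ) : HasDerivAt (tau (i + 1)) (tau i s) s := by
  have h := (hasDerivAt_pow (i + 1) s).div_const ((i + 1).factorial : ℝ)
  refine h.congr_deriv ?_
  rw [tau, Nat.factorial_succ]
  have : (i.factorial : ℝ) ≠ 0 := by positivity
  push_cast
  field_simp

theorem integral_tau (i : ℕ) (θ s : ℝ) : ∫ η in θ..s, tau i (η - θ) = tau (i + 1) (s - θ) := by
  rw [intervalIntegral.integral_comp_sub_right (fun x => tau i x) θ, sub_self,
    intervalIntegral.integral_eq_sub_of_hasDerivAt (fun t _ => hasDerivAt_tau i t)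
      ((continuous_tau i).intervalIntegrable _ _), tau_succ_zero, sub_zero]

theorem memLp_mono {g : ℝ → ℝ} (hg : MemLp g 2 (volume.restrict (Icc a b))) {s : ℝ}
    (hs : s ∈ Icc a b) : MemLp g 2 (volume.restrict (Icc a s)) :=
  hg.mono_measure (Measure.restrict_mono (Icc_subset_Icc_right hs.2) le_rfl)

/-- Cauchy's formula for repeated integration. -/
theorem integral_integral_tau {g : ℝ → ℝ} (hg : MemLp g 2 (volume.restrict (Icc a b))) (i : ℕ)
    {s : ℝ} (hs : s ∈ Icc a b) :
    ∫ η in a..s, ∫ θ in a..η, tau i (η - θ) * g θ = ∫ θ in a..s, tau (i + 1) (s - θ) * g θ := by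
  have hk : KerL2 a s (fun η θ => tau i (η - θ)) :=
    KerL2.of_continuous ((continuous_tau i).comp (continuous_fst.sub continuous_snd))
  have hi := hk.integrable (memLp_const (1 : ℝ)) (memLp_mono hg hs)
  simp only [one_mul] at hi
  rw [integral_triangle hs.1 hi]
  refine intervalIntegral.integral_congr fun θ _ => ?_
  rw [intervalIntegral.integral_mul_const, integral_tau]

theorem continuousOn_primitive {g : ℝ → ℝ} (hab : a ≤ b)
    (hg : MemLp g 2 (volume.restrict (Icc a b))) :
    ContinuousOn (fun s => ∫ θ in a..s, g θ) (Icc a b) := by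
  have := intervalIntegral.continuousOn_primitive_interval (f := g) (μ := volume) (a := a) (b := b)
      (by rw [uIcc_of_le hab]; exact hg.integrable (by norm_num))
  rwa [uIcc_of_le hab] at this

/-- The `j`-th derivative of the function with `m`-th derivative `g` and derivatives `c k` of order
`k < m` at `a`. -/
noncomputable def taylor (a : ℝ) (m : ℕ) (c : ℕ → ℝ) (g : ℝ → ℝ) (j : ℕ) (s : ℝ) : ℝ :=
  if j < m then (∑ k ∈ Finset.Ico j m, tau (k - j) (s - a) * c k)
    + ∫ θ in a..s, tau (m - (j + 1)) (s - θ) * g θ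
  else g s

theorem memLp_of_continuousOn {f : ℝ → ℝ} (hf : ContinuousOn f (Icc a b)) :
    MemLp f 2 (volume.restrict (Icc a b)) := by
  obtain ⟨C, hC⟩ := isCompact_Icc.exists_bound_of_continuousOn hf
  exact MemLp.of_bound (hf.aestronglyMeasurable measurableSet_Icc) C
    ((ae_restrict_iff' measurableSet_Icc).2 (ae_of_all _ hC))

theorem taylor_of_le {m : ℕ} {c : ℕ → ℝ} {g : ℝ → ℝ} {j : ℕ} (h : m ≤ j) :
    taylor a m c g j = g := by
  funext s; rw [taylor, if_neg (not_lt.2 h)]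

/-- By Cauchy's formula the convolution with τ_{i+1} is a primitive of the convolution with τ_i, so
continuity propagates by induction from the primitive of `g`. -/
theorem continuousOn_conv {g : ℝ → ℝ} (hab : a ≤ b) (hg : MemLp g 2 (volume.restrict (Icc a b)))
    (i : ℕ) : ContinuousOn (fun s => ∫ θ in a..s, tau i (s - θ) * g θ) (Icc a b) := by
  induction i with
  | zero =>
    simp only [tau_zero, one_mul]
    exact continuousOn_primitive hab hg
  | succ i ih =>
    exact (continuousOn_primitive hab (memLp_of_continuousOn ih)).congr
      fun s hs => (integral_integral_tau hg i hs).symm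

theorem continuousOn_taylor {m : ℕ} (c : ℕ → ℝ) {g : ℝ → ℝ} (hab : a ≤ b)
    (hg : MemLp g 2 (volume.restrict (Icc a b))) {j : ℕ} (hj : j < m) :
    ContinuousOn (taylor a m c g j) (Icc a b) := by
  have : taylor a m c g j = fun s => (∑ k ∈ Finset.Ico j m, tau (k - j) (s - a) * c k)
      + ∫ θ in a..s, tau (m - (j + 1)) (s - θ) * g θ := by funext s; rw [taylor, if_pos hj]
  rw [this]
  refine ContinuousOn.add (Continuous.continuousOn ?_) (continuousOn_conv hab hg _)
  exact continuous_finsetSum _ fun k _ =>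
    ((continuous_tau _).comp (continuous_id.sub continuous_const)).mul continuous_const

theorem memLp_taylor {m : ℕ} (c : ℕ → ℝ) {g : ℝ → ℝ} (hab : a ≤ b)
    (hg : MemLp g 2 (volume.restrict (Icc a b))) (j : ℕ) :
    MemLp (taylor a m c g j) 2 (volume.restrict (Icc a b)) := by
  rcases lt_or_ge j m with h | h
  · exact memLp_of_continuousOn (continuousOn_taylor c hab hg h)
  · rwa [taylor_of_le h]

theorem taylor_self {m : ℕ} (c : ℕ → ℝ) (g : ℝ → ℝ) {j : ℕ} (hj : j < m) :
    taylor a m c g j a = c j := by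
  rw [taylor, if_pos hj, Finset.sum_eq_sum_Ico_succ_bot hj, Finset.sum_eq_zero]
  · simp [tau_zero]
  · intro k hk
    obtain ⟨i, hi⟩ : ∃ i, k - j = i + 1 := ⟨k - j - 1, by have := Finset.mem_Ico.1 hk; omega⟩
    rw [hi, sub_self, tau_succ_zero, zero_mul]

/-- Integrating the formula of order `j + 1` raises each τ index by one, in the polynomial directly
and in the remainder by Cauchy's formula; the new constant of integration is the term `k = j`. All
later facts about `taylor` use this recursion. -/
theorem taylor_succ {m : ℕ} (c : ℕ → ℝ) {g : ℝ → ℝ}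
    (hg : MemLp g 2 (volume.restrict (Icc a b))) {j : ℕ} (hj : j < m) {s : ℝ}
    (hs : s ∈ Icc a b) : taylor a m c g j s = c j + ∫ η in a..s, taylor a m c g (j + 1) η := by
  have hab : a ≤ b := hs.1.trans hs.2
  rw [taylor, if_pos hj]
  rcases Nat.lt_or_ge (j + 1) m with h | h
  · have e : taylor a m c g (j + 1) = fun η =>
        (∑ k ∈ Finset.Ico (j + 1) m, tau (k - (j + 1)) (η - a) * c k)
        + ∫ θ in a..η, tau (m - (j + 1 + 1)) (η - θ) * g θ := by
      funext s; rw [taylor, if_pos h]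
    have hc : ∀ k, Continuous fun η => tau (k - (j + 1)) (η - a) * c k := fun k =>
      ((continuous_tau _).comp (continuous_id.sub continuous_const)).mul continuous_const
    rw [e, intervalIntegral.integral_add
      ((continuous_finsetSum _ fun k _ => hc k).intervalIntegrable _ _)
      (((continuousOn_conv hab hg _).mono (by
        rw [uIcc_of_le hs.1]; exact Icc_subset_Icc_right hs.2)).intervalIntegrable),
      intervalIntegral.integral_finsetSum fun k _ => (hc k).intervalIntegrable _ _,
      integral_integral_tau hg _ hs, Finset.sum_eq_sum_Ico_succ_bot hj, ← add_assoc]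
    have e2 : m - (j + 1 + 1) + 1 = m - (j + 1) := by omega
    rw [e2, Nat.sub_self, tau_zero, one_mul]
    congr 2
    refine Finset.sum_congr rfl fun k hk => ?_
    have hk' := Finset.mem_Ico.1 hk
    have e3 : k - (j + 1) + 1 = k - j := by omega
    rw [intervalIntegral.integral_mul_const, integral_tau, e3]
  -- At the top order the next "derivative" is `g` itself: the polynomial has the single term `c j`
  -- and the remainder kernel is τ₀ = 1.
  · have e : m = j + 1 := by omega
    subst e
    rw [taylor_of_le le_rfl]
    simp [tau_zero]

/-- One derivative is moved off the test function at a time: the induction hypothesis handles order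
`j` with φ' as test function, and `taylor_succ` followed by integration by parts handles the last
one. -/
theorem integral_taylor_mul_iteratedDeriv (hab : a < b) {m : ℕ} (c : ℕ → ℝ) {g : ℝ → ℝ}
    (hg : MemLp g 2 (volume.restrict (Icc a b))) {j : ℕ} (hj : j ≤ m) :
    IsWeakDeriv a b j (taylor a m c g 0) (taylor a m c g j) := by
  rw [isWeakDeriv_iff]
  induction j with
  | zero => intro φ _; simp
  | succ j ih =>
    intro φ hφ
    rw [iteratedDeriv_succ', ih (Nat.le_of_succ_le hj) _ hφ.deriv, pow_succ, mul_assoc]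
    congr 1
    rw [neg_one_mul, ← integral_primitive_mul_deriv hab (memLp_taylor c hab.le hg (j + 1)) (c j) hφ]
    refine intervalIntegral.integral_congr fun s hs => ?_
    rw [uIcc_of_le hab.le] at hs
    rw [taylor_succ c hg hj hs]

/-- A function given by Taylor's formula is a Sobolev function with the expected derivatives. -/
theorem memW_of_ae_eq_taylor (hab : a < b) {m : ℕ} {c : ℕ → ℝ} {u g : ℝ → ℝ}
    (hg : MemLp g 2 (volume.restrict (Icc a b)))
    (hu : u =ᵐ[volume.restrict (Icc a b)] taylor a m c g 0) :
    MemW a b m u ∧ (∀ j ≤ m, wD a b j u =ᵐ[volume.restrict (Icc a b)] taylor a m c g j) ∧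
      ∀ j < m, EqOn (contRep a b (wD a b j u)) (taylor a m c g j) (Icc a b) := by
  have hW : ∀ j ≤ m, IsWeakDeriv a b j u (taylor a m c g j) := fun j hj =>
    (integral_taylor_mul_iteratedDeriv hab c hg hj).congr hab.le hu.symm (ae_eq_refl _)
  have hD : ∀ j ≤ m, wD a b j u =ᵐ[volume.restrict (Icc a b)] taylor a m c g j := fun j hj =>
    wD_ae_eq hab (memLp_taylor c hab.le hg j) (hW j hj)
  exact ⟨⟨(memLp_congr_ae hu).2 (memLp_taylor c hab.le hg 0),
    fun j hj => ⟨_, memLp_taylor c hab.le hg j, hW j hj⟩⟩, hD,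
    fun j hj => contRep_eq hab (continuousOn_taylor c hab.le hg hj) (hD j hj.le)⟩

/-- Taylor's formula for Sobolev functions. -/
theorem MemW.exists_taylor (hab : a < b) {m : ℕ} {u : ℝ → ℝ} (hu : MemW a b m u) :
    ∃ c : ℕ → ℝ, u =ᵐ[volume.restrict (Icc a b)] taylor a m c (wD a b m u) 0 := by
  have hspec : ∀ j ≤ m, IsWeakDeriv a b j u (wD a b j u) := fun j hj => (wD_spec (hu.2 j hj)).2
  have hm := memLp_wD (a := a) (b := b) m u
  -- The induction descends from the top order. If order `j + 1` is known, the `j`-th weak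
  -- derivative minus the primitive of the next one is orthogonal to derivatives of test functions,
  -- hence constant by du Bois-Reymond; that constant is the new coefficient.
  have key : ∀ i ≤ m, ∃ c : ℕ → ℝ, wD a b (m - i) u =ᵐ[volume.restrict (Icc a b)]
      taylor a m c (wD a b m u) (m - i) := by
    intro i
    induction i with
    | zero => intro _; exact ⟨0, by rw [taylor_of_le (by simp)]; rfl⟩
    | succ i ih =>
      intro hi
      obtain ⟨c, hc⟩ := ih (Nat.le_of_succ_le hi)
      obtain ⟨j, hj⟩ : ∃ j, j = m - (i + 1) := ⟨_, rfl⟩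
      have hj1 : m - i = j + 1 := by omega
      have hjm : j < m := by omega
      rw [hj1] at hc
      rw [← hj]
      have hpL : MemLp (fun s => ∫ θ in a..s, wD a b (j + 1) u θ) 2 (volume.restrict (Icc a b)) :=
        memLp_of_continuousOn (continuousOn_primitive hab.le (memLp_wD _ _))
      obtain ⟨d, hd⟩ := ae_const_of_test hab
        ((memLp_wD (a := a) (b := b) j u).sub hpL) (fun φ hφ => by
          have h1 := hspec j hjm.le _ hφ.deriv.1 hφ.deriv.2.1 hφ.deriv.2.2
          have h2 := hspec (j + 1) hjm _ hφ.1 hφ.2.1 hφ.2.2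
          rw [iteratedDeriv_succ', h1, pow_succ, mul_assoc] at h2
          have h3 := mul_left_cancel₀ (pow_ne_zero j (by norm_num : (-1 : ℝ) ≠ 0)) h2
          have h4 := integral_primitive_mul_deriv hab (memLp_wD (a := a) (b := b) (j + 1) u) 0 hφ
          simp only [zero_add] at h4
          simp only [Pi.sub_apply, sub_mul]
          rw [intervalIntegral.integral_sub
            (intervalIntegrable_mul_continuous hab.le (memLp_wD _ _) hφ.deriv.continuous)
            (intervalIntegrable_mul_continuous hab.le hpL hφ.deriv.continuous), h3, h4]
          ring)
      refine ⟨Function.update c j d, ?_⟩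
      -- Changing coefficient `j` is harmless, since order `j + 1` only uses coefficients with index
      -- above `j`.
      have htay : ∀ s, taylor a m (Function.update c j d) (wD a b m u) (j + 1) s
          = taylor a m c (wD a b m u) (j + 1) s := fun s => by
        simp only [taylor]
        split_ifs with h
        · congr 1
          refine Finset.sum_congr rfl fun k hk => ?_
          have := Finset.mem_Ico.1 hk
          rw [Function.update_of_ne (by omega)]
        · rfl
      filter_upwards [hd, ae_restrict_mem measurableSet_Icc] with s hs hsI
      rw [taylor_succ _ hm hjm hsI, Function.update_self]
      simp only [htay]
      have : ∫ θ in a..s, wD a b (j + 1) u θ = ∫ θ in a..s, taylor a m c (wD a b m u) (j + 1) θ := by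
        rw [integral_lower_eq hsI, integral_lower_eq hsI]
        refine integral_congr_ae ?_
        filter_upwards [hc] with θ hθ
        rw [hθ]
      rw [← this]
      simp only [Pi.sub_apply] at hs
      linarith
  obtain ⟨c, hc⟩ := key m le_rfl
  rw [Nat.sub_self] at hc
  -- At order zero the chosen weak derivative is `u` itself up to a null set.
  refine ⟨c, EventuallyEq.trans (wD_ae_eq hab hu.1 ?_).symm hc⟩
  rw [isWeakDeriv_iff]
  intro φ _
  simp

end Sobolev

/-! ### Matrix-valued functions and kernels -/

section MatrixFunctions

variable {a b : ℝ} {k l m n p q : Type}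

/-- Matrix-valued functions with entries in `L_r[a,b]`. -/
def MatLp (a b : ℝ) (r : ENNReal) (M : ℝ → Matrix m n ℝ) : Prop :=
  ∀ i j, MemLp (fun s => M s i j) r (volume.restrict (Icc a b))

/-- Matrix-valued kernels with entries in `KerL2`. -/
def MatKer (a b : ℝ) (H : ℝ → ℝ → Matrix m n ℝ) : Prop :=
  ∀ i j, KerL2 a b (fun θ η => H θ η i j)

/-- Entrywise integral over `[a,b]`. -/
noncomputable def matInt (a b : ℝ) (M : ℝ → Matrix m n ℝ) : Matrix m n ℝ :=
  Matrix.of fun i j => ∫ s in Icc a b, M s i j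

theorem MatLp.const (r : ENNReal) (M : Matrix m n ℝ) : MatLp a b r (fun _ => M) :=
  fun _ _ => memLp_const _

theorem MatLp.add {r : ENNReal} {M M' : ℝ → Matrix m n ℝ} (h : MatLp a b r M)
    (h' : MatLp a b r M') : MatLp a b r (fun s => M s + M' s) :=
  fun i j => (h i j).add (h' i j)

theorem MatLp.sub {r : ENNReal} {M M' : ℝ → Matrix m n ℝ} (h : MatLp a b r M)
    (h' : MatLp a b r M') : MatLp a b r (fun s => M s - M' s) :=
  fun i j => (h i j).sub (h' i j)

theorem MatLp.two {M : ℝ → Matrix m n ℝ} (h : MatLp a b ⊤ M) : MatLp a b 2 M :=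
  fun i j => (h i j).mono_exponent le_top

theorem MatLp.of_continuous {r : ENNReal} {M : ℝ → Matrix m n ℝ}
    (h : ∀ i j, Continuous fun s => M s i j) : MatLp a b r M := fun i j => by
  obtain ⟨C, hC⟩ := (isCompact_Icc (a := a) (b := b)).exists_bound_of_continuousOn
    (h i j).continuousOn
  exact MemLp.of_bound (h i j).aestronglyMeasurable C
    ((ae_restrict_iff' measurableSet_Icc).2 (ae_of_all _ hC))

theorem MatLp.mul_right [Fintype n] {M : ℝ → Matrix m n ℝ} {M' : ℝ → Matrix n k ℝ}
    (h : MatLp a b 2 M) (h' : MatLp a b ⊤ M') : MatLp a b 2 (fun s => M s * M' s) := fun i j => by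
  simp only [Matrix.mul_apply]
  exact memLp_finsetSum _ fun l _ => (h' l j).mul (h i l)

theorem MatLp.mul_left [Fintype n] {M : ℝ → Matrix m n ℝ} {M' : ℝ → Matrix n k ℝ}
    (h : MatLp a b ⊤ M) (h' : MatLp a b 2 M') : MatLp a b 2 (fun s => M s * M' s) := fun i j => by
  simp only [Matrix.mul_apply]
  exact memLp_finsetSum _ fun l _ => (h' l j).mul (h i l)

theorem MatLp.const_mul [Fintype n] (M : Matrix m n ℝ) {M' : ℝ → Matrix n k ℝ}
    (h' : MatLp a b 2 M') : MatLp a b 2 (fun s => M * M' s) :=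
  (MatLp.const ⊤ M).mul_left h'

theorem MatLp.mulVec [Fintype n] {M : ℝ → Matrix m n ℝ} {x : ℝ → n → ℝ}
    (h : MatLp a b ⊤ M) (hx : MemL2 a b x) : MemL2 a b (fun s => M s *ᵥ x s) := fun i => by
  simp only [Matrix.mulVec, dotProduct]
  exact memLp_finsetSum _ fun l _ => (hx l).mul (h i l)

theorem MatLp.mulVec_const [Fintype n] {M : ℝ → Matrix m n ℝ} (h : MatLp a b 2 M) (x : n → ℝ) :
    MemL2 a b (fun s => M s *ᵥ x) := fun i => by
  simp only [Matrix.mulVec, dotProduct]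
  exact memLp_finsetSum _ fun l _ => (h i l).mul_const _

theorem MemL2.add {x y : ℝ → n → ℝ} (hx : MemL2 a b x) (hy : MemL2 a b y) :
    MemL2 a b (fun s => x s + y s) := fun i => (hx i).add (hy i)

theorem MemL2.neg {x : ℝ → n → ℝ} (hx : MemL2 a b x) :
    MemL2 a b (fun s => - x s) := fun i => (hx i).neg

theorem MemL2.congr {x y : ℝ → n → ℝ} (hx : MemL2 a b x)
    (h : x =ᵐ[volume.restrict (Icc a b)] y) : MemL2 a b y := fun i =>
  (memLp_congr_ae (h.mono fun s hs => by simp only [hs])).1 (hx i)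

theorem MemL2.integrable [Fintype n] {x : ℝ → n → ℝ} (hx : MemL2 a b x) :
    Integrable x (volume.restrict (Icc a b)) :=
  Integrable.of_eval fun i => (hx i).integrable (by norm_num)

theorem MatLp.integrable_entry {M : ℝ → Matrix m n ℝ} (h : MatLp a b 2 M) (i : m) (j : n) :
    Integrable (fun s => M s i j) (volume.restrict (Icc a b)) :=
  (h i j).integrable (by norm_num)

theorem integrable_mulVec [Fintype m] [Fintype n] {M : ℝ → Matrix m n ℝ} {x : ℝ → n → ℝ}
    (h : MatLp a b 2 M) (hx : MemL2 a b x) :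
    Integrable (fun s => M s *ᵥ x s) (volume.restrict (Icc a b)) :=
  Integrable.of_eval fun i => by
    simp only [Matrix.mulVec, dotProduct]
    exact integrable_finsetSum _ fun l _ => (h i l).integrable_mul (hx l)

theorem integral_mulVec_apply [Fintype m] [Fintype n] {M : ℝ → Matrix m n ℝ} {x : ℝ → n → ℝ}
    (h : MatLp a b 2 M) (hx : MemL2 a b x) (i : m) :
    (∫ s in Icc a b, M s *ᵥ x s) i = ∑ j, ∫ s in Icc a b, M s i j * x s j := by
  have hi : ∀ i j, Integrable (fun s => M s i j * x s j) (volume.restrict (Icc a b)) :=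
    fun i j => (h i j).integrable_mul (hx j)
  rw [eval_integral]
  · simp only [Matrix.mulVec, dotProduct]
    exact integral_finsetSum _ fun j _ => hi i j
  · intro i
    simp only [Matrix.mulVec, dotProduct]
    exact integrable_finsetSum _ fun j _ => hi i j

theorem integral_mulVec_const [Fintype m] [Fintype n] {M : ℝ → Matrix m n ℝ}
    (h : MatLp a b 2 M) (x : n → ℝ) :
    ∫ s in Icc a b, M s *ᵥ x = matInt a b M *ᵥ x := by
  ext i
  rw [integral_mulVec_apply h (x := fun _ => x) (fun j => memLp_const _)]
  simp only [matInt, Matrix.mulVec, dotProduct, Matrix.of_apply, integral_mul_const]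

theorem integral_const_mulVec [Fintype m] [Fintype n] (N : Matrix m n ℝ) {x : ℝ → n → ℝ}
    {μ : Measure ℝ} (hx : Integrable x μ) : ∫ s, N *ᵥ x s ∂μ = N *ᵥ ∫ s, x s ∂μ :=
  (LinearMap.toContinuousLinearMap N.mulVecLin).integral_comp_comm hx

/-! ### Integral operators with matrix kernels and their composition. -/

theorem MatKer.integral_mem [Fintype p] [Fintype q] {H : ℝ → ℝ → Matrix p q ℝ} (hH : MatKer a b H)
    {x : ℝ → q → ℝ} (hx : MemL2 a b x) :
    MemL2 a b (fun θ => ∫ η in Icc a b, H θ η *ᵥ x η) := fun i => by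
  have h1 : MemLp (fun θ => ∑ j, ∫ η in Icc a b, H θ η i j * x η j) 2
      (volume.restrict (Icc a b)) :=
    memLp_finsetSum _ fun j _ => (hH i j).memLp_apply (hx j)
  have h2 : ∀ᵐ θ ∂(volume.restrict (Icc a b)), MatLp a b 2 (H θ) :=
    ae_all_iff.2 fun i => ae_all_iff.2 fun j => (hH i j).memLp_slice
  refine (memLp_congr_ae ?_).1 h1
  filter_upwards [h2] with θ hθ
  rw [integral_mulVec_apply hθ hx]

theorem MatKer.ae_slice [Fintype p] [Fintype q] {H : ℝ → ℝ → Matrix p q ℝ} (hH : MatKer a b H) :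
    ∀ᵐ θ ∂(volume.restrict (Icc a b)), MatLp a b 2 (H θ) :=
  ae_all_iff.2 fun i => ae_all_iff.2 fun j => (hH i j).memLp_slice

theorem MatKer.ae_coslice [Fintype m] [Fintype p] [Fintype q] {H : ℝ → ℝ → Matrix p q ℝ}
    (hH : MatKer a b H) {f : ℝ → Matrix m p ℝ} (hf : MatLp a b 2 f) :
    ∀ᵐ η ∂(volume.restrict (Icc a b)), ∀ i l j,
      Integrable (fun θ => f θ i l * H θ η l j) (volume.restrict (Icc a b)) := by
  refine ae_all_iff.2 fun i => ae_all_iff.2 fun l => ae_all_iff.2 fun j => ?_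
  have h := (hH l j).integrable (hf i l) (memLp_const (1 : ℝ))
  simp only [mul_one] at h
  exact h.prod_left_ae

/-- The integral of the matrix product splits into a sum of scalar integrals only for almost every
η, where the individual products are integrable; this suffices for membership in L₂. -/
theorem MatKer.coslice_mem [Fintype m] [Fintype p] [Fintype q] {H : ℝ → ℝ → Matrix p q ℝ}
    (hH : MatKer a b H) {f : ℝ → Matrix m p ℝ} (hf : MatLp a b 2 f) :
    MatLp a b 2 (fun η => matInt a b (fun θ => f θ * H θ η)) := fun i j => by
  have h1 : MemLp (fun η => ∑ l, ∫ θ in Icc a b, f θ i l * H θ η l j) 2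
      (volume.restrict (Icc a b)) :=
    memLp_finsetSum _ fun l _ => (hH l j).memLp_coapply (hf i l)
  refine (memLp_congr_ae ?_).1 h1
  filter_upwards [hH.ae_coslice hf] with η hη
  simp only [matInt, Matrix.of_apply, Matrix.mul_apply]
  rw [integral_finsetSum _ fun l _ => hη i l j]

/-- Fubini's theorem for the composition of integral operators. -/
theorem integral_mulVec_integral [Fintype m] [Fintype p] [Fintype q] {H : ℝ → ℝ → Matrix p q ℝ}
    (hH : MatKer a b H) {f : ℝ → Matrix m p ℝ} (hf : MatLp a b 2 f) {x : ℝ → q → ℝ}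
    (hx : MemL2 a b x) :
    ∫ θ in Icc a b, f θ *ᵥ ∫ η in Icc a b, H θ η *ᵥ x η
      = ∫ η in Icc a b, matInt a b (fun θ => f θ * H θ η) *ᵥ x η := by
  ext i
  rw [integral_mulVec_apply hf (hH.integral_mem hx),
    integral_mulVec_apply (hH.coslice_mem hf) hx]
  have hL : ∀ l, ∫ θ in Icc a b, f θ i l * (∫ η in Icc a b, H θ η *ᵥ x η) l
      = ∑ j, ∫ θ in Icc a b, ∫ η in Icc a b, f θ i l * H θ η l j * x η j := by
    intro l
    have hi : ∀ j, Integrable (fun θ => ∫ η in Icc a b, f θ i l * H θ η l j * x η j)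
        (volume.restrict (Icc a b)) := fun j =>
      ((hH l j).integrable (hf i l) (hx j)).integral_prod_left
    rw [← integral_finsetSum _ fun j _ => hi j]
    refine integral_congr_ae ?_
    filter_upwards [hH.ae_slice] with θ hθ
    rw [integral_mulVec_apply hθ hx, Finset.mul_sum]
    refine Finset.sum_congr rfl fun j _ => ?_
    rw [← integral_const_mul]
    simp only [mul_assoc]
  have hR : ∀ j, ∫ η in Icc a b, matInt a b (fun θ => f θ * H θ η) i j * x η j
      = ∑ l, ∫ η in Icc a b, ∫ θ in Icc a b, f θ i l * H θ η l j * x η j := by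
    intro j
    have hi : ∀ l, Integrable (fun η => ∫ θ in Icc a b, f θ i l * H θ η l j * x η j)
        (volume.restrict (Icc a b)) := fun l =>
      ((hH l j).integrable (hf i l) (hx j)).integral_prod_right
    rw [← integral_finsetSum _ fun l _ => hi l]
    refine integral_congr_ae ?_
    filter_upwards [hH.ae_coslice hf] with η hη
    simp only [matInt, Matrix.of_apply, Matrix.mul_apply]
    rw [integral_finsetSum _ fun l _ => hη i l j, Finset.sum_mul]
    refine Finset.sum_congr rfl fun l _ => ?_
    rw [integral_mul_const]
  rw [Finset.sum_congr rfl fun l _ => hL l, Finset.sum_congr rfl fun j _ => hR j,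
    Finset.sum_comm]
  refine Finset.sum_congr rfl fun j _ => Finset.sum_congr rfl fun l _ => ?_
  exact integral_integral_swap ((hH l j).integrable (hf i l) (hx j))

end MatrixFunctions

/-! ### Splitting integrals -/

section Split

variable {a b : ℝ} {E : Type} [NormedAddCommGroup E] [NormedSpace ℝ E]

/-- Values at the endpoints do not matter, so the diagonal, where the two kernels of a 4-PI operator
meet, can be ignored. -/
theorem integral_congr_Ioo {c d : ℝ} (hc : a ≤ c) (hcd : c ≤ d) (hd : d ≤ b) {f G : ℝ → E}
    (h : ∀ᵐ θ ∂(volume.restrict (Icc a b)), c < θ → θ < d → f θ = G θ) :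
    ∫ θ in c..d, f θ = ∫ θ in c..d, G θ := by
  rw [intervalIntegral.integral_of_le hcd, intervalIntegral.integral_of_le hcd,
    integral_Ioc_eq_integral_Ioo, integral_Ioc_eq_integral_Ioo]
  refine setIntegral_congr_ae measurableSet_Ioo ?_
  filter_upwards [(ae_restrict_iff' measurableSet_Icc).1 h] with θ hθ hI
  exact hθ ⟨hc.trans hI.1.le, hI.2.le.trans hd⟩ hI.1 hI.2

theorem intervalIntegrable_of_Icc {F : Type} [NormedAddCommGroup F] {G : ℝ → F} (hG : Integrable G (volume.restrict (Icc a b)))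
    {c d : ℝ} (hc : c ∈ Icc a b) (hd : d ∈ Icc a b) : IntervalIntegrable G volume c d := by
  rw [intervalIntegrable_iff]
  exact IntegrableOn.mono_set hG (uIoc_subset_uIcc.trans (ordConnected_Icc.uIcc_subset hc hd))

theorem integral_add_add {μ : Measure ℝ} {f g h : ℝ → E} (hf : Integrable f μ)
    (hg : Integrable g μ) (hh : Integrable h μ) :
    ∫ s, (f s + (g s + h s)) ∂μ = (∫ s, f s ∂μ) + ((∫ s, g s ∂μ) + ∫ s, h s ∂μ) := by
  rw [integral_add (g := fun s => g s + h s) hf (hg.add hh), integral_add hg hh]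

theorem integral_split {s : ℝ} (hs : s ∈ Icc a b) {f g G : ℝ → E}
    (hG : Integrable G (volume.restrict (Icc a b)))
    (hf : ∀ᵐ θ ∂(volume.restrict (Icc a b)), θ < s → f θ = G θ)
    (hg : ∀ᵐ θ ∂(volume.restrict (Icc a b)), s < θ → g θ = G θ) :
    (∫ θ in a..s, f θ) + ∫ θ in s..b, g θ = ∫ θ in Icc a b, G θ := by
  have hab := hs.1.trans hs.2
  rw [integral_congr_Ioo le_rfl hs.1 hs.2 (hf.mono fun θ h _ => h),
    integral_congr_Ioo hs.1 hs.2 le_rfl (hg.mono fun θ h h' _ => h h'),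
    intervalIntegral.integral_add_adjacent_intervals
      (intervalIntegrable_of_Icc hG (left_mem_Icc.2 hab) hs)
      (intervalIntegrable_of_Icc hG hs (right_mem_Icc.2 hab)),
    intervalIntegral.integral_of_le hab, integral_Icc_eq_integral_Ioc]

/-- Needed for composed kernels: for fixed outer variables the inner variable crosses two diagonals,
which cut `[a, b]` into three zones. -/
theorem integral_split_three {r s : ℝ} (hr : a ≤ r) (hrs : r ≤ s) (hs : s ≤ b) {f g h G : ℝ → E}
    (hG : Integrable G (volume.restrict (Icc a b)))
    (hf : ∀ θ, θ < r → f θ = G θ) (hg : ∀ θ, r < θ → θ < s → g θ = G θ)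
    (hh : ∀ θ, s < θ → h θ = G θ) :
    (∫ θ in a..r, f θ) + (∫ θ in r..s, g θ) + ∫ θ in s..b, h θ = ∫ θ in Icc a b, G θ := by
  have hab := hr.trans (hrs.trans hs)
  have ha : a ∈ Icc a b := left_mem_Icc.2 hab
  have hb : b ∈ Icc a b := right_mem_Icc.2 hab
  have hrI : r ∈ Icc a b := ⟨hr, hrs.trans hs⟩
  have hsI : s ∈ Icc a b := ⟨hr.trans hrs, hs⟩
  rw [integral_congr_Ioo le_rfl hr hrI.2 (ae_of_all _ fun θ _ h => hf θ h),
    integral_congr_Ioo hr hrs hs (ae_of_all _ fun θ h h' => hg θ h h'),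
    integral_congr_Ioo hsI.1 hs le_rfl (ae_of_all _ fun θ h' _ => hh θ h'),
    intervalIntegral.integral_add_adjacent_intervals (intervalIntegrable_of_Icc hG ha hrI)
      (intervalIntegrable_of_Icc hG hrI hsI),
    intervalIntegral.integral_add_adjacent_intervals (intervalIntegrable_of_Icc hG ha hsI)
      (intervalIntegrable_of_Icc hG hsI hb),
    intervalIntegral.integral_of_le hab, integral_Icc_eq_integral_Ioc]

end Split

/-! ### Composition of 4-PI operators -/

section Composition

variable {a b : ℝ} {k l m n p q : Type}

/-- 4-PI parameters for which the operator is defined on `ℝL₂`. -/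
structure PI4.Reg (a b : ℝ) (K : PI4 m n p q) : Prop where
  Q1 : MatLp a b 2 K.Q1
  Q2 : MatLp a b 2 K.Q2
  R0 : MatLp a b ⊤ K.R0
  R1 : MatKer a b K.R1
  R2 : MatKer a b K.R2

/-- The kernel of the integral part of a 4-PI operator. -/
noncomputable def PI4.ker (K : PI4 m n p q) (θ η : ℝ) : Matrix p q ℝ :=
  if η ≤ θ then K.R1 θ η else K.R2 θ η

theorem PI4.ker_of_lt {K : PI4 m n p q} {θ η : ℝ} (h : η < θ) : K.ker θ η = K.R1 θ η :=
  if_pos h.le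

theorem PI4.ker_of_gt {K : PI4 m n p q} {θ η : ℝ} (h : θ < η) : K.ker θ η = K.R2 θ η :=
  if_neg (not_le.2 h)

theorem PI4.Reg.ker {K : PI4 m n p q} (hK : K.Reg a b) : MatKer a b K.ker := fun i j => by
  have := (hK.R1 i j).ite (hK.R2 i j)
  convert this using 3
  simp only [PI4.ker]
  split_ifs <;> rfl

theorem matInt_eq_mint (hab : a ≤ b) (M : ℝ → Matrix m n ℝ) : mint a b M = matInt a b M := by
  ext i j
  exact integral_eq_Icc hab _

theorem mint_add_mint {s : ℝ} (hs : s ∈ Icc a b) {f g G : ℝ → Matrix m n ℝ}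
    (hG : ∀ i j, Integrable (fun θ => G θ i j) (volume.restrict (Icc a b)))
    (hf : ∀ θ, θ < s → f θ = G θ) (hg : ∀ θ, s < θ → g θ = G θ) :
    mint a s f + mint s b g = matInt a b G := by
  ext i j
  exact integral_split hs (hG i j) (ae_of_all _ fun θ h => by rw [hf θ h])
    (ae_of_all _ fun θ h => by rw [hg θ h])

theorem mint_add_mint_add_mint {r s : ℝ} (hr : a ≤ r) (hrs : r ≤ s) (hs : s ≤ b)
    {f g h G : ℝ → Matrix m n ℝ}
    (hG : ∀ i j, Integrable (fun θ => G θ i j) (volume.restrict (Icc a b)))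
    (hf : ∀ θ, θ < r → f θ = G θ) (hg : ∀ θ, r < θ → θ < s → g θ = G θ)
    (hh : ∀ θ, s < θ → h θ = G θ) :
    mint a r f + mint r s g + mint s b h = matInt a b G := by
  ext i j
  exact integral_split_three hr hrs hs (hG i j) (fun θ h => by rw [hf θ h])
    (fun θ h h' => by rw [hg θ h h']) (fun θ h => by rw [hh θ h])

theorem MatKer.ae_coslice_mul [Fintype m] [Fintype p] [Fintype q] {H : ℝ → ℝ → Matrix p q ℝ}
    (hH : MatKer a b H) {f : ℝ → Matrix m p ℝ} (hf : MatLp a b 2 f) :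
    ∀ᵐ η ∂(volume.restrict (Icc a b)), ∀ i j,
      Integrable (fun θ => (f θ * H θ η) i j) (volume.restrict (Icc a b)) := by
  filter_upwards [hH.ae_coslice hf] with η hη i j
  simp only [Matrix.mul_apply]
  exact integrable_finsetSum _ fun l _ => hη i l j

/-- The two one-sided integrals in the product formula use `R2` for θ below η and `R1` above, which
is exactly the glued kernel of `L`. The gluing requires integrability, available for almost every η.
-/
theorem PI4.comp_Q1_ae [Fintype k] [Fintype l] [Fintype m] [Fintype q] {K : PI4 m k p l} {L : PI4 k n l q} (hK : K.Reg a b) (hL : L.Reg a b) :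
    (K.comp a b L).Q1 =ᵐ[volume.restrict (Icc a b)] fun η =>
      K.P * L.Q1 η + (K.Q1 η * L.R0 η + matInt a b (fun θ => K.Q1 θ * L.ker θ η)) := by
  filter_upwards [hL.ker.ae_coslice_mul hK.Q1, ae_restrict_mem measurableSet_Icc] with η hη hI
  rw [← mint_add_mint hI hη (f := fun θ => K.Q1 θ * L.R2 θ η) (g := fun θ => K.Q1 θ * L.R1 θ η)
    (fun θ h => by rw [PI4.ker_of_gt h]) (fun θ h => by rw [PI4.ker_of_lt h])]
  simp only [PI4.comp]
  abel

/-- The position of θ relative to `s` selects the kernel of `K`, and relative to η the kernel of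
`L`. Each ordering of η and `s` gives the three zones in the corresponding product formula; the case
η = s is a null set. -/
theorem PI4.comp_ker_ae [Fintype k] [Fintype l] [Fintype p] [Fintype q] {K : PI4 m k p l} {L : PI4 k n l q} (hL : L.Reg a b) {s : ℝ}
    (hs : s ∈ Icc a b) (hKs : MatLp a b 2 (K.ker s)) :
    ∀ᵐ η ∂(volume.restrict (Icc a b)), η ≠ s → (K.comp a b L).ker s η =
      K.Q2 s * L.Q1 η + (K.R0 s * L.ker s η
        + (K.ker s η * L.R0 η + matInt a b (fun θ => K.ker s θ * L.ker θ η))) := by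
  filter_upwards [hL.ker.ae_coslice_mul hKs, ae_restrict_mem measurableSet_Icc] with η hη hI hne
  rcases lt_or_gt_of_ne hne with h | h
  · rw [← mint_add_mint_add_mint hI.1 h.le hs.2 hη (f := fun θ => K.R1 s θ * L.R2 θ η)
      (g := fun θ => K.R1 s θ * L.R1 θ η) (h := fun θ => K.R2 s θ * L.R1 θ η)
      (fun θ h' => by rw [PI4.ker_of_gt h', PI4.ker_of_lt (h'.trans h)])
      (fun θ h' h'' => by rw [PI4.ker_of_lt h', PI4.ker_of_lt h''])
      (fun θ h' => by rw [PI4.ker_of_gt h', PI4.ker_of_lt (h.trans h')]),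
      PI4.ker_of_lt h, PI4.ker_of_lt h, PI4.ker_of_lt h]
    simp only [PI4.comp]
    abel
  · rw [← mint_add_mint_add_mint hs.1 h.le hI.2 hη (f := fun θ => K.R1 s θ * L.R2 θ η)
      (g := fun θ => K.R2 s θ * L.R2 θ η) (h := fun θ => K.R2 s θ * L.R1 θ η)
      (fun θ h' => by rw [PI4.ker_of_lt h', PI4.ker_of_gt (h'.trans h)])
      (fun θ h' h'' => by rw [PI4.ker_of_gt h', PI4.ker_of_gt h''])
      (fun θ h' => by rw [PI4.ker_of_lt h', PI4.ker_of_gt (h.trans h')]),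
      PI4.ker_of_gt h, PI4.ker_of_gt h, PI4.ker_of_gt h]
    simp only [PI4.comp]
    abel

theorem PI4.comp_Q1_mem [Fintype k] [Fintype l] [Fintype m] [Fintype q] {K : PI4 m k p l} {L : PI4 k n l q} (hK : K.Reg a b) (hL : L.Reg a b) :
    MatLp a b 2 (K.comp a b L).Q1 := fun i j => by
  refine (memLp_congr_ae ?_).1 (((hL.Q1.const_mul K.P).add ((hK.Q1.mul_right hL.R0).add
    (hL.ker.coslice_mem hK.Q1))) i j)
  filter_upwards [PI4.comp_Q1_ae hK hL] with η hη
  rw [hη]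

variable [Fintype k] [Fintype l] [Fintype m] [Fintype n] [Fintype p] [Fintype q]

theorem PI4.apply_fst (hab : a ≤ b) (K : PI4 m n p q) (x : RL2 n q) :
    (K.apply a b x).1 = K.P *ᵥ x.1 + ∫ θ in Icc a b, K.Q1 θ *ᵥ x.2 θ := by
  rw [PI4.apply, intervalIntegral.integral_of_le hab, integral_Icc_eq_integral_Ioc]

theorem PI4.apply_snd {K : PI4 m n p q} (hK : K.Reg a b) {x : RL2 n q} (hx : MemL2 a b x.2) :
    (K.apply a b x).2 =ᵐ[volume.restrict (Icc a b)] fun s =>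
      K.Q2 s *ᵥ x.1 + (K.R0 s *ᵥ x.2 s + ∫ θ in Icc a b, K.ker s θ *ᵥ x.2 θ) := by
  filter_upwards [hK.ker.ae_slice, ae_restrict_mem measurableSet_Icc] with s hs hsI
  simp only [PI4.apply, add_assoc]
  rw [integral_split hsI (integrable_mulVec hs hx)
    (ae_of_all _ fun θ h => by rw [PI4.ker_of_lt h])
    (ae_of_all _ fun θ h => by rw [PI4.ker_of_gt h])]

theorem PI4.apply_snd_mem {K : PI4 m n p q} (hK : K.Reg a b) {x : RL2 n q}
    (hx : MemL2 a b x.2) : MemL2 a b (K.apply a b x).2 :=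
  MemL2.congr ((hK.Q2.mulVec_const x.1).add ((hK.R0.mulVec hx).add (hK.ker.integral_mem hx)))
    (PI4.apply_snd hK hx).symm

/-- Integration of a 4-PI operator against a matrix-valued function. -/
theorem PI4.integral_mulVec_apply {L : PI4 k n l q} (hL : L.Reg a b) {x : RL2 n q}
    (hx : MemL2 a b x.2) {f : ℝ → Matrix m l ℝ} (hf : MatLp a b 2 f)
    (hQ : MatLp a b ⊤ L.Q2) :
    ∫ θ in Icc a b, f θ *ᵥ (L.apply a b x).2 θ
      = matInt a b (fun θ => f θ * L.Q2 θ) *ᵥ x.1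
        + ∫ η in Icc a b, (f η * L.R0 η + matInt a b (fun θ => f θ * L.ker θ η)) *ᵥ x.2 η := by
  -- As `f` is only square integrable, essential boundedness of `L.Q2` is what keeps the product in
  -- L₂.
  have hQ2 : MatLp a b 2 (fun θ => f θ * L.Q2 θ) := hf.mul_right hQ
  have e : ∫ θ in Icc a b, f θ *ᵥ (L.apply a b x).2 θ = ∫ θ in Icc a b,
      ((f θ * L.Q2 θ) *ᵥ x.1 + ((f θ * L.R0 θ) *ᵥ x.2 θ
        + f θ *ᵥ ∫ η in Icc a b, L.ker θ η *ᵥ x.2 η)) := by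
    refine integral_congr_ae ?_
    filter_upwards [PI4.apply_snd hL hx] with θ hθ
    rw [hθ, mulVec_add, mulVec_add, mulVec_mulVec, mulVec_mulVec]
  have i1 := (hQ2.mulVec_const x.1).integrable
  have i2 := integrable_mulVec (hf.mul_right hL.R0) hx
  have i3 := integrable_mulVec hf (hL.ker.integral_mem hx)
  have i4 := integrable_mulVec (hL.ker.coslice_mem hf) hx
  rw [e, integral_add_add i1 i2 i3, integral_mulVec_const hQ2,
    integral_mulVec_integral hL.ker hf hx, ← integral_add i2 i4]
  simp only [add_mulVec]

/-- The finite-dimensional component of a composition of 4-PI operators. -/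
theorem PI4.comp_apply_fst (hab : a ≤ b) {K : PI4 m k p l} {L : PI4 k n l q} (hK : K.Reg a b)
    (hL : L.Reg a b) (hQ : MatLp a b ⊤ L.Q2) {x : RL2 n q} (hx : MemL2 a b x.2) :
    ((K.comp a b L).apply a b x).1 = (K.apply a b (L.apply a b x)).1 := by
  rw [PI4.apply_fst hab, PI4.apply_fst hab, PI4.apply_fst hab,
    PI4.integral_mulVec_apply hL hx hK.Q1 hQ]
  have e : ∫ θ in Icc a b, (K.comp a b L).Q1 θ *ᵥ x.2 θ = ∫ η in Icc a b, (K.P *ᵥ L.Q1 η *ᵥ x.2 η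
      + (K.Q1 η * L.R0 η + matInt a b (fun θ => K.Q1 θ * L.ker θ η)) *ᵥ x.2 η) := by
    refine integral_congr_ae ?_
    filter_upwards [PI4.comp_Q1_ae hK hL] with η hη
    rw [hη, add_mulVec, mulVec_mulVec]
  have i1 := integrable_mulVec (hL.Q1.const_mul K.P) hx
  simp only [← mulVec_mulVec] at i1
  rw [e, integral_add i1
    (integrable_mulVec ((hK.Q1.mul_right hL.R0).add (hL.ker.coslice_mem hK.Q1)) hx),
    integral_const_mulVec _ (integrable_mulVec hL.Q1 hx)]
  simp only [PI4.comp, matInt_eq_mint hab, add_mulVec, mulVec_add, mulVec_mulVec]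
  abel

/-- The distributed component of a composition of 4-PI operators. -/
theorem PI4.comp_apply_snd (hab : a ≤ b) {K : PI4 m k p l} {L : PI4 k n l q} (hK : K.Reg a b)
    (hL : L.Reg a b) (hQ : MatLp a b ⊤ L.Q2) {x : RL2 n q} (hx : MemL2 a b x.2) :
    ((K.comp a b L).apply a b x).2 =ᵐ[volume.restrict (Icc a b)]
      (K.apply a b (L.apply a b x)).2 := by
  filter_upwards [hK.ker.ae_slice, hL.ker.ae_slice, ae_restrict_mem measurableSet_Icc,
    PI4.apply_snd hL hx, PI4.apply_snd hK (x := L.apply a b x) (PI4.apply_snd_mem hL hx)]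
    with s hKs hLs hs h1 h2
  have i1 := integrable_mulVec hL.Q1 hx
  have i1' := integrable_mulVec (hL.Q1.const_mul (K.Q2 s)) hx
  have i2 := integrable_mulVec hLs hx
  have i2' := integrable_mulVec (hLs.const_mul (K.R0 s)) hx
  have i3 := integrable_mulVec ((hKs.mul_right hL.R0).add (hL.ker.coslice_mem hKs)) hx
  rw [h2, h1, PI4.apply_fst hab, PI4.integral_mulVec_apply hL hx hKs hQ]
  have hker := PI4.comp_ker_ae (K := K) hL hs hKs
  -- The two one-sided integrals of the composite merge into one over `[a, b]`, the form in which
  -- Fubini's theorem was applied on the other side.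
  have e : (∫ θ in a..s, (K.comp a b L).R1 s θ *ᵥ x.2 θ)
      + ∫ θ in s..b, (K.comp a b L).R2 s θ *ᵥ x.2 θ = ∫ η in Icc a b,
      ((K.Q2 s * L.Q1 η) *ᵥ x.2 η + ((K.R0 s * L.ker s η) *ᵥ x.2 η
        + (K.ker s η * L.R0 η + matInt a b (fun θ => K.ker s θ * L.ker θ η)) *ᵥ x.2 η)) := by
    refine integral_split hs (i1'.add (i2'.add i3)) ?_ ?_
    · filter_upwards [hker] with η hη h
      rw [← PI4.ker_of_lt h, hη h.ne]
      simp only [add_mulVec]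
    · filter_upwards [hker] with η hη h
      rw [← PI4.ker_of_gt h, hη h.ne']
      simp only [add_mulVec]
  have eQ : (K.comp a b L).Q2 s = K.Q2 s * L.P + K.R0 s * L.Q2 s
      + matInt a b (fun θ => K.ker s θ * L.Q2 θ) := by
    rw [← mint_add_mint hs (hKs.mul_right hQ).integrable_entry
      (f := fun θ => K.R1 s θ * L.Q2 θ) (g := fun θ => K.R2 s θ * L.Q2 θ)
      (fun θ h => by rw [PI4.ker_of_lt h]) (fun θ h => by rw [PI4.ker_of_gt h])]
    simp only [PI4.comp]
    abel
  have eR : (K.comp a b L).R0 s = K.R0 s * L.R0 s := rfl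
  have e0 : ((K.comp a b L).apply a b x).2 s = (K.comp a b L).Q2 s *ᵥ x.1
      + ((K.comp a b L).R0 s *ᵥ x.2 s + (∫ θ in a..s, (K.comp a b L).R1 s θ *ᵥ x.2 θ)
      + ∫ θ in s..b, (K.comp a b L).R2 s θ *ᵥ x.2 θ) := rfl
  rw [e0, add_assoc ((K.comp a b L).R0 s *ᵥ x.2 s), e, eQ, eR, integral_add_add i1' i2' i3]
  simp only [← mulVec_mulVec]
  rw [integral_const_mulVec _ i1, integral_const_mulVec _ i2]
  simp only [add_mulVec, mulVec_add, mulVec_mulVec]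
  abel

end Composition

/-! ### Taylor's formula in block form -/

section BlockForm

variable {N : ℕ} {n : Fin (N + 1) → ℕ} {a b : ℝ}

/-- The derivatives at `a` of the component `p`, extracted from a vector indexed by `CIdx n`. -/
noncomputable def coef (c : CIdx n → ℝ) (p : XIdx n) (k : ℕ) : ℝ :=
  if h : k + 1 ≤ (p.1 : ℕ) then c ⟨(⟨k, by have := p.1.2; omega⟩, p), h⟩ else 0

theorem coef_idx (c : CIdx n → ℝ) (d : CIdx n) : coef c d.1.2 d.1.1 = c d := by
  rw [coef, dif_pos d.2]

/-- The indices attached to a fixed component `p` are exactly its orders strictly below `p.1`. This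
converts block matrix products into the finite sums of `taylor`. -/
theorem sum_CIdx (f : ℕ → ℝ) (c : CIdx n → ℝ) (p : XIdx n) (j : ℕ) :
    ∑ d : CIdx n, (if d.1.2 = p ∧ j ≤ d.1.1 then f d.1.1 else 0) * c d
      = ∑ k ∈ Finset.Ico j p.1, f k * coef c p k := by
  simp only [ite_mul, zero_mul]
  rw [← Finset.sum_filter]
  refine Finset.sum_bij (fun d _ => (d.1.1 : ℕ)) ?_ ?_ ?_ ?_
  · intro d hd
    obtain ⟨h1, h2⟩ := (Finset.mem_filter.1 hd).2
    have := d.2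
    rw [h1] at this
    exact Finset.mem_Ico.2 ⟨h2, this⟩
  · intro d hd d' hd' h
    have h1 := (Finset.mem_filter.1 hd).2.1
    have h1' := (Finset.mem_filter.1 hd').2.1
    exact Subtype.ext (Prod.ext (Fin.ext h) (h1.trans h1'.symm))
  · intro k hk
    have hk' := Finset.mem_Ico.1 hk
    have := p.1.2
    exact ⟨⟨(⟨k, by omega⟩, p), hk'.2⟩, by simp [hk'.1], rfl⟩
  · intro d hd
    have h1 := (Finset.mem_filter.1 hd).2.1
    rw [← h1, coef_idx]

theorem matT_mulVec (s : ℝ) (c : CIdx n → ℝ) (e : CIdx n) :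
    (matT n s *ᵥ c) e = ∑ k ∈ Finset.Ico (e.1.1 : ℕ) e.1.2.1, tau (k - e.1.1) s
      * coef c e.1.2 k := by
  rw [← sum_CIdx (fun k => tau (k - e.1.1) s)]
  simp only [matT, Matrix.mulVec, dotProduct, Matrix.of_apply]
  refine Finset.sum_congr rfl fun d _ => ?_
  congr 1
  refine if_congr ?_ rfl rfl
  rw [Fin.le_def, eq_comm]

theorem matT1_mulVec (s : ℝ) (c : CIdx n → ℝ) (p : XIdx n) :
    (matT1 n s *ᵥ c) p = ∑ k ∈ Finset.Ico 0 (p.1 : ℕ), tau (k - 0) s * coef c p k := by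
  rw [← sum_CIdx (fun k => tau (k - 0) s)]
  simp only [matT1, Matrix.mulVec, dotProduct, Matrix.of_apply]
  refine Finset.sum_congr rfl fun d _ => ?_
  congr 1
  refine if_congr ?_ rfl rfl
  simp [eq_comm]

theorem matQ_mulVec (s : ℝ) (x : XIdx n → ℝ) (e : CIdx n) :
    (matQ n s *ᵥ x) e = tau ((e.1.2.1 : ℕ) - (e.1.1 + 1)) s * x e.1.2 := by
  simp [matQ, Matrix.mulVec, dotProduct]

theorem matQ1_mulVec (s : ℝ) (x : XIdx n → ℝ) (p : XIdx n) :
    (matQ1 n s *ᵥ x) p = if 1 ≤ (p.1 : ℕ) then tau ((p.1 : ℕ) - 1) s * x p else 0 := by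
  simp only [matQ1, Matrix.mulVec, dotProduct, Matrix.of_apply]
  rw [Finset.sum_eq_single p (fun q _ h => by rw [if_neg fun h' => h h'.1.symm, zero_mul])
    (fun h => absurd (Finset.mem_univ p) h)]
  simp

theorem matG0_mulVec (x : XIdx n → ℝ) (p : XIdx n) :
    (matG0 n *ᵥ x) p = if (p.1 : ℕ) = 0 then x p else 0 := by
  simp only [matG0, Matrix.mulVec, dotProduct, Matrix.of_apply]
  rw [Finset.sum_eq_single p (fun q _ h => by rw [if_neg fun h' => h h'.1.symm, zero_mul])
    (fun h => absurd (Finset.mem_univ p) h)]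
  simp

theorem matU1_mulVec (x : XIdx n → ℝ) (f : FIdx n) :
    (matU1 n *ᵥ x) f = if (f.1.1 : ℕ) = f.1.2.1 then x f.1.2 else 0 := by
  simp only [matU1, Matrix.mulVec, dotProduct, Matrix.of_apply]
  rw [Finset.sum_eq_single f.1.2 (fun q _ h => by rw [if_neg fun h' => h h'.1.symm, zero_mul])
    (fun h => absurd (Finset.mem_univ f.1.2) h)]
  simp

theorem matU2_mulVec_of_lt (c : CIdx n → ℝ) (e : CIdx n) (f : FIdx n) (h1 : f.1.2 = e.1.2)
    (h2 : (f.1.1 : ℕ) = e.1.1) : (matU2 n *ᵥ c) f = c e := by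
  simp only [matU2, Matrix.mulVec, dotProduct, Matrix.of_apply]
  rw [Finset.sum_eq_single e]
  · simp [h1, h2]
  · intro d _ hd
    rw [if_neg, zero_mul]
    rintro ⟨h3, h4⟩
    exact hd (Subtype.ext (Prod.ext (Fin.ext (h4.symm.trans h2)) (h3.symm.trans h1)))
  · exact fun h => absurd (Finset.mem_univ e) h

theorem matU2_mulVec_of_eq (c : CIdx n → ℝ) (f : FIdx n) (h : (f.1.1 : ℕ) = f.1.2.1) :
    (matU2 n *ᵥ c) f = 0 := by
  simp only [matU2, Matrix.mulVec, dotProduct, Matrix.of_apply]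
  refine Finset.sum_eq_zero fun d _ => ?_
  rw [if_neg, zero_mul]
  rintro ⟨h3, h4⟩
  have := d.2
  rw [← h3, ← h4] at this
  omega

/-- At zero only τ₀ survives, hence only the diagonal. This is why `c` is literally the boundary
value at `a`. -/
theorem matT_zero : matT n 0 = 1 := by
  have h : ∀ c : CIdx n → ℝ, matT n 0 *ᵥ c = 1 *ᵥ c := by
    intro c
    ext e
    have he : (e.1.1 : ℕ) < (e.1.2.1 : ℕ) := e.2
    rw [matT_mulVec, one_mulVec, Finset.sum_eq_sum_Ico_succ_bot he, Finset.sum_eq_zero,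
      Nat.sub_self, tau_zero, one_mul, add_zero, coef_idx]
    intro k hk
    obtain ⟨i, hi⟩ : ∃ i, k - (e.1.1 : ℕ) = i + 1 :=
      ⟨k - e.1.1 - 1, by have := Finset.mem_Ico.1 hk; omega⟩
    rw [hi, tau_succ_zero, zero_mul]
  exact Matrix.mulVec_injective (funext h)

theorem continuous_matT (i j : CIdx n) : Continuous fun s => matT n s i j := by
  simp only [matT, Matrix.of_apply]
  split_ifs
  · exact continuous_tau _
  · exact continuous_const

theorem continuous_matT1 (i : XIdx n) (j : CIdx n) : Continuous fun s => matT1 n s i j := by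
  simp only [matT1, Matrix.of_apply]
  split_ifs
  · exact continuous_tau _
  · exact continuous_const

theorem continuous_matQ (i : CIdx n) (j : XIdx n) : Continuous fun s => matQ n s i j := by
  simp only [matQ, Matrix.of_apply]
  split_ifs
  · exact continuous_tau _
  · exact continuous_const

theorem continuous_matQ1 (i j : XIdx n) : Continuous fun s => matQ1 n s i j := by
  simp only [matQ1, Matrix.of_apply]
  split_ifs
  · exact continuous_tau _
  · exact continuous_const

theorem continuous_const_mul_entry {m k l : Type} [Fintype k] (M : Matrix m k ℝ) {X : Type}
    [TopologicalSpace X] {F : X → Matrix k l ℝ} (hF : ∀ i j, Continuous fun s => F s i j)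
    (i : m) (j : l) : Continuous fun s => (M * F s) i j := by
  simp only [Matrix.mul_apply]
  exact continuous_finsetSum _ fun k _ => continuous_const.mul (hF k j)

/-- Maps `((𝒞x̂)(a), 𝒟x̂)` to `((𝒞x̂)(b), ℱx̂)`. -/
noncomputable def fOp (n : Fin (N + 1) → ℕ) (a b : ℝ) :
    PI4 (CIdx n) (CIdx n) (FIdx n) (XIdx n) where
  P := matT n (b - a)
  Q1 := fun θ => matQ n (b - θ)
  Q2 := fun s => matU2 n * matT n (s - a)
  R0 := fun _ => matU1 n
  R1 := fun s θ => matU2 n * matQ n (s - θ)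
  R2 := fun _ _ => 0

/-- Maps `((𝒞x̂)(a), 𝒟x̂)` to `((𝒞x̂)(a), x̂)`. -/
noncomputable def xOp (n : Fin (N + 1) → ℕ) (a : ℝ) :
    PI4 (CIdx n) (CIdx n) (XIdx n) (XIdx n) where
  P := 1
  Q1 := fun _ => 0
  Q2 := fun s => matT1 n (s - a)
  R0 := fun _ => matG0 n
  R1 := fun s θ => matQ1 n (s - θ)
  R2 := fun _ _ => 0

theorem MatKer.of_continuous {m k : Type} {F : ℝ → Matrix m k ℝ}
    (hF : ∀ i j, Continuous fun s => F s i j) : MatKer a b (fun s θ => F (s - θ)) := fun i j =>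
  KerL2.of_continuous ((hF i j).comp (continuous_fst.sub continuous_snd))

theorem fOp_Q2_mem {r : ENNReal} : MatLp a b r (fOp n a b).Q2 :=
  MatLp.of_continuous (continuous_const_mul_entry _
    fun i j => (continuous_matT i j).comp (continuous_id.sub continuous_const))

theorem fOp_Q1_mem {r : ENNReal} : MatLp a b r (fOp n a b).Q1 :=
  MatLp.of_continuous fun i j => (continuous_matQ i j).comp (continuous_const.sub continuous_id)

theorem fOp_reg : (fOp n a b).Reg a b where
  Q1 := fOp_Q1_mem
  Q2 := fOp_Q2_mem
  R0 := MatLp.const _ _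
  R1 := MatKer.of_continuous (continuous_const_mul_entry _ continuous_matQ)
  R2 := fun _ _ => KerL2.zero

theorem xOp_reg : (xOp n a).Reg a b where
  Q1 := MatLp.const _ _
  Q2 := MatLp.of_continuous fun i j =>
    (continuous_matT1 i j).comp (continuous_id.sub continuous_const)
  R0 := MatLp.const _ _
  R1 := MatKer.of_continuous continuous_matQ1
  R2 := fun _ _ => KerL2.zero

theorem intervalIntegral_mulVec_apply {m k : Type} [Fintype m] [Fintype k] {s : ℝ}
    (hs : s ∈ Icc a b) {M : ℝ → Matrix m k ℝ} {x : ℝ → k → ℝ} (h : MatLp a b 2 M)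
    (hx : MemL2 a b x) (i : m) :
    (∫ θ in a..s, M θ *ᵥ x θ) i = ∫ θ in a..s, (M θ *ᵥ x θ) i := by
  have hi := intervalIntegrable_of_Icc (integrable_mulVec h hx)
    (left_mem_Icc.2 (hs.1.trans hs.2)) hs
  exact ((ContinuousLinearMap.proj (R := ℝ) (φ := fun _ : m => ℝ) i).intervalIntegral_comp_comm
    hi).symm

/-- Row `p` of the block matrices spells out Taylor's formula at order zero. Components with `p.1 =
0` have no Taylor coefficients or remainder, and there `matG0` supplies the value of `D` itself. -/
theorem xOp_apply {c : CIdx n → ℝ} {D : ℝ → XIdx n → ℝ} (hD : MemL2 a b D) {s : ℝ}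
    (hs : s ∈ Icc a b) (p : XIdx n) :
    ((xOp n a).apply a b (c, D)).2 s p = taylor a p.1 (coef c p) (fun θ => D θ p) 0 s := by
  have hQ : MatLp a b 2 (fun θ => matQ1 n (s - θ)) := MatLp.of_continuous fun i j =>
    (continuous_matQ1 i j).comp (continuous_const.sub continuous_id)
  simp only [PI4.apply, xOp, zero_mulVec, intervalIntegral.integral_zero, add_zero, Pi.add_apply]
  rw [intervalIntegral_mulVec_apply hs hQ hD]
  simp only [matT1_mulVec, matG0_mulVec, matQ1_mulVec, taylor]
  rcases Nat.eq_zero_or_pos (p.1 : ℕ) with h | h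
  · simp [h]
  · have h1 : 1 ≤ (p.1 : ℕ) := h
    simp [h, h1, h.ne']

/-- `matU2` selects derivatives below the top order, given by the polynomial and remainder of
`taylor`; `matU1` selects the top order, where `taylor` is `D` itself. -/
theorem fOp_apply_snd {c : CIdx n → ℝ} {D : ℝ → XIdx n → ℝ} (hD : MemL2 a b D) {s : ℝ}
    (hs : s ∈ Icc a b) (f : FIdx n) :
    ((fOp n a b).apply a b (c, D)).2 s f
      = taylor a f.1.2.1 (coef c f.1.2) (fun θ => D θ f.1.2) f.1.1 s := by
  have hQ : MatLp a b 2 (fun θ => matU2 n * matQ n (s - θ)) :=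
    MatLp.of_continuous (continuous_const_mul_entry _ fun i j =>
      (continuous_matQ i j).comp (continuous_const.sub continuous_id))
  simp only [PI4.apply, fOp, zero_mulVec, intervalIntegral.integral_zero, add_zero, Pi.add_apply]
  rw [intervalIntegral_mulVec_apply hs hQ hD]
  simp only [← mulVec_mulVec, matU1_mulVec, taylor]
  rcases Nat.lt_or_ge (f.1.1 : ℕ) (f.1.2.1 : ℕ) with h | h
  · have hN := f.1.2.1.2
    set e : CIdx n := ⟨(⟨f.1.1, by omega⟩, f.1.2), h⟩ with he
    simp only [fun c => matU2_mulVec_of_lt c e f rfl rfl, matT_mulVec, matQ_mulVec, if_pos h,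
      if_neg h.ne, he, zero_add]
  · have h' : (f.1.1 : ℕ) = f.1.2.1 := le_antisymm f.2 h
    simp only [fun c => matU2_mulVec_of_eq c f h', if_pos h', if_neg (not_lt.2 h),
      intervalIntegral.integral_zero, zero_add, add_zero]

theorem fOp_apply_fst (hab : a ≤ b) {c : CIdx n → ℝ} {D : ℝ → XIdx n → ℝ} (hD : MemL2 a b D)
    (e : CIdx n) : ((fOp n a b).apply a b (c, D)).1 e
      = taylor a e.1.2.1 (coef c e.1.2) (fun θ => D θ e.1.2) e.1.1 b := by
  have hQ : MatLp a b 2 (fun θ => matQ n (b - θ)) := fOp_Q1_mem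
  simp only [PI4.apply, fOp, Pi.add_apply]
  rw [intervalIntegral_mulVec_apply (right_mem_Icc.2 hab) hQ hD]
  have h : (e.1.1 : ℕ) < e.1.2.1 := e.2
  simp only [matT_mulVec, matQ_mulVec, taylor, if_pos h]

theorem opD_mem (xh : ℝ → XIdx n → ℝ) : MemL2 a b (opD a b xh) := fun _ => memLp_wD _ _

theorem ae_eq_of_forall_ae {ι : Type} [Countable ι] {μ : Measure ℝ} {f g : ℝ → ι → ℝ}
    (h : ∀ i, (fun s => f s i) =ᵐ[μ] fun s => g s i) : f =ᵐ[μ] g := by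
  filter_upwards [ae_all_iff.2 h] with s hs
  exact funext hs

/-- A vector of functions given by Taylor's formula lies in `Wⁿ` and has the expected derivatives
and boundary values. -/
theorem memWn_of_ae_eq (hab : a < b) {xh : ℝ → XIdx n → ℝ} {c : CIdx n → ℝ}
    {D : ℝ → XIdx n → ℝ} (hD : MemL2 a b D)
    (h : xh =ᵐ[volume.restrict (Icc a b)] ((xOp n a).apply a b (c, D)).2) :
    MemWn a b xh ∧ opD a b xh =ᵐ[volume.restrict (Icc a b)] D ∧
      opF a b xh =ᵐ[volume.restrict (Icc a b)] ((fOp n a b).apply a b (c, D)).2 ∧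
      opC a b xh a = c ∧ opC a b xh b = ((fOp n a b).apply a b (c, D)).1 := by
  have hp : ∀ p : XIdx n, (fun s => xh s p) =ᵐ[volume.restrict (Icc a b)]
      taylor a p.1 (coef c p) (fun θ => D θ p) 0 := fun p => by
    filter_upwards [h, ae_restrict_mem measurableSet_Icc] with s hs hI
    rw [hs, xOp_apply hD hI]
  have hW := fun p => memW_of_ae_eq_taylor hab (hD p) (hp p)
  refine ⟨fun p => (hW p).1, ae_eq_of_forall_ae fun p => ?_, ae_eq_of_forall_ae fun f => ?_,
    ?_, ?_⟩
  · have := (hW p).2.1 p.1 le_rfl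
    rwa [taylor_of_le le_rfl] at this
  · filter_upwards [(hW f.1.2).2.1 f.1.1 f.2, ae_restrict_mem measurableSet_Icc] with s hs hI
    rw [fOp_apply_snd hD hI, ← hs]
    rfl
  · ext e
    have h1 := (hW e.1.2).2.2 e.1.1 e.2 (left_mem_Icc.2 hab.le)
    rw [taylor_self _ _ e.2, coef_idx] at h1
    exact h1
  · ext e
    rw [fOp_apply_fst hab.le hD]
    exact (hW e.1.2).2.2 e.1.1 e.2 (right_mem_Icc.2 hab.le)

/-- A function in `Wⁿ` is determined by its highest derivatives and its boundary values at `a`. -/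
theorem MemWn.ae_eq (hab : a < b) {xh : ℝ → XIdx n → ℝ} (h : MemWn a b xh) :
    xh =ᵐ[volume.restrict (Icc a b)] ((xOp n a).apply a b (opC a b xh a, opD a b xh)).2 := by
  -- These coefficients come componentwise from Taylor's formula with no link to boundary values
  -- yet; the final rewrite identifies them with the continuous representatives at `a`.
  choose c hc using fun p => (h p).exists_taylor hab
  have hx : xh =ᵐ[volume.restrict (Icc a b)]
      ((xOp n a).apply a b (fun e => c e.1.2 e.1.1, opD a b xh)).2 := by
    refine ae_eq_of_forall_ae fun p => ?_
    filter_upwards [hc p, ae_restrict_mem measurableSet_Icc] with s hs hI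
    rw [xOp_apply (opD_mem xh) hI, hs]
    simp only [taylor]
    split_ifs with h0
    · congr 1
      refine Finset.sum_congr rfl fun k hk => ?_
      have : k + 1 ≤ (p.1 : ℕ) := (Finset.mem_Ico.1 hk).2
      rw [coef, dif_pos this]
    · rfl
  rwa [(memWn_of_ae_eq hab (opD_mem xh) hx).2.2.2.1]

end BlockForm

/-! ### Boundary conditions -/

section Boundary

variable {N : ℕ} {n : Fin (N + 1) → ℕ} {a b : ℝ} {nBC nx nz ny nw nu nv nr : ℕ}

theorem minv_spec {m k : Type} [Fintype m] [Fintype k] [DecidableEq m] [DecidableEq k]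
    {M : Matrix m k ℝ} (h : IsInvertible M) : M * minv M = 1 ∧ minv M * M = 1 := by
  rw [minv, dif_pos h]
  exact h.choose_spec

/-- Since `fOp` has zero kernel above the diagonal, the truncated integral in the definition of B_Q
is an integral of its full kernel over `[a, b]`. -/
theorem fOp_ker_mul (Gb : BcParams n a b nBC nv) {η : ℝ} (hη : η ∈ Icc a b) :
    mint η b (fun θ => Gb.BI θ * matU2 n * matQ n (θ - η))
      = matInt a b (fun θ => Gb.BI θ * (fOp n a b).ker θ η) := by
  ext i j
  simp only [mint, matInt, Matrix.of_apply]
  rw [integral_upper_eq hη]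
  congr 1
  ext θ
  simp only [PI4.ker, fOp, Matrix.mul_assoc]
  split_ifs <;> simp

theorem matQ_end_mem {r : ENNReal} : MatLp a b r (fun s => matQ n (b - s)) := fOp_Q1_mem

theorem fromRows_mem {r : ENNReal} {m m' k : Type} {M : ℝ → Matrix m k ℝ} {M' : ℝ → Matrix m' k ℝ}
    (h : MatLp a b r M) (h' : MatLp a b r M') :
    MatLp a b r (fun s => Matrix.fromRows (M s) (M' s)) := by
  rintro (i | i) j
  · exact h i j
  · exact h' i j

theorem fromCols_mem {r : ENNReal} {m k k' : Type} {M : ℝ → Matrix m k ℝ} {M' : ℝ → Matrix m k' ℝ}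
    (h : MatLp a b r M) (h' : MatLp a b r M') :
    MatLp a b r (fun s => Matrix.fromCols (M s) (M' s)) := by
  rintro i (j | j)
  · exact h i j
  · exact h' i j

/-- The function `B_T B_Q`, up to a null set. -/
noncomputable def BTQ (Gb : BcParams n a b nBC nv) (s : ℝ) : Matrix (Fin nBC) (XIdx n) ℝ :=
  (Gb.BI s * matU1 n + matInt a b (fun θ => Gb.BI θ * (fOp n a b).ker θ s))
    - Gb.B * Matrix.fromRows (0 : Matrix (CIdx n) (XIdx n) ℝ) (matQ n (b - s))

theorem BTQ_row_mem (Gb : BcParams n a b nBC nv) : MatLp a b 2 (fun s =>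
    Gb.BI s * matU1 n + matInt a b (fun θ => Gb.BI θ * (fOp n a b).ker θ s)) :=
  (MatLp.mul_right Gb.BI_mem (MatLp.const _ _)).add (fOp_reg.ker.coslice_mem Gb.BI_mem)

theorem BTQ_mem (Gb : BcParams n a b nBC nv) : MatLp a b 2 (BTQ Gb) :=
  (BTQ_row_mem Gb).sub ((fromRows_mem (MatLp.const _ 0) matQ_end_mem).const_mul _)

theorem BQ_eq (Gb : BcParams n a b nBC nv) {s : ℝ} (hs : s ∈ Icc a b) :
    BQ Gb s = minv (BT Gb) * BTQ Gb s := by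
  have h : BQ Gb s = minv (BT Gb) * (Gb.BI s * matU1 n
      + mint s b (fun θ => Gb.BI θ * matU2 n * matQ n (θ - s))
      - Gb.B * Matrix.fromRows (0 : Matrix (CIdx n) (XIdx n) ℝ) (matQ n (b - s))) := rfl
  rw [h, BTQ, fOp_ker_mul Gb hs]

theorem MatLp.congr {m k : Type} {r : ENNReal} {M M' : ℝ → Matrix m k ℝ} (h : MatLp a b r M)
    (h' : ∀ s ∈ Icc a b, M' s = M s) : MatLp a b r M' := fun i j => by
  refine (memLp_congr_ae ?_).1 (h i j)
  exact (ae_restrict_iff' measurableSet_Icc).2 (ae_of_all _ fun s hs => by simp only [h' s hs])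

theorem BQ_mem (Gb : BcParams n a b nBC nv) : MatLp a b 2 (BQ Gb) :=
  ((BTQ_mem Gb).const_mul (minv (BT Gb))).congr fun _ hs => BQ_eq Gb hs

/-- The boundary values `(𝒞x̂)(a)` prescribed by the boundary conditions. -/
noncomputable def bcVal (Gb : BcParams n a b nBC nv) (v : Fin nv → ℝ) (D : ℝ → XIdx n → ℝ) :
    CIdx n → ℝ :=
  (minv (BT Gb) * Gb.Bv) *ᵥ v + ∫ θ in Icc a b, BQ Gb θ *ᵥ D θ

theorem bcVal_eq (Gb : BcParams n a b nBC nv) (v : Fin nv → ℝ) {D : ℝ → XIdx n → ℝ}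
    (hD : MemL2 a b D) :
    bcVal Gb v D = minv (BT Gb) *ᵥ (Gb.Bv *ᵥ v + ∫ θ in Icc a b, BTQ Gb θ *ᵥ D θ) := by
  rw [bcVal, mulVec_add, ← integral_const_mulVec _ (integrable_mulVec (BTQ_mem Gb) hD),
    ← mulVec_mulVec]
  congr 1
  refine setIntegral_congr_fun measurableSet_Icc fun θ hθ => ?_
  simp only [BQ_eq Gb hθ, mulVec_mulVec]

theorem integral_sumElim {m m' : Type} [Fintype m] [Fintype m'] {μ : Measure ℝ}
    {f : ℝ → m → ℝ} {g : ℝ → m' → ℝ} (hf : Integrable f μ) (hg : Integrable g μ) :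
    ∫ s, Sum.elim (f s) (g s) ∂μ = Sum.elim (∫ s, f s ∂μ) (∫ s, g s ∂μ) := by
  ext i
  rw [eval_integral]
  · rcases i with i | i
    · exact (eval_integral (fun i => hf.eval i) i).symm
    · exact (eval_integral (fun i => hg.eval i) i).symm
  · rintro (i | i)
    · exact hf.eval i
    · exact hg.eval i

/-- The residual of the boundary conditions. -/
theorem boundary_residual (hab : a < b) (Gb : BcParams n a b nBC nv) (v : Fin nv → ℝ)
    {xh : ℝ → XIdx n → ℝ} {c : CIdx n → ℝ} {D : ℝ → XIdx n → ℝ} (hD : MemL2 a b D)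
    (hF : opF a b xh =ᵐ[volume.restrict (Icc a b)] ((fOp n a b).apply a b (c, D)).2)
    (ha : opC a b xh a = c) (hb : opC a b xh b = ((fOp n a b).apply a b (c, D)).1) :
    (∫ s in a..b, Gb.BI s *ᵥ opF a b xh s) + (Gb.Bv *ᵥ v - Gb.B *ᵥ opB a b xh)
      = (Gb.Bv *ᵥ v + ∫ θ in Icc a b, BTQ Gb θ *ᵥ D θ) - BT Gb *ᵥ c := by
  have e1 : ∫ s in a..b, Gb.BI s *ᵥ opF a b xh s
      = ∫ s in Icc a b, Gb.BI s *ᵥ ((fOp n a b).apply a b (c, D)).2 s := by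
    rw [intervalIntegral.integral_of_le hab.le, ← integral_Icc_eq_integral_Ioc]
    refine integral_congr_ae ?_
    filter_upwards [hF] with s hs
    rw [hs]
  have i0 := integrable_mulVec (BTQ_row_mem Gb) hD
  have i1 := integrable_mulVec (matQ_end_mem (n := n) (a := a) (b := b)) hD
  have hQ0 := fromRows_mem (MatLp.const 2 (0 : Matrix (CIdx n) (XIdx n) ℝ))
    (matQ_end_mem (n := n) (a := a) (b := b))
  have i2 := integrable_mulVec hQ0 hD
  have i2' := integrable_mulVec (hQ0.const_mul Gb.B) hD
  have e2 : ∫ θ in Icc a b, BTQ Gb θ *ᵥ D θ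
      = (∫ θ in Icc a b, (Gb.BI θ * matU1 n
          + matInt a b (fun η => Gb.BI η * (fOp n a b).ker η θ)) *ᵥ D θ)
        - Gb.B *ᵥ Sum.elim (0 : CIdx n → ℝ) (∫ θ in Icc a b, matQ n (b - θ) *ᵥ D θ) := by
    simp only [BTQ, sub_mulVec]
    rw [integral_sub i0 i2']
    simp only [← mulVec_mulVec]
    rw [integral_const_mulVec _ i2]
    simp only [fromRows_mulVec, zero_mulVec]
    rw [integral_sumElim (integrable_zero _ _ _) i1]
    simp
  -- The boundary vector splits into its dependence on `c`, with T(0) = I at the left end, and the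
  -- remainder term, which contributes only at `b`.
  have e3 : opB a b xh = Matrix.fromRows (matT n 0) (matT n (b - a)) *ᵥ c
      + Sum.elim (0 : CIdx n → ℝ) (∫ θ in Icc a b, matQ n (b - θ) *ᵥ D θ) := by
    rw [opB, ha, hb, PI4.apply_fst hab.le, fromRows_mulVec, matT_zero, one_mulVec]
    ext (i | i) <;> simp [fOp]
  have e4 : matInt a b (fun θ => Gb.BI θ * (fOp n a b).Q2 θ)
      = mint a b (fun s => Gb.BI s * matU2 n * matT n (s - a)) := by
    rw [matInt_eq_mint hab.le]
    simp only [fOp, Matrix.mul_assoc]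
  rw [e1, PI4.integral_mulVec_apply fOp_reg (x := (c, D)) hD Gb.BI_mem fOp_Q2_mem, e2, e3, e4, BT]
  have e5 : ∀ η, (fOp n a b).R0 η = matU1 n := fun _ => rfl
  simp only [e5, sub_mulVec, mulVec_add, mulVec_mulVec]
  abel

/-- By `boundary_residual` the boundary condition reads `B_T c = ⋯` with a right-hand side depending
only on `v` and `D`. Admissibility enters here: the left inverse gives uniqueness of `c` and the
right inverse shows that the resulting `c` works. -/
theorem boundary_iff (hab : a < b) {Gb : BcParams n a b nBC nv} (hadm : Admissible Gb)
    (v : Fin nv → ℝ) {xh : ℝ → XIdx n → ℝ} {c : CIdx n → ℝ} {D : ℝ → XIdx n → ℝ}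
    (hD : MemL2 a b D)
    (h : xh =ᵐ[volume.restrict (Icc a b)] ((xOp n a).apply a b (c, D)).2) :
    xh ∈ domX Gb v ↔ c = bcVal Gb v D := by
  obtain ⟨hW, -, hF, ha, hb⟩ := memWn_of_ae_eq hab hD h
  obtain ⟨h1, h2⟩ := minv_spec hadm
  rw [bcVal_eq Gb v hD]
  change MemWn a b xh ∧ _ = 0 ↔ _
  rw [boundary_residual hab Gb v hD hF ha hb, sub_eq_zero]
  constructor
  · rintro ⟨-, h0⟩
    rw [h0, mulVec_mulVec, h2, one_mulVec]
  · intro h0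
    refine ⟨hW, ?_⟩
    rw [h0, mulVec_mulVec, h1, one_mulVec]

theorem ae_eq_of_mem_domX (hab : a < b) {Gb : BcParams n a b nBC nv} (hadm : Admissible Gb)
    {v : Fin nv → ℝ} {xh : ℝ → XIdx n → ℝ} (h : xh ∈ domX Gb v) :
    xh =ᵐ[volume.restrict (Icc a b)]
      ((xOp n a).apply a b (bcVal Gb v (opD a b xh), opD a b xh)).2 := by
  have h1 := MemWn.ae_eq hab h.1
  rwa [(boundary_iff hab hadm v (opD_mem xh) h1).1 h] at h1

/-! ### The operators `𝒯` and `Υ` -/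

/-- The kernels of 𝒯 and Υ are the Taylor kernel below the diagonal plus a separable term `M * L θ`
on both sides of it. The separable term integrates to `M` times a constant vector, which is the
`D`-dependent part of the prescribed boundary value. -/
theorem integral_lowRank {m k l : Type} [Fintype m] [Fintype k] [Fintype l] {s : ℝ}
    (hs : s ∈ Icc a b) (M : Matrix m k ℝ) {L : ℝ → Matrix k l ℝ} (hL : MatLp a b 2 L)
    {H : ℝ → Matrix m l ℝ} (hH : MatLp a b 2 H) {D : ℝ → l → ℝ} (hD : MemL2 a b D) :
    (∫ θ in a..s, (H θ + M * L θ) *ᵥ D θ) + ∫ θ in s..b, (M * L θ) *ᵥ D θ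
      = M *ᵥ (∫ θ in Icc a b, L θ *ᵥ D θ) + ∫ θ in a..s, H θ *ᵥ D θ := by
  have hab := hs.1.trans hs.2
  have ha : a ∈ Icc a b := left_mem_Icc.2 hab
  have i1 := integrable_mulVec hL hD
  have i2 := integrable_mulVec (hL.const_mul M) hD
  have i3 := integrable_mulVec hH hD
  simp only [add_mulVec]
  rw [intervalIntegral.integral_add (intervalIntegrable_of_Icc i3 ha hs)
      (intervalIntegrable_of_Icc i2 ha hs), add_assoc,
    intervalIntegral.integral_add_adjacent_intervals (intervalIntegrable_of_Icc i2 ha hs)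
      (intervalIntegrable_of_Icc i2 hs (right_mem_Icc.2 hab)),
    intervalIntegral.integral_of_le hab, ← integral_Icc_eq_integral_Ioc]
  simp only [← mulVec_mulVec]
  rw [integral_const_mulVec _ i1, add_comm]

theorem matQ_slice_mem {m : Type} (M : Matrix m (CIdx n) ℝ) (s : ℝ) :
    MatLp a b 2 (fun θ => M * matQ n (s - θ)) :=
  MatLp.of_continuous (continuous_const_mul_entry _ fun i j =>
    (continuous_matQ i j).comp (continuous_const.sub continuous_id))

/-- Υ is `fOp` after eliminating `c`: inserting `bcVal` for `c` turns the rows of `fOp`, together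
with identity rows for `v` and `c`, into the rows of Υ. -/
theorem Ups_apply_fst (hab : a < b) (Gb : BcParams n a b nBC nv) (v : Fin nv → ℝ)
    {D : ℝ → XIdx n → ℝ} (hD : MemL2 a b D) :
    ((Ups Gb).apply a b (v, D)).1 = Sum.elim v (Sum.elim (bcVal Gb v D)
      ((fOp n a b).apply a b (bcVal Gb v D, D)).1) := by
  have i1 := integrable_mulVec (BQ_mem Gb) hD
  have i2 := integrable_mulVec ((BQ_mem Gb).const_mul (matT n (b - a))) hD
  have i3 := integrable_mulVec (matQ_end_mem (n := n) (a := a) (b := b)) hD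
  have i4 : Integrable (fun θ => (matT n (b - a) * BQ Gb θ + matQ n (b - θ)) *ᵥ D θ)
      (volume.restrict (Icc a b)) := by
    simp only [add_mulVec]
    exact i2.add i3
  have i5 : Integrable (fun θ => Sum.elim (BQ Gb θ *ᵥ D θ)
      ((matT n (b - a) * BQ Gb θ + matQ n (b - θ)) *ᵥ D θ)) (volume.restrict (Icc a b)) :=
    Integrable.of_eval (by
      rintro (i | i)
      · exact i1.eval i
      · exact i4.eval i)
  rw [PI4.apply_fst hab.le, PI4.apply_fst hab.le]
  simp only [Ups, fOp, fromRows_mulVec, zero_mulVec, one_mulVec]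
  rw [integral_sumElim (integrable_zero _ _ _) i5, integral_sumElim i1 i4]
  simp only [add_mulVec]
  rw [integral_add i2 i3]
  simp only [← mulVec_mulVec]
  rw [integral_const_mulVec _ i1]
  ext (i | i | i)
  · simp
  · simp [bcVal, mulVec_mulVec]
  · simp only [bcVal, mulVec_add, mulVec_mulVec, Sum.elim_inr, Pi.add_apply, ← Matrix.mul_assoc]
    ring

theorem Ups_apply_snd (Gb : BcParams n a b nBC nv) (v : Fin nv → ℝ) {D : ℝ → XIdx n → ℝ}
    (hD : MemL2 a b D) {s : ℝ} (hs : s ∈ Icc a b) :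
    ((Ups Gb).apply a b (v, D)).2 s = ((fOp n a b).apply a b (bcVal Gb v D, D)).2 s := by
  have h := integral_lowRank hs (matU2 n * matT n (s - a)) (BQ_mem Gb)
    (matQ_slice_mem (matU2 n) s) hD
  simp only [PI4.apply, Ups, fOp, RD1, RD2, zero_mulVec, intervalIntegral.integral_zero, add_zero]
  simp only [add_comm (matU2 n * matT n (s - a) * BQ Gb _)]
  rw [add_assoc (matU1 n *ᵥ D s), h, bcVal]
  simp only [mulVec_add, mulVec_mulVec]
  abel

theorem KerL2.mul_matrix {m k l : Type} [Fintype k] {F : ℝ → Matrix m k ℝ}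
    (hF : ∀ i j, Continuous fun s => F s i j) {L : ℝ → Matrix k l ℝ} (hL : MatLp a b 2 L) :
    MatKer a b (fun s θ => F s * L θ) := fun i j => by
  simp only [Matrix.mul_apply]
  exact KerL2.sum _ fun k _ => KerL2.mul (hF i k) (hL k j)

theorem RD2_ker (Gb : BcParams n a b nBC nv) : MatKer a b (RD2 Gb) :=
  KerL2.mul_matrix (continuous_const_mul_entry _ fun i j =>
    (continuous_matT i j).comp (continuous_id.sub continuous_const)) (BQ_mem Gb)

/-- The composition theorem needs this parameter in L_∞, not just in L₂; it is a continuous matrix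
times a constant one. -/
theorem Ups_Q2_mem (Gb : BcParams n a b nBC nv) : MatLp a b ⊤ (Ups Gb).Q2 := fun i j => by
  simp only [Ups, Matrix.mul_apply (M := matU2 n * matT n _)]
  exact memLp_finsetSum _ fun k _ => (fOp_Q2_mem i k).mul_const _

theorem Ups_reg (Gb : BcParams n a b nBC nv) : (Ups Gb).Reg a b where
  Q1 := fromRows_mem (MatLp.const _ 0) (fromRows_mem (BQ_mem Gb)
    (((BQ_mem Gb).const_mul _).add matQ_end_mem))
  Q2 := (Ups_Q2_mem Gb).two
  R0 := MatLp.const _ _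
  R1 := fun i j => (RD2_ker Gb i j).add (MatKer.of_continuous
    (continuous_const_mul_entry (matU2 n) continuous_matQ) i j)
  R2 := RD2_ker Gb

/-- `Υ` maps `(v, 𝒟x̂)` to `(v, ℬx̂, ℱx̂)`. -/
theorem Ups_opD (hab : a < b) {Gb : BcParams n a b nBC nv} {v : Fin nv → ℝ}
    {xh : ℝ → XIdx n → ℝ} {D : ℝ → XIdx n → ℝ} (hD : MemL2 a b D)
    (h : xh =ᵐ[volume.restrict (Icc a b)] ((xOp n a).apply a b (bcVal Gb v D, D)).2) :
    ((Ups Gb).apply a b (v, D)).1 = Sum.elim v (opB a b xh) ∧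
      ((Ups Gb).apply a b (v, D)).2 =ᵐ[volume.restrict (Icc a b)] opF a b xh := by
  obtain ⟨-, -, hF, ha, hb⟩ := memWn_of_ae_eq hab hD h
  refine ⟨by rw [Ups_apply_fst hab Gb v hD, opB, ha, hb], ?_⟩
  filter_upwards [hF, ae_restrict_mem measurableSet_Icc] with s hs hI
  rw [Ups_apply_snd Gb v hD hI, hs]

end Boundary

/-! ### The PIE operators -/

section Representation

variable {N : ℕ} {n : Fin (N + 1) → ℕ} {a b : ℝ} {nBC nx nz ny nw nu nv nr : ℕ}

theorem Xi_reg (Gp : PdeParams n a b nv nr) : (Xi Gp).Reg a b where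
  Q1 := MatLp.two Gp.Cr_mem
  Q2 := (fromCols_mem Gp.Bxv_mem Gp.Bxb_mem).two
  R0 := Gp.A0_mem
  R1 := fun i j => KerL2.of_memLp_top (Gp.A1_mem i j)
  R2 := fun i j => KerL2.of_memLp_top (Gp.A2_mem i j)

theorem sub_Q1_mem (Gb : BcParams n a b nBC nv) (Gp : PdeParams n a b nv nr) :
    MatLp a b 2 (sub Gb Gp).Q1 :=
  PI4.comp_Q1_mem (Xi_reg Gp) (Ups_reg Gb)

theorem PI4.apply_fst_congr {m k p q : Type} [Fintype m] [Fintype k] [Fintype p] [Fintype q]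
    (hab : a ≤ b) (K : PI4 m k p q) (c : k → ℝ) {x y : ℝ → q → ℝ}
    (h : x =ᵐ[volume.restrict (Icc a b)] y) :
    (K.apply a b (c, x)).1 = (K.apply a b (c, y)).1 := by
  rw [PI4.apply_fst hab, PI4.apply_fst hab]
  congr 1
  refine integral_congr_ae ?_
  filter_upwards [h] with θ hθ
  rw [hθ]

theorem PI4.apply_snd_congr {m k p q : Type} [Fintype m] [Fintype k] [Fintype p] [Fintype q]
    (K : PI4 m k p q) (c : k → ℝ) {x y : ℝ → q → ℝ}
    (h : x =ᵐ[volume.restrict (Icc a b)] y) :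
    (K.apply a b (c, x)).2 =ᵐ[volume.restrict (Icc a b)] (K.apply a b (c, y)).2 := by
  filter_upwards [h, ae_restrict_mem measurableSet_Icc] with s hs hI
  simp only [PI4.apply]
  rw [hs, integral_congr_Ioo le_rfl hI.1 hI.2 (h.mono fun θ hθ _ _ => by rw [hθ]),
    integral_congr_Ioo hI.1 hI.2 le_rfl (h.mono fun θ hθ _ _ => by rw [hθ])]

/-- The output of the PDE subsystem in terms of `(v, 𝒟x̂)`. -/
theorem sub_apply_fst (hab : a < b) {Gb : BcParams n a b nBC nv} (Gp : PdeParams n a b nv nr)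
    {v : Fin nv → ℝ} {xh : ℝ → XIdx n → ℝ} {D : ℝ → XIdx n → ℝ} (hD : MemL2 a b D)
    (h : xh =ᵐ[volume.restrict (Icc a b)] ((xOp n a).apply a b (bcVal Gb v D, D)).2) :
    ((sub Gb Gp).apply a b (v, D)).1
      = Gp.Drb *ᵥ opB a b xh + ∫ θ in a..b, Gp.Cr θ *ᵥ opF a b xh θ := by
  obtain ⟨h1, h2⟩ := Ups_opD hab hD h
  rw [sub, PI4.comp_apply_fst hab.le (Xi_reg Gp) (Ups_reg Gb) (Ups_Q2_mem Gb) (x := (v, D)) hD]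
  have e : (Ups Gb).apply a b (v, D)
      = (Sum.elim v (opB a b xh), ((Ups Gb).apply a b (v, D)).2) := Prod.ext h1 rfl
  rw [e, PI4.apply_fst_congr hab.le _ _ h2]
  simp only [PI4.apply, Xi, fromCols_mulVec_sumElim, zero_mulVec, zero_add]

/-- The dynamics of the PDE subsystem in terms of `(v, 𝒟x̂)`. -/
theorem sub_apply_snd (hab : a < b) {Gb : BcParams n a b nBC nv} (Gp : PdeParams n a b nv nr)
    {v : Fin nv → ℝ} {xh : ℝ → XIdx n → ℝ} {D : ℝ → XIdx n → ℝ} (hD : MemL2 a b D)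
    (h : xh =ᵐ[volume.restrict (Icc a b)] ((xOp n a).apply a b (bcVal Gb v D, D)).2) :
    ((sub Gb Gp).apply a b (v, D)).2 =ᵐ[volume.restrict (Icc a b)] fun s =>
      Gp.A0 s *ᵥ opF a b xh s + (Gp.Bxv s *ᵥ v + Gp.Bxb s *ᵥ opB a b xh)
        + ((∫ θ in a..s, Gp.A1 s θ *ᵥ opF a b xh θ) + ∫ θ in s..b, Gp.A2 s θ *ᵥ opF a b xh θ) := by
  obtain ⟨h1, h2⟩ := Ups_opD hab hD h
  have e : (Ups Gb).apply a b (v, D)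
      = (Sum.elim v (opB a b xh), ((Ups Gb).apply a b (v, D)).2) := Prod.ext h1 rfl
  have e1 := PI4.comp_apply_snd hab.le (Xi_reg Gp) (Ups_reg Gb) (Ups_Q2_mem Gb) (x := (v, D)) hD
  rw [e] at e1
  refine e1.trans ((PI4.apply_snd_congr _ _ h2).trans (Eventually.of_forall fun s => ?_))
  simp only [PI4.apply, Xi, fromCols_mulVec_sumElim]
  abel

theorem PI4.applyVec_fst {m k p : Type} [Fintype m] [Fintype k] [Fintype p]
    (K : PI4 m k p (Fin 0)) (x : k → ℝ) : (K.applyVec a b x).1 = K.P *ᵥ x := by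
  simp [PI4.applyVec, PI4.apply]

theorem PI4.applyVec_snd {m k p : Type} [Fintype m] [Fintype k] [Fintype p]
    (K : PI4 m k p (Fin 0)) (x : k → ℝ) (s : ℝ) : (K.applyVec a b x).2 s = K.Q2 s *ᵥ x := by
  simp [PI4.applyVec, PI4.apply]

/-- The equations for ẋ, `z` and `y` all have the shape `C x + Dw w + Du u + Dr r`, so eliminating
`r` once serves all three. -/
theorem output_eq {m : Type} [Fintype m] (Go : OdeParams nx nz ny nw nu nv nr)
    (Gb : BcParams n a b nBC nv) (Gp : PdeParams n a b nv nr) (hab : a ≤ b)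
    (C : Matrix m (Fin nx) ℝ) (Dw : Matrix m (Fin nw) ℝ) (Du : Matrix m (Fin nu) ℝ)
    (Dr : Matrix m (Fin nr) ℝ) (x : Fin nx → ℝ) (w : Fin nw → ℝ) (u : Fin nu → ℝ)
    {D : ℝ → XIdx n → ℝ} (hD : MemL2 a b D) :
    ((C + Dr * Drv Gb Gp * Go.Cv) *ᵥ x + ∫ θ in a..b, (Dr * (sub Gb Gp).Q1 θ) *ᵥ D θ)
        + (Dw + Dr * Drv Gb Gp * Go.Dvw) *ᵥ w + (Du + Dr * Drv Gb Gp * Go.Dvu) *ᵥ u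
      = C *ᵥ x + Dw *ᵥ w + Du *ᵥ u
        + Dr *ᵥ ((sub Gb Gp).apply a b (Go.Cv *ᵥ x + Go.Dvw *ᵥ w + Go.Dvu *ᵥ u, D)).1 := by
  have i := integrable_mulVec (sub_Q1_mem Gb Gp) hD
  rw [PI4.apply_fst hab, intervalIntegral.integral_of_le hab, ← integral_Icc_eq_integral_Ioc]
  simp only [← mulVec_mulVec, add_mulVec]
  rw [integral_const_mulVec _ i]
  simp only [mulVec_add, mulVec_mulVec, Drv]
  abel

variable (Go : OdeParams nx nz ny nw nu nv nr) (Gb : BcParams n a b nBC nv)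
  (Gp : PdeParams n a b nv nr)

theorem pieOf_rhs_fst (hab : a ≤ b) (x : Fin nx → ℝ) (w : Fin nw → ℝ) (u : Fin nu → ℝ)
    {D : ℝ → XIdx n → ℝ} (hD : MemL2 a b D) :
    ((pieOf Go Gb Gp).A.apply a b (x, D) + (pieOf Go Gb Gp).B1.applyVec a b w
        + (pieOf Go Gb Gp).B2.applyVec a b u).1
      = Go.A *ᵥ x + Go.Bxw *ᵥ w + Go.Bxu *ᵥ u
        + Go.Bxr *ᵥ ((sub Gb Gp).apply a b (Go.Cv *ᵥ x + Go.Dvw *ᵥ w + Go.Dvu *ᵥ u, D)).1 := by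
  rw [← output_eq Go Gb Gp hab Go.A Go.Bxw Go.Bxu Go.Bxr x w u hD]
  simp only [Prod.fst_add, PI4.applyVec_fst]
  rfl

theorem pieOf_rhs_snd (x : Fin nx → ℝ) (w : Fin nw → ℝ) (u : Fin nu → ℝ) (D : ℝ → XIdx n → ℝ) :
    ((pieOf Go Gb Gp).A.apply a b (x, D) + (pieOf Go Gb Gp).B1.applyVec a b w
        + (pieOf Go Gb Gp).B2.applyVec a b u).2
      = ((sub Gb Gp).apply a b (Go.Cv *ᵥ x + Go.Dvw *ᵥ w + Go.Dvu *ᵥ u, D)).2 := by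
  funext s
  simp only [Prod.snd_add, Pi.add_apply, PI4.applyVec_snd]
  simp only [PI4.apply, pieOf, mulVec_add, mulVec_mulVec]
  abel

theorem pieOf_z (hab : a ≤ b) (x : Fin nx → ℝ) (w : Fin nw → ℝ) (u : Fin nu → ℝ)
    {D : ℝ → XIdx n → ℝ} (hD : MemL2 a b D) :
    ((pieOf Go Gb Gp).C1.apply a b (x, D)).1 + ((pieOf Go Gb Gp).D11.applyVec a b w).1
        + ((pieOf Go Gb Gp).D12.applyVec a b u).1
      = Go.Cz *ᵥ x + Go.Dzw *ᵥ w + Go.Dzu *ᵥ u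
        + Go.Dzr *ᵥ ((sub Gb Gp).apply a b (Go.Cv *ᵥ x + Go.Dvw *ᵥ w + Go.Dvu *ᵥ u, D)).1 := by
  rw [← output_eq Go Gb Gp hab Go.Cz Go.Dzw Go.Dzu Go.Dzr x w u hD]
  simp only [PI4.applyVec_fst]
  rfl

theorem pieOf_y (hab : a ≤ b) (x : Fin nx → ℝ) (w : Fin nw → ℝ) (u : Fin nu → ℝ)
    {D : ℝ → XIdx n → ℝ} (hD : MemL2 a b D) :
    ((pieOf Go Gb Gp).C2.apply a b (x, D)).1 + ((pieOf Go Gb Gp).D21.applyVec a b w).1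
        + ((pieOf Go Gb Gp).D22.applyVec a b u).1
      = Go.Cy *ᵥ x + Go.Dyw *ᵥ w + Go.Dyu *ᵥ u
        + Go.Dyr *ᵥ ((sub Gb Gp).apply a b (Go.Cv *ᵥ x + Go.Dvw *ᵥ w + Go.Dvu *ᵥ u, D)).1 := by
  rw [← output_eq Go Gb Gp hab Go.Cy Go.Dyw Go.Dyu Go.Dyr x w u hD]
  simp only [PI4.applyVec_fst]
  rfl

theorem pieOf_T_fst (x : RL2 (Fin nx) (XIdx n)) :
    ((pieOf Go Gb Gp).T.apply a b x).1 = x.1 := by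
  simp [PI4.apply, pieOf]

theorem pieOf_Tw_fst (w : Fin nw → ℝ) : ((pieOf Go Gb Gp).Tw.applyVec a b w).1 = 0 := by
  simp [PI4.applyVec_fst, pieOf]

theorem pieOf_Tu_fst (u : Fin nu → ℝ) : ((pieOf Go Gb Gp).Tu.applyVec a b u).1 = 0 := by
  simp [PI4.applyVec_fst, pieOf]

/-- The matrix function `[0; T₁(s-a)] B_T⁻¹`. -/
noncomputable def inputMap (s : ℝ) : Matrix (XIdx n) (Fin nBC) ℝ :=
  matT1 n (s - a) * minv (BT Gb)

/-- The input term factors through `B_v D_vw w`. This combination is the one with assumed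
regularity; `w` itself need not be differentiable. -/
theorem pieOf_Tw_snd (w : Fin nw → ℝ) (s : ℝ) : ((pieOf Go Gb Gp).Tw.applyVec a b w).2 s
    = inputMap Gb s *ᵥ (Gb.Bv *ᵥ (Go.Dvw *ᵥ w)) := by
  simp only [PI4.applyVec_snd, pieOf, Gv, inputMap, mulVec_mulVec, Matrix.mul_assoc]

theorem pieOf_Tu_snd (u : Fin nu → ℝ) (s : ℝ) : ((pieOf Go Gb Gp).Tu.applyVec a b u).2 s
    = inputMap Gb s *ᵥ (Gb.Bv *ᵥ (Go.Dvu *ᵥ u)) := by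
  simp only [PI4.applyVec_snd, pieOf, Gv, inputMap, mulVec_mulVec, Matrix.mul_assoc]

theorem inputMap_mem : MatLp a b 2 (inputMap Gb) := fun i j => by
  simp only [inputMap, Matrix.mul_apply]
  exact memLp_finsetSum _ fun k _ =>
    ((xOp_reg (n := n) (a := a) (b := b)).Q2 i k).mul_const _

/-- The state of the GPDE in terms of the state of the PIE. -/
theorem pieOf_state {x : Fin nx → ℝ} (w : Fin nw → ℝ) (u : Fin nu → ℝ) {D : ℝ → XIdx n → ℝ}
    (hD : MemL2 a b D) {s : ℝ} (hs : s ∈ Icc a b) :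
    ((pieOf Go Gb Gp).T.apply a b (x, D) + (pieOf Go Gb Gp).Tw.applyVec a b w
        + (pieOf Go Gb Gp).Tu.applyVec a b u).2 s
      = ((xOp n a).apply a b
          (bcVal Gb (Go.Cv *ᵥ x + Go.Dvw *ᵥ w + Go.Dvu *ᵥ u) D, D)).2 s := by
  have hQ : MatLp a b 2 (fun θ => matQ1 n (s - θ)) := MatLp.of_continuous fun i j =>
    (continuous_matQ1 i j).comp (continuous_const.sub continuous_id)
  have h := integral_lowRank hs (matT1 n (s - a)) (BQ_mem Gb) hQ hD
  simp only [Prod.snd_add, Pi.add_apply, PI4.applyVec_snd]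
  simp only [PI4.apply, pieOf, xOp, G1, G2, Gv, zero_mulVec, intervalIntegral.integral_zero,
    add_zero]
  rw [add_assoc (matG0 n *ᵥ D s), h, bcVal]
  simp only [mulVec_add, mulVec_mulVec, Matrix.mul_assoc]
  abel

theorem pieOf_T_mem {x : RL2 (Fin nx) (XIdx n)} (hx : MemL2 a b x.2) :
    MemL2 a b ((pieOf Go Gb Gp).T.apply a b x).2 := by
  -- With zero inputs the reconstructed state is exactly 𝒯x, so membership is inherited from the
  -- Taylor operator.
  have h : MemL2 a b ((xOp n a).apply a b (bcVal Gb (Go.Cv *ᵥ x.1 + Go.Dvw *ᵥ (0 : Fin nw → ℝ)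
      + Go.Dvu *ᵥ (0 : Fin nu → ℝ)) x.2, x.2)).2 := PI4.apply_snd_mem xOp_reg hx
  refine h.congr ?_
  filter_upwards [ae_restrict_mem measurableSet_Icc] with s hs
  rw [← pieOf_state Go Gb Gp 0 0 hx hs]
  simp [PI4.applyVec_snd]

end Representation

/-! ### Functions of time -/

section Time

variable {a b : ℝ}

theorem MemW.sum {ι : Type} (s : Finset ι) (hab : a ≤ b) {k : ℕ} {u : ι → ℝ → ℝ} (r : ι → ℝ)
    (hu : ∀ i ∈ s, MemW a b k (u i)) : MemW a b k (fun t => ∑ i ∈ s, r i * u i t) := by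
  refine ⟨memLp_finsetSum _ fun i hi => (hu i hi).1.const_mul _, fun l hl => ?_⟩
  refine ⟨fun t => ∑ i ∈ s, r i * wD a b l (u i) t,
    memLp_finsetSum _ fun i _ => (memLp_wD _ _).const_mul _, ?_⟩
  rw [isWeakDeriv_iff]
  intro φ hφ
  have h1 : ∀ i ∈ s, IntervalIntegrable (fun t => r i * u i t * iteratedDeriv l φ t) volume a b :=
    fun i hi => intervalIntegrable_mul_continuous hab ((hu i hi).1.const_mul _)
      (hφ.iteratedDeriv l).continuous
  have h2 : ∀ i ∈ s, IntervalIntegrable (fun t => r i * wD a b l (u i) t * φ t) volume a b :=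
    fun i _ => intervalIntegrable_mul_continuous hab ((memLp_wD _ _).const_mul _) hφ.continuous
  simp only [Finset.sum_mul]
  rw [intervalIntegral.integral_finsetSum h1, intervalIntegral.integral_finsetSum h2,
    Finset.mul_sum]
  refine Finset.sum_congr rfl fun i hi => ?_
  simp only [mul_assoc, intervalIntegral.integral_const_mul]
  rw [(wD_spec ((hu i hi).2 l hl)).2 φ hφ.1 hφ.2.1 hφ.2.2]
  ring

theorem MemW1e.mulVec {m k : Type} [Fintype k] (M : Matrix m k ℝ) {f : ℝ → k → ℝ}
    (hf : MemW1e f) : MemW1e (fun t => M *ᵥ f t) := fun i => by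
  simp only [Matrix.mulVec, dotProduct]
  exact ⟨continuousOn_finsetSum _ fun j _ => continuousOn_const.mul (hf j).1,
    fun T hT => MemW.sum _ hT.le _ fun j _ => (hf j).2 T hT⟩

theorem memW1e_zero {m : Type} : MemW1e (fun _ => (0 : m → ℝ)) := fun i => by
  refine ⟨continuousOn_const, fun T hT => ?_⟩
  have := MemW.sum (a := 0) (b := T) (∅ : Finset ℕ) hT.le (k := 1) (u := fun _ _ => 0) 0 (by simp)
  simpa using this

/-- Continuity upgrades Taylor's formula of order one to an identity at every point, so `f` is a
primitive of an integrable function and the Lebesgue differentiation theorem applies. -/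
theorem MemW.differentiableAt_ae (hab : a < b) {f : ℝ → ℝ} (hc : ContinuousOn f (Icc a b))
    (hf : MemW a b 1 f) : ∀ᵐ t, t ∈ Ioo a b → DifferentiableAt ℝ f t := by
  obtain ⟨c, h⟩ := hf.exists_taylor hab
  have hg := memLp_wD (a := a) (b := b) 1 f
  have heq : EqOn f (taylor a 1 c (wD a b 1 f) 0) (Icc a b) :=
    Measure.eqOn_Icc_of_ae_eq volume hab.ne h hc (continuousOn_taylor c hab.le hg zero_lt_one)
  have hi := intervalIntegrable_of_memLp hg (left_mem_Icc.2 hab.le) (right_mem_Icc.2 hab.le)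
  filter_upwards [hi.ae_hasDerivAt_integral] with t ht htI
  have hd := (ht (by rw [uIcc_of_le hab.le]; exact Ioo_subset_Icc_self htI) a left_mem_uIcc).const_add
    (c 0)
  refine (hd.congr_of_eventuallyEq ?_).differentiableAt
  filter_upwards [Ioo_mem_nhds htI.1 htI.2] with s hs
  have hs' := Ioo_subset_Icc_self hs
  rw [heq hs', taylor_succ c hg zero_lt_one hs', taylor_of_le (m := 1) (j := 0 + 1) le_rfl]

theorem ae_pos : ∀ᵐ t ∂(volume.restrict (Ici (0 : ℝ))), 0 < t := by
  rw [← restrict_Ioi_eq_restrict_Ici]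
  exact ae_restrict_mem measurableSet_Ioi

/-- Functions in `W_{1e}` are differentiable almost everywhere. -/
theorem MemW1e.ae_hasDerivAt {m : Type} [Fintype m] {f : ℝ → m → ℝ} (hf : MemW1e f) :
    ∀ᵐ t ∂(volume.restrict (Ici (0 : ℝ))), ∃ f', HasDerivAt f f' t := by
  -- The open half line is covered by countably many intervals `(0, k + 1)`, so the exceptional sets
  -- still form a null set.
  have h : ∀ᵐ t, ∀ i, ∀ k : ℕ, t ∈ Ioo (0 : ℝ) (k + 1) → DifferentiableAt ℝ (fun t => f t i) t :=
    ae_all_iff.2 fun i => ae_all_iff.2 fun k => by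
      have hk : (0 : ℝ) < k + 1 := by positivity
      exact MemW.differentiableAt_ae hk ((hf i).1.mono Icc_subset_Ici_self) ((hf i).2 _ hk)
  filter_upwards [ae_restrict_of_ae h, ae_pos] with t ht h0
  obtain ⟨k, hk⟩ := exists_nat_gt t
  exact ⟨_, (differentiableAt_pi.2 fun i => ht i k ⟨h0, by linarith⟩).hasDerivAt⟩

/-! ### Differentiation with respect to the L₂-norm. -/

theorem tendsto_slope_entry {k : Type} [Fintype k] {f : ℝ → k → ℝ} {f' : k → ℝ} {t : ℝ}
    (hf : HasDerivAt f f' t) (j : k) :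
    Tendsto (fun h : ℝ => h⁻¹ * (f (t + h) j - f t j) - f' j) (𝓝[≠] 0) (𝓝 0) := by
  have h1 : HasDerivAt (fun τ => f τ j) (f' j) t := hasDerivAt_pi.1 hf j
  have h2 := (hasDerivAt_iff_tendsto_slope_zero.1 h1).sub_const (f' j)
  rw [sub_self] at h2
  exact h2

theorem eLpNorm_mulVec_le {m k : Type} [Fintype k] {M : ℝ → Matrix m k ℝ} (hM : MatLp a b 2 M)
    (e : k → ℝ) (i : m) : eLpNorm (fun s => (M s *ᵥ e) i) 2 (volume.restrict (Icc a b))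
      ≤ ∑ j, ‖e j‖ₑ * eLpNorm (fun s => M s i j) 2 (volume.restrict (Icc a b)) := by
  have e1 : (fun s => (M s *ᵥ e) i) = ∑ j, e j • (fun s => M s i j) := by
    ext s
    simp only [Matrix.mulVec, dotProduct, Finset.sum_apply, Pi.smul_apply, smul_eq_mul, mul_comm]
  rw [e1]
  refine (eLpNorm_sum_le (fun j _ => (hM i j).1.const_smul _) (by norm_num)).trans ?_
  exact Finset.sum_le_sum fun j _ => (eLpNorm_const_smul _ _ _ _).le

/-- The error of the difference quotient is `M s` applied to a vector independent of `s` that tends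
to zero; its L₂-norm is controlled by the fixed norms of the entries of `M`. -/
theorem MatLp.hasL2DerivAt {m k : Type} [Fintype k] {M : ℝ → Matrix m k ℝ}
    (hM : MatLp a b 2 M) {f : ℝ → k → ℝ} {f' : k → ℝ} {t : ℝ} (hf : HasDerivAt f f' t) :
    HasL2DerivAt a b (fun τ s => M s *ᵥ f τ) (fun s => M s *ᵥ f') t := by
  refine ⟨hM.mulVec_const f', fun i => ?_⟩
  have hz : Tendsto (fun h : ℝ => ∑ j, ‖h⁻¹ * (f (t + h) j - f t j) - f' j‖ₑ
      * eLpNorm (fun s => M s i j) 2 (volume.restrict (Icc a b))) (𝓝[≠] 0)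
      (𝓝 (∑ j, ‖(0 : ℝ)‖ₑ * eLpNorm (fun s => M s i j) 2 (volume.restrict (Icc a b)))) :=
    tendsto_finsetSum _ fun j _ =>
      ENNReal.Tendsto.mul_const (tendsto_slope_entry hf j).enorm (Or.inr (hM i j).2.ne)
  simp only [enorm_zero, zero_mul, Finset.sum_const_zero] at hz
  refine tendsto_of_tendsto_of_tendsto_of_le_of_le tendsto_const_nhds hz (fun _ => zero_le)
    fun h => ?_
  have e : (fun s => h⁻¹ * ((M s *ᵥ f (t + h)) i - (M s *ᵥ f t) i) - (M s *ᵥ f') i)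
      = fun s => (M s *ᵥ (fun j => h⁻¹ * (f (t + h) j - f t j) - f' j)) i := by
    ext s
    simp only [Matrix.mulVec, dotProduct]
    rw [← Finset.sum_sub_distrib, Finset.mul_sum, ← Finset.sum_sub_distrib]
    exact Finset.sum_congr rfl fun j _ => by ring
  exact (congrArg (fun g => eLpNorm g 2 (volume.restrict (Icc a b))) e).le.trans
    (eLpNorm_mulVec_le hM _ i)

variable {ι : Type} {F G : ℝ → ℝ → ι → ℝ} {F' G' : ℝ → ι → ℝ} {t : ℝ}

theorem tendsto_const_add (t : ℝ) : Tendsto (fun h : ℝ => t + h) (𝓝[≠] 0) (𝓝 t) := by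
  have : Tendsto (fun h : ℝ => t + h) (𝓝 0) (𝓝 (t + 0)) :=
    tendsto_const_nhds.add tendsto_id
  rw [add_zero] at this
  exact this.mono_left nhdsWithin_le_nhds

theorem HasL2DerivAt.congr (h : HasL2DerivAt a b F F' t)
    (hF : ∀ᶠ τ in 𝓝 t, G τ =ᵐ[volume.restrict (Icc a b)] F τ)
    (hF' : G' =ᵐ[volume.restrict (Icc a b)] F') : HasL2DerivAt a b G G' t := by
  refine ⟨h.1.congr hF'.symm, fun i => (h.2 i).congr' ?_⟩
  filter_upwards [(tendsto_const_add t).eventually hF] with r hr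
  refine eLpNorm_congr_ae ?_
  filter_upwards [hr, hF.self_of_nhds, hF'] with s h1 h2 h3
  rw [h1, h2, h3]

theorem HasL2DerivAt.add (h : HasL2DerivAt a b F F' t) (h' : HasL2DerivAt a b G G' t)
    (hF : ∀ᶠ τ in 𝓝 t, MemL2 a b (F τ)) (hG : ∀ᶠ τ in 𝓝 t, MemL2 a b (G τ)) :
    HasL2DerivAt a b (fun τ s => F τ s + G τ s) (fun s => F' s + G' s) t := by
  refine ⟨h.1.add h'.1, fun i => ?_⟩
  have hz := (h.2 i).add (h'.2 i)
  rw [add_zero] at hz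
  refine tendsto_of_tendsto_of_tendsto_of_le_of_le' tendsto_const_nhds hz
    (Eventually.of_forall fun _ => zero_le) ?_
  filter_upwards [(tendsto_const_add t).eventually hF, (tendsto_const_add t).eventually hG]
    with r h1 h2
  have m1 := (((h1 i).sub (hF.self_of_nhds i)).const_mul r⁻¹).sub (h.1 i)
  have m2 := (((h2 i).sub (hG.self_of_nhds i)).const_mul r⁻¹).sub (h'.1 i)
  refine le_trans (le_of_eq ?_) (eLpNorm_add_le m1.1 m2.1 (by norm_num))
  congr 1
  ext s
  simp only [Pi.add_apply]
  ring

theorem HasL2DerivAt.neg (h : HasL2DerivAt a b F F' t) :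
    HasL2DerivAt a b (fun τ s => -F τ s) (fun s => -F' s) t := by
  refine ⟨h.1.neg, fun i => (h.2 i).congr fun r => ?_⟩
  rw [← eLpNorm_neg]
  congr 1
  ext s
  simp only [Pi.neg_apply]
  ring

/-! ### Square integrability in time. -/

theorem MemL2e.mulVec {m k : Type} [Fintype k] (M : Matrix m k ℝ) {f : ℝ → k → ℝ}
    (hf : MemL2e f) : MemL2e (fun t => M *ᵥ f t) := fun T hT =>
  (MatLp.const ⊤ M).mulVec (hf T hT)

theorem MemL2e.add {m : Type} {f g : ℝ → m → ℝ} (hf : MemL2e f) (hg : MemL2e g) :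
    MemL2e (fun t => f t + g t) := fun T hT => (hf T hT).add (hg T hT)

theorem MemL2e.congr {m : Type} {f g : ℝ → m → ℝ} (hf : MemL2e f)
    (h : ∀ t, 0 ≤ t → g t = f t) : MemL2e g := fun T hT =>
  (hf T hT).congr ((ae_restrict_iff' measurableSet_Icc).2
    (ae_of_all _ fun t ht => (h t ht.1).symm))

/-- A square integrable function of two variables integrated against a square integrable function
of one of them is square integrable. -/
theorem memLp_integral_mul {μ ν : Measure ℝ} [IsFiniteMeasure μ] [IsFiniteMeasure ν] {q : ℝ → ℝ}
    (hq : MemLp q 2 ν) {X : ℝ × ℝ → ℝ} (hX : MemLp X 2 (μ.prod ν)) :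
    MemLp (fun t => ∫ θ, q θ * X (t, θ) ∂ν) 2 μ := by
  have hm : AEStronglyMeasurable (fun t => ∫ θ, q θ * X (t, θ) ∂ν) μ :=
    (hq.1.comp_snd.mul hX.1).integral_prod_right'
  rw [memLp_two_iff_integrable_sq hm]
  have hX2 : Integrable (fun p => X p ^ 2) (μ.prod ν) := hX.integrable_sq
  -- For almost every `t`, Cauchy–Schwarz in θ bounds the square of the integral by the squared norm
  -- of `q` times the squared norm of the slice of `X`; the latter is integrable in `t` by Fubini.
  refine (hX2.integral_prod_left.const_mul (∫ θ, q θ ^ 2 ∂ν)).mono' (hm.pow 2) ?_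
  filter_upwards [hX.1.prodMk_left, hX2.prod_right_ae] with t ht ht2
  have hXt : MemLp (fun θ => X (t, θ)) 2 ν := (memLp_two_iff_integrable_sq ht).2 ht2
  rw [Real.norm_eq_abs, abs_of_nonneg (sq_nonneg _)]
  have hcs := integral_mul_norm_le_Lp_mul_Lq (μ := ν) (f := q) (g := fun θ => X (t, θ))
    Real.HolderConjugate.two_two (by simpa using hq) (by simpa using hXt)
  have h1 : |∫ θ, q θ * X (t, θ) ∂ν| ≤ ∫ θ, ‖q θ‖ * ‖X (t, θ)‖ ∂ν := by
    refine (norm_integral_le_integral_norm (fun θ => q θ * X (t, θ))).trans (le_of_eq ?_)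
    simp only [norm_mul]
  have h2 := h1.trans hcs
  simp only [Real.rpow_two, Real.norm_eq_abs, sq_abs] at h2
  rw [← Real.sqrt_eq_rpow, ← Real.sqrt_eq_rpow, ← Real.sqrt_mul
    (integral_nonneg fun θ => sq_nonneg _)] at h2
  have h3 := Real.sq_sqrt (mul_nonneg (integral_nonneg (μ := ν) fun θ => sq_nonneg (q θ))
    (integral_nonneg (μ := ν) fun θ => sq_nonneg (X (t, θ))))
  calc (∫ θ, q θ * X (t, θ) ∂ν) ^ 2 = |∫ θ, q θ * X (t, θ) ∂ν| ^ 2 := (sq_abs _).symm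
    _ ≤ _ := pow_le_pow_left₀ (abs_nonneg _) h2 2
    _ = _ := h3

end Time

/-! ### Equivalence of the GPDE and the PIE -/

section Equivalence

variable {N : ℕ} {n : Fin (N + 1) → ℕ} {a b : ℝ} {nBC nx nz ny nw nu nv nr : ℕ}
  {Go : OdeParams nx nz ny nw nu nv nr} {Gb : BcParams n a b nBC nv} {Gp : PdeParams n a b nv nr}
  {w : ℝ → Fin nw → ℝ} {u : ℝ → Fin nu → ℝ}

theorem pieOf_Tw_hasRL2DerivAt {t : ℝ} {β : Fin nBC → ℝ}
    (h : HasDerivAt (fun t => Gb.Bv *ᵥ (Go.Dvw *ᵥ w t)) β t) :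
    HasRL2DerivAt a b (fun τ => (pieOf Go Gb Gp).Tw.applyVec a b (w τ))
      (0, fun s => inputMap Gb s *ᵥ β) t := by
  refine ⟨?_, ?_⟩
  · simp only [pieOf_Tw_fst]
    exact hasDerivAt_const _ _
  · exact ((inputMap_mem Gb).hasL2DerivAt h).congr
      (Eventually.of_forall fun τ => Eventually.of_forall fun s => pieOf_Tw_snd Go Gb Gp (w τ) s)
      (ae_eq_refl _)

theorem pieOf_Tu_hasRL2DerivAt {t : ℝ} {β : Fin nBC → ℝ}
    (h : HasDerivAt (fun t => Gb.Bv *ᵥ (Go.Dvu *ᵥ u t)) β t) :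
    HasRL2DerivAt a b (fun τ => (pieOf Go Gb Gp).Tu.applyVec a b (u τ))
      (0, fun s => inputMap Gb s *ᵥ β) t := by
  refine ⟨?_, ?_⟩
  · simp only [pieOf_Tu_fst]
    exact hasDerivAt_const _ _
  · exact ((inputMap_mem Gb).hasL2DerivAt h).congr
      (Eventually.of_forall fun τ => Eventually.of_forall fun s => pieOf_Tu_snd Go Gb Gp (u τ) s)
      (ae_eq_refl _)

/-- Solutions of the GPDE give solutions of the PIE. -/
theorem isPIESolution_of_isGPDESolution (hab : a < b) (hadm : Admissible Gb)
    {x0 : Fin nx → ℝ} {xh0 : ℝ → XIdx n → ℝ} {x : ℝ → Fin nx → ℝ} {xh : ℝ → ℝ → XIdx n → ℝ}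
    {z : ℝ → Fin nz → ℝ} {y : ℝ → Fin ny → ℝ} {v : ℝ → Fin nv → ℝ} {r : ℝ → Fin nr → ℝ}
    (h : IsGPDEPresolution Go Gb Gp x0 xh0 w u x xh z y v r) :
    IsPIESolution a b (pieOf Go Gb Gp) (x0, opD a b xh0) w u (fun t => (x t, opD a b (xh t)))
      z y := by
  set V : ℝ → Fin nv → ℝ := fun t => Go.Cv *ᵥ x t + Go.Dvw *ᵥ w t + Go.Dvu *ᵥ u t with hV
  have hdom : ∀ t, 0 ≤ t → xh t ∈ domX Gb (V t) := h.state_mem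
  have hx : ∀ t, 0 ≤ t → xh t =ᵐ[volume.restrict (Icc a b)]
      ((xOp n a).apply a b (bcVal Gb (V t) (opD a b (xh t)), opD a b (xh t))).2 :=
    fun t ht => ae_eq_of_mem_domX hab hadm (hdom t ht)
  have hr : ∀ᵐ t ∂(volume.restrict (Ici (0 : ℝ))),
      ((sub Gb Gp).apply a b (V t, opD a b (xh t))).1 = r t := by
    filter_upwards [h.r_eq, ae_pos] with t ht h0
    rw [ht, sub_apply_fst hab Gp (opD_mem _) (hx t h0.le)]
  -- Solving the state representation for 𝒯 gives x̂ minus the two input terms, each differentiable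
  -- in L₂ almost everywhere in time.
  have hT : ∀ t, 0 ≤ t → ((pieOf Go Gb Gp).T.apply a b (x t, opD a b (xh t))).2
      =ᵐ[volume.restrict (Icc a b)] fun s => xh t s
        + (-(inputMap Gb s *ᵥ (Gb.Bv *ᵥ (Go.Dvw *ᵥ w t)))
          + -(inputMap Gb s *ᵥ (Gb.Bv *ᵥ (Go.Dvu *ᵥ u t)))) := by
    intro t ht
    filter_upwards [hx t ht, ae_restrict_mem measurableSet_Icc] with s hs hI
    rw [hs, ← pieOf_state Go Gb Gp (w t) (u t) (opD_mem (xh t)) hI]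
    simp only [Prod.snd_add, Pi.add_apply, pieOf_Tw_snd, pieOf_Tu_snd]
    abel
  refine ⟨h.w_mem, h.u_mem, ?_, ?_, ?_, ?_, opD_mem _, h.z_mem, h.y_mem, fun t _ => opD_mem _,
    ⟨h.x_init, ?_⟩, ?_, ?_, ?_⟩
  · simp only [pieOf_Tw_fst]
    exact memW1e_zero
  · intro s _
    simp only [pieOf_Tw_snd]
    exact h.Bw_mem.mulVec _
  · simp only [pieOf_Tu_fst]
    exact memW1e_zero
  · intro s _
    simp only [pieOf_Tu_snd]
    exact h.Bu_mem.mulVec _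
  -- The initial states agree only almost everywhere, which is enough for 𝒟 to give the same
  -- functions.
  · refine ae_eq_of_forall_ae fun p => Eventually.of_forall fun s => ?_
    refine congrFun (wD_congr hab.le ?_) s
    filter_upwards [h.xh_init] with θ hθ
    rw [hθ]
  · filter_upwards [h.x_dyn, h.xh_dyn, h.v_eq, hr, h.Bw_mem.ae_hasDerivAt, h.Bu_mem.ae_hasDerivAt,
      ae_pos] with t hxd hxhd hvt hrt hwt hut h0
    obtain ⟨d, hd, hd'⟩ := hxhd
    obtain ⟨βw, hβw⟩ := hwt
    obtain ⟨βu, hβu⟩ := hut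
    have hTw := pieOf_Tw_hasRL2DerivAt (Gp := Gp) hβw
    have hTu := pieOf_Tu_hasRL2DerivAt (Gp := Gp) hβu
    -- The representation is known for nonnegative times only. At `t > 0` these fill a
    -- neighbourhood, as a two-sided derivative requires, and `t = 0` is a null set.
    have hnear : ∀ᶠ τ in 𝓝 t, (0 : ℝ) ≤ τ := (lt_mem_nhds h0).mono fun τ h => h.le
    have hmem : ∀ f : Fin nBC → ℝ, MemL2 a b (fun s => -(inputMap Gb s *ᵥ f)) := fun f =>
      ((inputMap_mem Gb).mulVec_const f).neg
    refine ⟨(Go.A *ᵥ x t + Go.Bxw *ᵥ w t + Go.Bxu *ᵥ u t + Go.Bxr *ᵥ r t,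
      fun s => d s + (-(inputMap Gb s *ᵥ βw) + -(inputMap Gb s *ᵥ βu))), _, _,
      ⟨?_, ?_⟩, hTw, hTu, ?_, ?_⟩
    · simp only [pieOf_T_fst]
      exact hxd
    · refine HasL2DerivAt.congr (hd.add (HasL2DerivAt.add
        ((inputMap_mem Gb).hasL2DerivAt hβw).neg ((inputMap_mem Gb).hasL2DerivAt hβu).neg ?_ ?_)
        ?_ ?_) (hnear.mono hT) (ae_eq_refl _)
      · exact Eventually.of_forall fun τ => hmem _
      · exact Eventually.of_forall fun τ => hmem _
      · exact hnear.mono fun τ hτ => fun p => ((hdom τ hτ).1 p).1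
      · exact Eventually.of_forall fun τ => (hmem _).add (hmem _)
    · rw [Prod.fst_sub, pieOf_rhs_fst Go Gb Gp hab.le _ _ _ (opD_mem _), hrt]
      simp
    · filter_upwards [hd', sub_apply_snd hab Gp (opD_mem _) (hx t h0.le)] with s h1 h2
      rw [Prod.snd_sub, pieOf_rhs_snd, Pi.sub_apply, h2, h1, hvt]
      simp only [Prod.snd_add, Pi.add_apply, hV]
      abel
  · filter_upwards [h.z_eq, hr] with t ht hrt
    rw [pieOf_z Go Gb Gp hab.le _ _ _ (opD_mem _), hrt, ht]
  · filter_upwards [h.y_eq, hr] with t ht hrt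
    rw [pieOf_y Go Gb Gp hab.le _ _ _ (opD_mem _), hrt, ht]

/-- The state of the GPDE reconstructed from the state of the PIE satisfies the boundary
conditions. -/
theorem pieOf_reconstruct (hab : a < b) (hadm : Admissible Gb) {ux : RL2 (Fin nx) (XIdx n)}
    (hux : MemL2 a b ux.2) {x : Fin nx → ℝ} {xh : ℝ → XIdx n → ℝ} {w : Fin nw → ℝ}
    {u : Fin nu → ℝ} (h : (x, xh) = (pieOf Go Gb Gp).T.apply a b ux
      + (pieOf Go Gb Gp).Tw.applyVec a b w + (pieOf Go Gb Gp).Tu.applyVec a b u) :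
    x = ux.1 ∧
    xh =ᵐ[volume.restrict (Icc a b)] ((xOp n a).apply a b
      (bcVal Gb (Go.Cv *ᵥ x + Go.Dvw *ᵥ w + Go.Dvu *ᵥ u) ux.2, ux.2)).2 ∧
    xh ∈ domX Gb (Go.Cv *ᵥ x + Go.Dvw *ᵥ w + Go.Dvu *ᵥ u) := by
  have h1 : x = ux.1 := by
    have := congrArg Prod.fst h
    simpa [pieOf_T_fst, pieOf_Tw_fst, pieOf_Tu_fst] using this
  have h2 : xh =ᵐ[volume.restrict (Icc a b)] ((xOp n a).apply a b
      (bcVal Gb (Go.Cv *ᵥ x + Go.Dvw *ᵥ w + Go.Dvu *ᵥ u) ux.2, ux.2)).2 := by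
    filter_upwards [ae_restrict_mem measurableSet_Icc] with s hs
    rw [h1, ← pieOf_state Go Gb Gp w u hux hs]
    exact congrFun (congrArg Prod.snd h) s
  exact ⟨h1, h2, (boundary_iff hab hadm _ hux h2).2 rfl⟩

/-- The reconstructed output `r` is the finite-dimensional row of ΞΥ applied to `v` and the
distributed state, so `sub_apply_fst` can evaluate it. -/
theorem zeroCr_apply_fst (hab : a ≤ b) (ux : RL2 (Fin nx) (XIdx n)) (v : Fin nv → ℝ) :
    ((zeroCr nx Gb Gp).apply a b ux).1 + Drv Gb Gp *ᵥ v = ((sub Gb Gp).apply a b (v, ux.2)).1 := by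
  rw [PI4.apply_fst hab, PI4.apply_fst hab]
  simp only [zeroCr, Drv, zero_mulVec, zero_add]
  rw [add_comm]

/-- Solutions of the PIE give solutions of the GPDE. -/
theorem isGPDEPresolution_of_isPIESolution (hab : a < b) (hadm : Admissible Gb)
    (hBw : MemW1e (fun t => Gb.Bv *ᵥ (Go.Dvw *ᵥ w t)))
    (hBu : MemW1e (fun t => Gb.Bv *ᵥ (Go.Dvu *ᵥ u t)))
    {ux0 : RL2 (Fin nx) (XIdx n)} {ux : ℝ → RL2 (Fin nx) (XIdx n)} {z : ℝ → Fin nz → ℝ}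
    {y : ℝ → Fin ny → ℝ} {x0 : Fin nx → ℝ} {xh0 : ℝ → XIdx n → ℝ} {x : ℝ → Fin nx → ℝ}
    {xh : ℝ → ℝ → XIdx n → ℝ} {v : ℝ → Fin nv → ℝ} {r : ℝ → Fin nr → ℝ}
    (h : IsPIESolution a b (pieOf Go Gb Gp) ux0 w u ux z y)
    (h0 : (x0, xh0) = (pieOf Go Gb Gp).T.apply a b ux0
      + (pieOf Go Gb Gp).Tw.applyVec a b (w 0) + (pieOf Go Gb Gp).Tu.applyVec a b (u 0))
    (hx : ∀ t, 0 ≤ t → (x t, xh t) = (pieOf Go Gb Gp).T.apply a b (ux t)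
      + (pieOf Go Gb Gp).Tw.applyVec a b (w t) + (pieOf Go Gb Gp).Tu.applyVec a b (u t))
    (hv : ∀ t, 0 ≤ t → v t = Go.Cv *ᵥ x t + Go.Dvw *ᵥ w t + Go.Dvu *ᵥ u t)
    (hr : ∀ t, 0 ≤ t → r t = ((zeroCr nx Gb Gp).apply a b (ux t)).1 + Drv Gb Gp *ᵥ v t) :
    IsGPDEPresolution Go Gb Gp x0 xh0 w u x xh z y v r := by
  have hrec := fun t ht => pieOf_reconstruct hab hadm (h.state_mem t ht) (hx t ht)
  have hrec0 := pieOf_reconstruct hab hadm h.init_mem h0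
  have hrs : ∀ t, 0 ≤ t → r t = ((sub Gb Gp).apply a b
      (Go.Cv *ᵥ x t + Go.Dvw *ᵥ w t + Go.Dvu *ᵥ u t, (ux t).2)).1 := fun t ht => by
    rw [hr t ht, zeroCr_apply_fst hab.le, hv t ht]
  have hpos := ae_restrict_mem (μ := volume) (measurableSet_Ici (a := (0 : ℝ)))
  -- Adding the input terms to 𝒯ux restores the full state, and their derivatives cancel the ones
  -- subtracted in the PIE.
  have hdyn : ∀ᵐ t ∂(volume.restrict (Ici (0 : ℝ))), ∃ d : RL2 (Fin nx) (XIdx n),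
      HasDerivAt x d.1 t ∧ HasL2DerivAt a b xh d.2 t ∧
      EqRL2 a b d ((pieOf Go Gb Gp).A.apply a b (ux t) + (pieOf Go Gb Gp).B1.applyVec a b (w t)
        + (pieOf Go Gb Gp).B2.applyVec a b (u t)) := by
    filter_upwards [h.dynamics, ae_pos] with t ht ht0
    obtain ⟨dT, dTw, dTu, h1, h2, h3, h4⟩ := ht
    have hnear : ∀ᶠ τ in 𝓝 t, (0 : ℝ) ≤ τ := (lt_mem_nhds ht0).mono fun τ h => h.le
    have hmT : ∀ᶠ τ in 𝓝 t, MemL2 a b ((pieOf Go Gb Gp).T.apply a b (ux τ)).2 :=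
      hnear.mono fun τ hτ => pieOf_T_mem Go Gb Gp (h.state_mem τ hτ)
    have hmTw : ∀ τ, MemL2 a b ((pieOf Go Gb Gp).Tw.applyVec a b (w τ)).2 := fun τ =>
      ((inputMap_mem Gb).mulVec_const _).congr
        (Eventually.of_forall fun s => (pieOf_Tw_snd Go Gb Gp (w τ) s).symm)
    have hmTu : ∀ τ, MemL2 a b ((pieOf Go Gb Gp).Tu.applyVec a b (u τ)).2 := fun τ =>
      ((inputMap_mem Gb).mulVec_const _).congr
        (Eventually.of_forall fun s => (pieOf_Tu_snd Go Gb Gp (u τ) s).symm)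
    refine ⟨dT + dTw + dTu, ?_, ?_, ?_, ?_⟩
    · refine ((h1.1.add h2.1).add h3.1).congr_of_eventuallyEq (hnear.mono fun τ hτ => ?_)
      exact congrArg Prod.fst (hx τ hτ)
    · refine HasL2DerivAt.congr ((h1.2.add h2.2 hmT (Eventually.of_forall hmTw)).add h3.2
        (hmT.mono fun τ hτ => hτ.add (hmTw τ)) (Eventually.of_forall hmTu)) ?_ (ae_eq_refl _)
      exact hnear.mono fun τ hτ => Eventually.of_forall fun s =>
        congrFun (congrArg Prod.snd (hx τ hτ)) s
    · rw [Prod.fst_add, Prod.fst_add, h4.1]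
      simp only [Prod.fst_sub, Prod.fst_add]
      abel
    · filter_upwards [h4.2] with s hs
      simp only [Prod.snd_add, Prod.snd_sub, Pi.add_apply, Pi.sub_apply] at hs ⊢
      rw [hs]
      abel
  refine ⟨hrec0.2.2, h.w_mem, h.u_mem, hBw, hBu, h.z_mem, h.y_mem, fun t ht => (hrec t ht).2.2,
    ?_, ?_, ?_, ?_, ?_, ?_, ?_, ?_, ?_⟩
  · rw [(hrec 0 le_rfl).1, hrec0.1, h.init.1]
  · have e1 : xh 0 = _ := congrArg Prod.snd (hx 0 le_rfl)
    have e2 : xh0 = _ := congrArg Prod.snd h0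
    -- The finite-dimensional parts are equal, while the distributed parts agree only almost
    -- everywhere; 𝒯 respects this equality.
    have e3 : ux 0 = (ux0.1, (ux 0).2) := Prod.ext h.init.1 rfl
    have e4 := PI4.apply_snd_congr (pieOf Go Gb Gp).T ux0.1 h.init.2
    rw [e1, e2, e3]
    filter_upwards [e4] with s hs
    simp only [Prod.snd_add, Pi.add_apply, hs]
  · filter_upwards [hdyn, hpos] with t ht ht0
    obtain ⟨d, h1, -, h2⟩ := ht
    rw [hrs t ht0, (hrec t ht0).1, ← pieOf_rhs_fst Go Gb Gp hab.le _ _ _ (h.state_mem t ht0),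
      ← h2.1]
    exact h1
  · filter_upwards [h.z_eq, hpos] with t ht ht0
    rw [hrs t ht0, (hrec t ht0).1, ← pieOf_z Go Gb Gp hab.le _ _ _ (h.state_mem t ht0), ht]
  · filter_upwards [h.y_eq, hpos] with t ht ht0
    rw [hrs t ht0, (hrec t ht0).1, ← pieOf_y Go Gb Gp hab.le _ _ _ (h.state_mem t ht0), ht]
  · filter_upwards [hpos] with t ht0 using hv t ht0
  · filter_upwards [hpos] with t ht0
    rw [hv t ht0]
    exact (hrec t ht0).2.2
  · filter_upwards [hdyn, hpos] with t ht ht0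
    obtain ⟨d, -, h1, h2⟩ := ht
    refine ⟨d.2, h1, ?_⟩
    filter_upwards [h2.2, sub_apply_snd hab Gp (h.state_mem t ht0) (hrec t ht0).2.1] with s hs hs'
    rw [hv t ht0, ← hs', hs, (hrec t ht0).1, ← pieOf_rhs_snd Go Gb Gp]
  · filter_upwards [hpos] with t ht0
    rw [hrs t ht0, sub_apply_fst hab Gp (h.state_mem t ht0) (hrec t ht0).2.1]

/-- Entrywise the output is a sum of pairings of a fixed L₂ function with a jointly square
integrable one, which `memLp_integral_mul` covers. -/
theorem memL2e_zeroCr (hab : a ≤ b) {ux : ℝ → RL2 (Fin nx) (XIdx n)}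
    (hux : ∀ t, 0 ≤ t → MemL2 a b (ux t).2) (h : MemL2eRL2 a b ux) :
    MemL2e (fun t => ((zeroCr nx Gb Gp).apply a b (ux t)).1) := by
  intro T hT i
  have h1 : MemLp (fun t => ∑ j, ∫ θ in Icc a b, (sub Gb Gp).Q1 θ i j * (ux t).2 θ j) 2
      (volume.restrict (Icc 0 T)) :=
    memLp_finsetSum _ fun j _ => memLp_integral_mul (sub_Q1_mem Gb Gp i j) (h.2 T hT j)
  refine (memLp_congr_ae ?_).1 h1
  filter_upwards [ae_restrict_mem measurableSet_Icc] with t ht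
  rw [PI4.apply_fst hab, Pi.add_apply]
  simp only [zeroCr, zero_mulVec, Pi.zero_apply, zero_add]
  rw [integral_mulVec_apply (sub_Q1_mem Gb Gp) (hux t ht.1)]

end Equivalence

end GPDE

/-! ### The equivalence theorem. -/

theorem corollary2 {N nBC nx nz ny nw nu nv nr : ℕ} (n : Fin (N + 1) → ℕ) (a b : ℝ) (hab : a < b)
    (Go : GPDE.OdeParams nx nz ny nw nu nv nr) (Gb : GPDE.BcParams n a b nBC nv)
    (Gp : GPDE.PdeParams n a b nv nr) (hadm : GPDE.Admissible Gb)
    (w : ℝ → Fin nw → ℝ) (u : ℝ → Fin nu → ℝ)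
    (hw : GPDE.MemL2e w) (hBw : GPDE.MemW1e (fun t => Gb.Bv *ᵥ (Go.Dvw *ᵥ w t)))
    (hu : GPDE.MemL2e u) (hBu : GPDE.MemW1e (fun t => Gb.Bv *ᵥ (Go.Dvu *ᵥ u t))) :
    (∀ (x0 : Fin nx → ℝ) (xh0 : ℝ → GPDE.XIdx n → ℝ)
      (x : ℝ → Fin nx → ℝ) (xh : ℝ → ℝ → GPDE.XIdx n → ℝ)
      (z : ℝ → Fin nz → ℝ) (y : ℝ → Fin ny → ℝ) (v : ℝ → Fin nv → ℝ) (r : ℝ → Fin nr → ℝ),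
      (x0, xh0) ∈ GPDE.domXX Go Gb (w 0) (u 0) →
      GPDE.IsGPDESolution Go Gb Gp x0 xh0 w u x xh z y v r →
      GPDE.IsPIESolution a b (GPDE.pieOf Go Gb Gp) (x0, GPDE.opD a b xh0) w u
        (fun t => (x t, GPDE.opD a b (xh t))) z y) ∧
    (∀ (ux0 : GPDE.RL2 (Fin nx) (GPDE.XIdx n)) (ux : ℝ → GPDE.RL2 (Fin nx) (GPDE.XIdx n))
      (z : ℝ → Fin nz → ℝ) (y : ℝ → Fin ny → ℝ)
      (x0 : Fin nx → ℝ) (xh0 : ℝ → GPDE.XIdx n → ℝ)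
      (x : ℝ → Fin nx → ℝ) (xh : ℝ → ℝ → GPDE.XIdx n → ℝ)
      (v : ℝ → Fin nv → ℝ) (r : ℝ → Fin nr → ℝ),
      GPDE.MemRL2 a b ux0 →
      GPDE.IsPIESolution a b (GPDE.pieOf Go Gb Gp) ux0 w u ux z y →
      (x0, xh0) = (GPDE.pieOf Go Gb Gp).T.apply a b ux0
        + (GPDE.pieOf Go Gb Gp).Tw.applyVec a b (w 0)
        + (GPDE.pieOf Go Gb Gp).Tu.applyVec a b (u 0) →
      (∀ t, 0 ≤ t → (x t, xh t) = (GPDE.pieOf Go Gb Gp).T.apply a b (ux t)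
        + (GPDE.pieOf Go Gb Gp).Tw.applyVec a b (w t)
        + (GPDE.pieOf Go Gb Gp).Tu.applyVec a b (u t)) →
      (∀ t, 0 ≤ t → v t = Go.Cv *ᵥ x t + Go.Dvw *ᵥ w t + Go.Dvu *ᵥ u t) →
      (∀ t, 0 ≤ t → r t = ((GPDE.zeroCr nx Gb Gp).apply a b (ux t)).1
        + GPDE.Drv Gb Gp *ᵥ v t) →
      GPDE.IsGPDEPresolution Go Gb Gp x0 xh0 w u x xh z y v r ∧
      (GPDE.MemL2e v → GPDE.MemL2e r →
        GPDE.IsGPDESolution Go Gb Gp x0 xh0 w u x xh z y v r) ∧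
      (GPDE.MemL2eRL2 a b ux → GPDE.IsGPDESolution Go Gb Gp x0 xh0 w u x xh z y v r)) := by
  refine ⟨fun x0 xh0 x xh z y v r _ h =>
    GPDE.isPIESolution_of_isGPDESolution hab hadm h.toIsGPDEPresolution,
    fun ux0 ux z y x0 xh0 x xh v r _ h h0 hx hv hr => ?_⟩
  have hpre := GPDE.isGPDEPresolution_of_isPIESolution hab hadm hBw hBu h h0 hx hv hr
  refine ⟨hpre, fun h1 h2 => ⟨hpre, h1, h2⟩, fun hL => ?_⟩
  -- The finite-dimensional part of 𝒯ux is that of `ux`, and 𝒯_w, 𝒯_u contribute nothing to it. So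
  -- `x` inherits square integrability and `v` is a linear combination of L_{2e} functions.
  have hvL : GPDE.MemL2e v := by
    refine GPDE.MemL2e.congr (((hL.1.mulVec Go.Cv).add (hw.mulVec Go.Dvw)).add
      (hu.mulVec Go.Dvu)) fun t ht => ?_
    rw [hv t ht, (GPDE.pieOf_reconstruct hab hadm (h.state_mem t ht) (hx t ht)).1]
  exact ⟨hpre, hvL, ((GPDE.memL2e_zeroCr hab.le h.state_mem hL).add
    (hvL.mulVec (GPDE.Drv Gb Gp))).congr hr⟩
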